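/- Let $(M,S,D)$ be a constraint manifold: $M$ is a smooth manifold, $j:S\hookrightarrow M$ is a closed embedded submanifold, and $D\subset TS$ is a regular foliation (a smooth involutive distribution of constant rank) whose leaf space $M_{\mathrm{red}}=S/D$ is a smooth manifold, i.e. there is a surjective submersion $\pi:S\to M_{\mathrm{red}}$ whose fibres are the leaves of $D$ (so $\ker d\pi=D$). Manifolds are finite-dimensional, Hausdorff, second countable and without boundary; $\Gamma(D)$ denotes the smooth vector fields on $S$ with values in $D$. Put $A=C^\infty(M)$, $A_0=I_S=\{f\in A: f\circ j=0\}$, and let $\mathfrak X(A)$ be the derivations of $A$, with $\mathfrak X(A)_W=\{X: X(A_0)\subset A_0\}$ and $\mathfrak X(A)_0=\{X: X(A)\subset A_0\}$. Let $\mathcal F=\{X\in\mathfrak X(A): X|_S\in\Gamma(D)\}$. Define * $A'_W=\{f\in A: X(f)\in A_0 \text{ for all }X\in\mathcal F\}$, $A'_0=A_0$, $A'_{\mathrm{red}}=A'_W/A'_0$; * $\mathfrak Y_W=\{X\in\mathfrak X(A)_W: [\mathcal F,X]\subset\mathcal F\}$, $\mathfrak Y_0=\mathcal F$, $\mathfrak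 Y_{\mathrm{red}}=\mathfrak Y_W/\mathfrak Y_0$, a Lie–Rinehart algebra over $A'_{\mathrm{red}}$; * $B=\mathrm{CE}(\mathfrak X(A))$, where $B^k$ is the module of alternating $A$-multilinear maps $\mathfrak X(A)^k\to A$, with the usual operators $d$, $\iota_X$, $L_X$; $B_0^k$ consists of the $\alpha$ with $\alpha(Y_1,\dots,Y_k)\in A_0$ for all $Y_i\in\mathfrak X(A)_W$, and $B_W^k$ of the $\alpha$ with $\alpha(Y_1,\dots,Y_k)\in A_0$ whenever all $Y_i\in\mathfrak X(A)_W$ and at least one $Y_i\in\mathfrak X(A)_0$; * $B'_W=\{\alpha\in B_W: \iota_X\alpha,\ L_X\alpha\in B_0\text{ for all }X\in\mathfrak Y_0\}$, $B'_0=B_0$, $B'_{\mathrm{red}}=B'_W/B'_0$. Then the following hold. 1. Vector fields on $M$ are the derivations of $A$, via $Y\mapsto(f\mapsto Yf)$, and, for every $k$, differential $k$-forms $\sigma$ on $M$ are the elements $\alpha$ of $B^k$, via $\alpha(Y_1,\dots,Y_k)=\sigma(Y_1,\dots,Y_k)$. Under these identifications * $A'_W$ is the set of functions $f\in A$ for which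 $f\circ j$ is constant on the leaves of $D$; * $\mathfrak Y_0\subset\mathfrak Y_W$, $B'_0\subset B'_W$; * $\mathfrak Y_W=\{Y\in\mathfrak X(M): Y|_S\in\mathfrak X(S),\ [Y|_S,\Gamma(D)]\subset\Gamma(D)\}$ and $\mathfrak Y_0=\{Y\in\mathfrak X(M): Y|_S\in\Gamma(D)\}$; * $B'_W=\{\sigma\in\Omega(M): \iota_W j^*\sigma=0,\ L_W j^*\sigma=0\text{ for all }W\in\Gamma(D)\}$ and $B'_0=\{\sigma\in\Omega(M): j^*\sigma=0\}$. 2. There is an algebra isomorphism $\varphi:A'_{\mathrm{red}}\to C^\infty(M_{\mathrm{red}})$ with $\varphi([f])\circ\pi=f\circ j$, and, over $\varphi$, an isomorphism of Lie–Rinehart algebras $\Phi:\mathfrak Y_{\mathrm{red}}\to\mathfrak X(M_{\mathrm{red}})$ which sends $[Y]$ to the $\pi$-projection of $Y|_S$: $\Phi([Y])_{\pi(s)}=d\pi_s\big((Y|_S)_s\big)$ for all $s\in S$. 3. For every $k$ there is a linear isomorphism $\Psi:B'^{\,k}_{\mathrm{red}}\to\Omega^k(M_{\mathrm{red}})$ with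 $\pi^*\Psi([\sigma])=j^*\sigma$. These isomorphisms are linear over $\varphi$, they commute with the differentials (in particular $dB'_W\subset B'_W$), and $\Psi([\iota_X\alpha])=\iota_{\Phi([X])}\Psi([\alpha])$ for all $X\in\mathfrak Y_W$ and $\alpha\in B'_W$ (in particular $\iota_X\alpha\in B'_W$). -/

import Mathlib

open scoped Manifold ContDiff

/-! ### Constraint reduction of a commutative algebra -/

namespace ConstraintReduction

section Reduction

variable {S M : Type*} [CommRing S] [AddCommGroup M] [Module S M]

/-- The reduction `V_W / V_0` of a constraint module `V_0 ⊆ V_W ⊆ V_T`. -/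
def Red (W N : Submodule S M) : Type _ := W ⧸ N.comap W.subtype

instance Red.addCommGroup (W N : Submodule S M) : AddCommGroup (Red W N) :=
  inferInstanceAs (AddCommGroup (W ⧸ N.comap W.subtype))

instance Red.module (W N : Submodule S M) : Module S (Red W N) :=
  inferInstanceAs (Module S (W ⧸ N.comap W.subtype))

/-- The class in `V_W / V_0` of an element of `V_W`. -/
def Red.mk {W N : Submodule S M} (x : M) (hx : x ∈ W) : Red W N :=
  (N.comap W.subtype).mkQ ⟨x, hx⟩

lemma Red.exists_mk {W N : Submodule S M} (y : Red W N) : ∃ x, ∃ hx : x ∈ W, Red.mk x hx = y := by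
  obtain ⟨x, rfl⟩ := Submodule.mkQ_surjective (N.comap W.subtype) y
  exact ⟨x.1, x.2, rfl⟩

lemma Red.mk_eq_zero {W N : Submodule S M} {x : M} (hx : x ∈ W) :
    (Red.mk x hx : Red W N) = 0 ↔ x ∈ N :=
  Submodule.Quotient.mk_eq_zero (N.comap W.subtype)

end Reduction

section Algebraic

variable {R A : Type*} [CommRing R] [CommRing A] [Algebra R A]

/-- `𝔛(A)_W` for the constraint algebra `(A, A, I)`: the derivations preserving `I`. -/
def derWobs (I : Ideal A) : LieSubalgebra R (Derivation R A A) where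
  carrier := {X | ∀ a ∈ I, X a ∈ I}
  add_mem' hX hY a ha := I.add_mem (hX a ha) (hY a ha)
  zero_mem' _ _ := I.zero_mem
  smul_mem' c X hX a ha := by
    rw [Derivation.smul_apply, algebra_compatible_smul A c (X a)]
    exact I.mul_mem_left _ (hX a ha)
  lie_mem' {X Y} hX hY a ha := by
    rw [Derivation.commutator_apply]
    exact I.sub_mem (hX _ (hY a ha)) (hY _ (hX a ha))

/-- `𝔛(A)_0` for the constraint algebra `(A, A, I)`: the derivations mapping `A` into `I`. -/
def derNull (I : Ideal A) : Submodule A (Derivation R A A) where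
  carrier := {X | ∀ a, X a ∈ I}
  add_mem' hX hY a := I.add_mem (hX a) (hY a)
  zero_mem' _ := I.zero_mem
  smul_mem' c _ hX a := I.mul_mem_left c (hX a)

variable (R A) in
/-- An ideal `I` of `A` with an `A`-module `𝓕` of symmetries,
`𝔛(A)_0 ⊆ 𝓕 ⊆ 𝔛(A)_W`. -/
structure SymmetryData where
  /-- the ideal `A_0` -/
  I : Ideal A
  /-- the symmetries -/
  F : Submodule A (Derivation R A A)
  null_le : derNull I ≤ F
  le_wobs : ∀ X ∈ F, X ∈ derWobs (R := R) I

namespace SymmetryData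

variable (P : SymmetryData R A)

/-- `A'_W = {f | 𝓕 f ⊆ A_0}`. -/
def algWobs : Subalgebra R A where
  carrier := {f | ∀ X ∈ P.F, X f ∈ P.I}
  add_mem' {f g} hf hg X hX := by
    rw [map_add]; exact P.I.add_mem (hf X hX) (hg X hX)
  mul_mem' {f g} hf hg X hX := by
    rw [Derivation.leibniz]
    exact P.I.add_mem (P.I.mul_mem_left _ (hg X hX)) (P.I.mul_mem_left _ (hf X hX))
  algebraMap_mem' r X _ := by
    rw [Derivation.map_algebraMap]; exact P.I.zero_mem

/-- `A'_0 = A_0`, as an ideal of `A'_W`. -/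
def algNull : Ideal P.algWobs := P.I.comap P.algWobs.val.toRingHom

/-- The reduced algebra `A'_red = A'_W / A'_0`. -/
abbrev AlgRed : Type _ := P.algWobs ⧸ P.algNull

/-- `𝔜_W`: the normalizer of `𝓕` in `𝔛(A)_W`. -/
def lieWobs : LieSubalgebra R (Derivation R A A) where
  carrier := {X | X ∈ derWobs (R := R) P.I ∧ ∀ Y ∈ P.F, ⁅Y, X⁆ ∈ P.F}
  add_mem' {X X'} hX hX' := ⟨add_mem hX.1 hX'.1, fun Y hY => by
    rw [lie_add]; exact P.F.add_mem (hX.2 Y hY) (hX'.2 Y hY)⟩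
  zero_mem' := ⟨zero_mem _, fun Y _ => by rw [lie_zero]; exact P.F.zero_mem⟩
  smul_mem' c X hX := ⟨(derWobs (R := R) P.I).smul_mem c hX.1, fun Y hY => by
    rw [lie_smul, algebra_compatible_smul A c]; exact P.F.smul_mem _ (hX.2 Y hY)⟩
  lie_mem' {X X'} hX hX' := ⟨LieSubalgebra.lie_mem _ hX.1 hX'.1, fun Y hY => by
    rw [leibniz_lie, ← lie_skew X ⁅Y, X'⁆, ← sub_eq_add_neg]
    exact P.F.sub_mem (hX'.2 _ (hX.2 Y hY)) (hX.2 _ (hX'.2 Y hY))⟩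

/-- `𝔜_0 = 𝓕`, as an ideal of the Lie algebra `𝔜_W`. -/
def lieNull : LieIdeal R P.lieWobs where
  carrier := {X | (X : Derivation R A A) ∈ P.F}
  add_mem' hX hY := P.F.add_mem hX hY
  zero_mem' := P.F.zero_mem
  smul_mem' c X hX := by
    change c • (X : Derivation R A A) ∈ P.F
    rw [algebra_compatible_smul A c]; exact P.F.smul_mem _ hX
  lie_mem {X Y} hY := by
    change ⁅(X : Derivation R A A), (Y : Derivation R A A)⁆ ∈ P.F
    rw [← lie_skew]; exact P.F.neg_mem (X.2.2 _ hY)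

/-- The reduced Lie algebra `𝔜_red = 𝔜_W / 𝔜_0`. -/
abbrev LieRed : Type _ := P.lieWobs ⧸ P.lieNull

lemma smul_mem_lieWobs {f : A} (hf : f ∈ P.algWobs) {X : Derivation R A A}
    (hX : X ∈ P.lieWobs) : f • X ∈ P.lieWobs := by
  refine ⟨fun a ha => P.I.mul_mem_left f (hX.1 a ha), fun Y hY => ?_⟩
  rw [LieRinehartRing.leibniz_smul_right]
  exact P.F.add_mem (P.F.smul_mem f (hX.2 Y hY))
    (P.null_le fun a => P.I.mul_mem_right _ (hf Y hY))

lemma apply_mem_algWobs {X : Derivation R A A} (hX : X ∈ P.lieWobs) {f : A}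
    (hf : f ∈ P.algWobs) : X f ∈ P.algWobs := fun Y hY => by
  have h : Y (X f) = ⁅Y, X⁆ f + X (Y f) := by rw [Derivation.commutator_apply]; ring
  rw [h]
  exact P.I.add_mem (hf _ (hX.2 Y hY)) (hX.1 _ (hf Y hY))

/-- Multiplication of `𝔜_red` by an element of `A'_W`. -/
def smulRed (f : P.algWobs) : P.LieRed →ₗ[R] P.LieRed :=
  Submodule.mapQ P.lieNull.toSubmodule P.lieNull.toSubmodule
    { toFun := fun X => ⟨(f : A) • (X : Derivation R A A), P.smul_mem_lieWobs f.2 X.2⟩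
      map_add' := fun _ _ => Subtype.ext (smul_add _ _ _)
      map_smul' := fun _ _ => Subtype.ext (smul_comm _ _ _) }
    (fun _ hX => P.F.smul_mem _ hX)

/-- The ring map through which `A'_red` acts on `𝔜_red`. -/
def smulRedHom : P.AlgRed →+* Module.End R P.LieRed :=
  Ideal.Quotient.lift P.algNull
    { toFun := P.smulRed
      map_one' := Submodule.linearMap_qext _ (LinearMap.ext fun X =>
        congrArg (Submodule.Quotient.mk (p := P.lieNull.toSubmodule))
          (Subtype.ext (one_smul A (X : Derivation R A A))))
      map_mul' := fun f g => Submodule.linearMap_qext _ (LinearMap.ext fun X =>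
        congrArg (Submodule.Quotient.mk (p := P.lieNull.toSubmodule))
          (Subtype.ext (mul_smul (f : A) (g : A) (X : Derivation R A A))))
      map_zero' := Submodule.linearMap_qext _ (LinearMap.ext fun X =>
        congrArg (Submodule.Quotient.mk (p := P.lieNull.toSubmodule))
          (Subtype.ext (zero_smul A (X : Derivation R A A))))
      map_add' := fun f g => Submodule.linearMap_qext _ (LinearMap.ext fun X =>
        congrArg (Submodule.Quotient.mk (p := P.lieNull.toSubmodule))
          (Subtype.ext (add_smul (f : A) (g : A) (X : Derivation R A A)))) }
    (fun _ hf => Submodule.linearMap_qext _ (LinearMap.ext fun _ =>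
      (Submodule.Quotient.mk_eq_zero P.lieNull.toSubmodule).2
        (P.null_le fun _ => P.I.mul_mem_right _ hf)))

/-- `𝔜_red` as an `A'_red`-module: `[f] • [X] = [f X]`. -/
instance : Module P.AlgRed P.LieRed := Module.compHom P.LieRed P.smulRedHom

/-- Action of an element of `𝔜_W` on `A'_red`. -/
def actRed (X : P.lieWobs) : Module.End R P.AlgRed :=
  Submodule.mapQ (P.algNull.restrictScalars R) (P.algNull.restrictScalars R)
    { toFun := fun f => ⟨(X : Derivation R A A) f, P.apply_mem_algWobs X.2 f.2⟩
      map_add' := fun _ _ => Subtype.ext (map_add _ _ _)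
      map_smul' := fun _ _ => Subtype.ext (Derivation.map_smul _ _ _) }
    (fun f hf => X.2.1 f hf)

lemma actRed_mk (X : P.lieWobs) (f : P.algWobs) :
    P.actRed X (Ideal.Quotient.mk P.algNull f) = Ideal.Quotient.mk P.algNull
      ⟨(X : Derivation R A A) f, P.apply_mem_algWobs X.2 f.2⟩ := rfl

lemma actRed_eq_zero (X : P.lieWobs) (hX : (X : Derivation R A A) ∈ P.F) : P.actRed X = 0 := by
  refine LinearMap.ext fun a => ?_
  obtain ⟨f, rfl⟩ := Ideal.Quotient.mk_surjective a
  rw [actRed_mk]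
  exact Ideal.Quotient.eq_zero_iff_mem.2 (f.2 _ hX)

/-- The linear map through which `𝔜_red` acts on `A'_red`. -/
def actRedHom : P.LieRed →ₗ[R] Module.End R P.AlgRed :=
  Submodule.liftQ P.lieNull.toSubmodule
    { toFun := P.actRed
      map_add' := fun X Y => LinearMap.ext fun a => by
        obtain ⟨f, rfl⟩ := Ideal.Quotient.mk_surjective a
        rw [LinearMap.add_apply, actRed_mk, actRed_mk, actRed_mk, ← map_add]
        rfl
      map_smul' := fun c X => LinearMap.ext fun a => by
        obtain ⟨f, rfl⟩ := Ideal.Quotient.mk_surjective a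
        rfl }
    (fun X hX => LinearMap.mem_ker.2 (P.actRed_eq_zero X hX))

/-- The action of `𝔜_red` on `A'_red`: `[X] [f] = [X f]`. -/
instance : LieRingModule P.LieRed P.AlgRed where
  bracket x a := P.actRedHom x a
  add_lie x y a := by rw [map_add]; rfl
  lie_add x a b := map_add _ _ _
  leibniz_lie x y a := by
    obtain ⟨X, rfl⟩ := Submodule.Quotient.mk_surjective _ x
    obtain ⟨Y, rfl⟩ := Submodule.Quotient.mk_surjective _ y
    obtain ⟨f, rfl⟩ := Ideal.Quotient.mk_surjective a
    change Ideal.Quotient.mk P.algNull _ =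
      Ideal.Quotient.mk P.algNull _ + Ideal.Quotient.mk P.algNull _
    rw [← map_add]
    refine congrArg _ (Subtype.ext ?_)
    change (X : Derivation R A A) ((Y : Derivation R A A) f) =
      ⁅(X : Derivation R A A), (Y : Derivation R A A)⁆ f +
        (Y : Derivation R A A) ((X : Derivation R A A) f)
    rw [Derivation.commutator_apply]; ring

instance : LieRinehartRing P.AlgRed P.LieRed where
  lie_smul_eq_mul' a b x := by
    obtain ⟨X, rfl⟩ := Submodule.Quotient.mk_surjective _ x
    obtain ⟨f, rfl⟩ := Ideal.Quotient.mk_surjective a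
    obtain ⟨g, rfl⟩ := Ideal.Quotient.mk_surjective b
    rfl
  leibniz_mul_right' x a b := by
    obtain ⟨X, rfl⟩ := Submodule.Quotient.mk_surjective _ x
    obtain ⟨f, rfl⟩ := Ideal.Quotient.mk_surjective a
    obtain ⟨g, rfl⟩ := Ideal.Quotient.mk_surjective b
    refine congrArg (Ideal.Quotient.mk P.algNull) (Subtype.ext ?_)
    change (X : Derivation R A A) ((f : A) * (g : A)) =
      (f : A) * (X : Derivation R A A) g + (X : Derivation R A A) f * (g : A)
    rw [Derivation.leibniz, smul_eq_mul, smul_eq_mul]; ring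
  leibniz_smul_right' x y a := by
    obtain ⟨X, rfl⟩ := Submodule.Quotient.mk_surjective _ x
    obtain ⟨Y, rfl⟩ := Submodule.Quotient.mk_surjective _ y
    obtain ⟨f, rfl⟩ := Ideal.Quotient.mk_surjective a
    refine congrArg (Submodule.Quotient.mk (p := P.lieNull.toSubmodule)) (Subtype.ext ?_)
    exact LieRinehartRing.leibniz_smul_right (X : Derivation R A A) (Y : Derivation R A A) (f : A)

instance : LieRinehartAlgebra R P.AlgRed P.LieRed where
  smul_assoc c a x := by
    obtain ⟨X, rfl⟩ := Submodule.Quotient.mk_surjective _ x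
    obtain ⟨f, rfl⟩ := Ideal.Quotient.mk_surjective a
    exact congrArg (Submodule.Quotient.mk (p := P.lieNull.toSubmodule))
      (Subtype.ext (smul_assoc c (f : A) (X : Derivation R A A)))
  smul_lie c x a := by
    obtain ⟨X, rfl⟩ := Submodule.Quotient.mk_surjective _ x
    obtain ⟨f, rfl⟩ := Ideal.Quotient.mk_surjective a
    rfl
  lie_smul c x a := map_smul (P.actRedHom x) c a

end SymmetryData

variable (R A) in
/-- `CE^k(𝔛(A))_T = (Λ^k_A 𝔛(A))^*`: alternating `A`-multilinear forms on the derivations of `A`. -/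
abbrev CE (k : ℕ) : Type _ := Derivation R A A [⋀^Fin k]→ₗ[A] A

/-- The Lie derivative
`(L_X α)(Y_1, …, Y_k) = X (α (Y_1, …, Y_k)) - ∑ i, α (Y_1, …, [X, Y_i], …, Y_k)`. -/
def lieDer {k : ℕ} (X : Derivation R A A) (α : CE R A k) : CE R A k where
  toFun Y := X (α Y) - ∑ i, α (Function.update Y i ⁅X, Y i⁆)
  map_update_add' := by
    intro _ Y i x y
    have hdec : ‹DecidableEq (Fin k)› = instDecidableEqFin k := Subsingleton.elim _ _
    subst hdec
    have key : ∀ j, α (Function.update (Function.update Y i (x + y)) j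
          ⁅X, Function.update Y i (x + y) j⁆) =
        α (Function.update (Function.update Y i x) j ⁅X, Function.update Y i x j⁆) +
        α (Function.update (Function.update Y i y) j ⁅X, Function.update Y i y j⁆) := by
      intro j
      by_cases h : j = i
      · subst h
        simp only [Function.update_idem, Function.update_self, lie_add,
          AlternatingMap.map_update_add]
      · simp only [Function.update_of_ne h, Function.update_comm (Ne.symm h),
          AlternatingMap.map_update_add]
    simp only [key, AlternatingMap.map_update_add, map_add, Finset.sum_add_distrib]
    abel
  map_update_smul' := by
    intro _ Y i c x
    have hdec : ‹DecidableEq (Fin k)› = instDecidableEqFin k := Subsingleton.elim _ _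
    subst hdec
    have key : ∀ j, α (Function.update (Function.update Y i (c • x)) j
          ⁅X, Function.update Y i (c • x) j⁆) =
        c • α (Function.update (Function.update Y i x) j ⁅X, Function.update Y i x j⁆) +
        if j = i then X c • α (Function.update Y i x) else 0 := by
      intro j
      by_cases h : j = i
      · subst h
        simp only [Function.update_idem, Function.update_self,
          LieRinehartRing.leibniz_smul_right, Derivation.bracket_eq_fun,
          AlternatingMap.map_update_add, AlternatingMap.map_update_smul, if_true]
      · simp only [Function.update_of_ne h, Function.update_comm (Ne.symm h),
          AlternatingMap.map_update_smul, if_neg h, add_zero]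
    simp only [key, AlternatingMap.map_update_smul, Finset.sum_add_distrib, smul_eq_mul,
      Derivation.leibniz, Finset.sum_ite_eq', Finset.mem_univ, if_true, ← Finset.mul_sum]
    ring
  map_eq_zero_of_eq' := by
    intro Y i j hij hne
    have hz : α Y = 0 := α.map_eq_zero_of_eq Y hij hne
    have hs : ∑ l, α (Function.update Y l ⁅X, Y l⁆) =
        α (Function.update Y i ⁅X, Y i⁆) + α (Function.update Y j ⁅X, Y j⁆) := by
      refine Finset.sum_eq_add i j hne (fun l _ hl => ?_) (by simp) (by simp)
      exact α.map_eq_zero_of_eq _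
        (by rw [Function.update_of_ne hl.1.symm, Function.update_of_ne hl.2.symm, hij]) hne
    have hsw : Function.update Y j ⁅X, Y j⁆ =
        Function.update Y i ⁅X, Y i⁆ ∘ Equiv.swap i j := by
      funext l
      by_cases h1 : l = i
      · subst h1; simp [Function.update_of_ne hne, Function.update_of_ne hne.symm, hij]
      · by_cases h2 : l = j
        · subst h2; simp [hij]
        · simp [Equiv.swap_apply_of_ne_of_ne h1 h2, Function.update_of_ne h1,
            Function.update_of_ne h2]
    rw [hz, map_zero, hs, hsw, α.map_swap _ hne, add_neg_cancel, sub_zero]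

/-- The contraction `ι_X`, which is zero in degree zero. -/
def contract (X : Derivation R A A) : ∀ {k : ℕ}, CE R A k → CE R A (k - 1)
  | 0, _ => 0
  | _ + 1, α => α.curryLeft X

/-- The Chevalley–Eilenberg differential of a cochain of a Lie ring `L` with values in an
`L`-module `V`:
`(d α)(X_0, …, X_k) = ∑ i, (-1)^i X_i (α (…, X̂_i, …)) +
  ∑ i < j, (-1)^(i+j) α ([X_i, X_j], …, X̂_i, …, X̂_j, …)`;
in the second sum `[X_i, X_j]` has been moved to the place of `X_j`. -/
def ceDiff {L V : Type*} [LieRing L] [AddCommGroup V] [LieRingModule L V] {k : ℕ}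
    (α : (Fin k → L) → V) (X : Fin (k + 1) → L) : V :=
  ∑ i : Fin (k + 1), (-1 : ℤ) ^ (i : ℕ) •
    (⁅X i, α (i.removeNth X)⁆ -
      ∑ j ∈ Finset.univ.filter (fun j => i < j),
        α (i.removeNth (Function.update X j ⁅X i, X j⁆)))

namespace SymmetryData

variable (P : SymmetryData R A)

/-- `B_W` for `B = CE(𝔛(A))`: forms taking `𝔛(A)_W` to `A_W = A` (no condition),
and to `A_0` as soon as one argument is in `𝔛(A)_0`. -/
def formTan (k : ℕ) : Submodule P.algWobs (CE R A k) where
  carrier := {α | ∀ Y : Fin k → Derivation R A A, (∀ i, Y i ∈ derWobs (R := R) P.I) →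
    (∃ i, Y i ∈ derNull P.I) → α Y ∈ P.I}
  add_mem' hα hβ Y hY h := P.I.add_mem (hα Y hY h) (hβ Y hY h)
  zero_mem' _ _ _ := P.I.zero_mem
  smul_mem' c _ hα Y hY h := P.I.mul_mem_left (c : A) (hα Y hY h)

/-- `B'_0 = B_0` for `B = CE(𝔛(A))`: forms taking `𝔛(A)_W` to `A_0`. -/
def formNull (k : ℕ) : Submodule P.algWobs (CE R A k) where
  carrier := {α | ∀ Y : Fin k → Derivation R A A, (∀ i, Y i ∈ derWobs (R := R) P.I) → α Y ∈ P.I}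
  add_mem' hα hβ Y hY := P.I.add_mem (hα Y hY) (hβ Y hY)
  zero_mem' _ _ := P.I.zero_mem
  smul_mem' c _ hα Y hY := P.I.mul_mem_left (c : A) (hα Y hY)

lemma contract_smul_mem {k : ℕ} {f : A} {X : Derivation R A A} {α : CE R A k}
    (h : contract X α ∈ P.formNull (k - 1)) : contract X (f • α) ∈ P.formNull (k - 1) := by
  cases k with
  | zero => exact h
  | succ k => exact fun Y hY => P.I.mul_mem_left f (h Y hY)

lemma contract_add_mem {k : ℕ} {X : Derivation R A A} {α β : CE R A k}
    (h : contract X α ∈ P.formNull (k - 1)) (h' : contract X β ∈ P.formNull (k - 1)) :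
    contract X (α + β) ∈ P.formNull (k - 1) := by
  cases k with
  | zero => exact h
  | succ k => exact fun Y hY => P.I.add_mem (h Y hY) (h' Y hY)

lemma contract_zero_mem {k : ℕ} {X : Derivation R A A} :
    contract X (0 : CE R A k) ∈ P.formNull (k - 1) := by
  cases k with
  | zero => exact zero_mem _
  | succ k => exact fun Y _ => P.I.zero_mem

/-- `B'_W = {α ∈ B_W | ι_X α, L_X α ∈ B_0 for all X ∈ 𝔜_0}`, in degree `k`. -/
def formWobs (k : ℕ) : Submodule P.algWobs (CE R A k) where
  carrier := {α | α ∈ P.formTan k ∧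
    ∀ X ∈ P.F, contract X α ∈ P.formNull (k - 1) ∧ lieDer X α ∈ P.formNull k}
  add_mem' {α β} hα hβ := ⟨add_mem hα.1 hβ.1, fun X hX =>
    ⟨P.contract_add_mem (hα.2 X hX).1 (hβ.2 X hX).1, fun Y hY => by
      have h := P.I.add_mem ((hα.2 X hX).2 Y hY) ((hβ.2 X hX).2 Y hY)
      convert h using 1
      simp only [lieDer, AlternatingMap.coe_mk, MultilinearMap.coe_mk, AlternatingMap.add_apply,
        map_add, Finset.sum_add_distrib]
      abel⟩⟩
  zero_mem' := ⟨zero_mem _, fun X _ => ⟨P.contract_zero_mem, fun Y _ => by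
    simp [lieDer]⟩⟩
  smul_mem' f α hα := ⟨(P.formTan k).smul_mem f hα.1, fun X hX =>
    ⟨P.contract_smul_mem (hα.2 X hX).1, fun Y hY => by
      have h := P.I.add_mem (P.I.mul_mem_left (f : A) ((hα.2 X hX).2 Y hY))
        (P.I.mul_mem_left (α Y) (f.2 X hX))
      convert h using 1
      change X ((f : A) * α Y) - ∑ i, (f : A) * α (Function.update Y i ⁅X, Y i⁆) =
        (f : A) * (X (α Y) - ∑ i, α (Function.update Y i ⁅X, Y i⁆)) + α Y * X f
      rw [Derivation.leibniz, ← Finset.mul_sum, smul_eq_mul, smul_eq_mul]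
      ring⟩⟩

/-- The reduced forms `B'_red = B'_W / B'_0`, in degree `k`. -/
def FormRed (k : ℕ) : Type _ := Red (P.formWobs k) (P.formNull k)

instance (k : ℕ) : AddCommGroup (P.FormRed k) := Red.addCommGroup _ _

instance FormRed.moduleWobs (k : ℕ) : Module P.algWobs (P.FormRed k) := Red.module _ _

instance (k : ℕ) : Module R (P.FormRed k) :=
  Module.compHom (P.FormRed k) (algebraMap R P.algWobs)

/-- The class in `B'_red` of an element of `B'_W`. -/
def formMk {k : ℕ} (α : CE R A k) (hα : α ∈ P.formWobs k) : P.FormRed k := Red.mk α hα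

/-- `B'_red` as an `A'_red`-module: `[f] • [α] = [f α]`. -/
instance (k : ℕ) : Module P.AlgRed (P.FormRed k) :=
  Module.IsTorsionBySet.module (R := P.algWobs) (I := P.algNull) (by
    rintro x ⟨f, hf⟩
    obtain ⟨α, hα, rfl⟩ := Red.exists_mk x
    exact (Red.mk_eq_zero ((P.formWobs k).smul_mem f hα)).2
      fun Y _ => P.I.mul_mem_right (α Y) hf)

end SymmetryData

end Algebraic

noncomputable section Geometry

open VectorField

variable {E M : Type*} [NormedAddCommGroup E] [NormedSpace ℝ E]
  [TopologicalSpace M] [ChartedSpace E M]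

variable (E M) in
/-- `C^∞(M)`. -/
abbrev Fun : Type _ := C^∞⟮𝓘(ℝ, E), M; ℝ⟯

variable [IsManifold 𝓘(ℝ, E) ∞ M]

variable (E M) in
/-- `𝔛(M)`: the smooth vector fields on `M`. -/
abbrev VF : Type _ :=
  Cₛ^∞⟮𝓘(ℝ, E); E, fun x : M => TangentSpace 𝓘(ℝ, E) x⟯

lemma two_le_infty : (2 : ℕ∞ω) ≤ ∞ :=
  WithTop.coe_le_coe.2 (le_top : (2 : ℕ∞) ≤ ⊤)

lemma three_le_infty : (3 : ℕ∞ω) ≤ ∞ :=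
  WithTop.coe_le_coe.2 (le_top : (3 : ℕ∞) ≤ ⊤)

namespace VF

instance : SMul (Fun E M) (VF E M) where
  smul f X := ⟨fun x => f x • X x, f.contMDiff.smul_section X.contMDiff⟩

instance : Module (Fun E M) (VF E M) where
  one_smul X := ContMDiffSection.ext fun x => one_smul ℝ (X x)
  mul_smul f g X := ContMDiffSection.ext fun x => mul_smul (f x) (g x) (X x)
  smul_zero f := ContMDiffSection.ext fun x => smul_zero (f x)
  smul_add f X Y := ContMDiffSection.ext fun x => smul_add (f x) (X x) (Y x)
  add_smul f g X := ContMDiffSection.ext fun x => add_smul (f x) (g x) (X x)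
  zero_smul X := ContMDiffSection.ext fun x => zero_smul ℝ (X x)

lemma mdiffAt (X : VF E M) (x : M) :
    MDifferentiableAt 𝓘(ℝ, E) (𝓘(ℝ, E).prod 𝓘(ℝ, E))
      (fun y => (⟨y, X y⟩ : TangentBundle 𝓘(ℝ, E) M)) x :=
  (X.contMDiff x).mdifferentiableAt (by simp)

lemma fun_mdiffAt (f : Fun E M) (x : M) : MDifferentiableAt 𝓘(ℝ, E) 𝓘(ℝ, ℝ) f x :=
  (f.contMDiff x).mdifferentiableAt (by simp)

/-- The derivative `X f = df(X)` of a function along a vector field. -/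
instance : Bracket (VF E M) (Fun E M) where
  bracket X f := ⟨fun x => mvfderiv 𝓘(ℝ, E) f x (X x),
    (contMDiff_snd_tangentBundle_modelSpace ℝ 𝓘(ℝ, ℝ)).comp
      ((f.contMDiff.contMDiff_tangentMap (m := ∞) (by simp)).comp X.contMDiff)⟩

lemma lie_fun_apply (X : VF E M) (f : Fun E M) (x : M) :
    ⁅X, f⁆ x = mvfderiv 𝓘(ℝ, E) f x (X x) := rfl

variable [FiniteDimensional ℝ E]

/-- The Lie bracket of vector fields. -/
instance : Bracket (VF E M) (VF E M) where
  bracket X Y := ⟨mlieBracket 𝓘(ℝ, E) X Y, by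
    have := FiniteDimensional.complete ℝ E
    have : IsManifold 𝓘(ℝ, E) (minSmoothness ℝ 2) M :=
      IsManifold.of_le (n := ∞) (by simpa using two_le_infty)
    have : IsManifold 𝓘(ℝ, E) ((⊤ : ℕ∞) + 1) M := IsManifold.of_le (n := ∞) (by simp)
    intro x
    exact ContMDiffAt.mlieBracket_vectorField (n := ⊤) (m := ⊤) (X.contMDiff x) (Y.contMDiff x)
      (by simp)⟩

lemma lie_apply (X Y : VF E M) (x : M) : ⁅X, Y⁆ x = mlieBracket 𝓘(ℝ, E) X Y x := rfl

instance : LieRing (VF E M) where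
  add_lie X Y Z := ContMDiffSection.ext fun x =>
    have := FiniteDimensional.complete ℝ E
    mlieBracket_add_left (X.mdiffAt x) (Y.mdiffAt x)
  lie_add X Y Z := ContMDiffSection.ext fun x =>
    have := FiniteDimensional.complete ℝ E
    mlieBracket_add_right (Y.mdiffAt x) (Z.mdiffAt x)
  lie_self X := ContMDiffSection.ext fun x => by
    rw [lie_apply, mlieBracket_self]; rfl
  leibniz_lie X Y Z := ContMDiffSection.ext fun x => by
    have := FiniteDimensional.complete ℝ E
    have h3 : minSmoothness ℝ 3 ≤ ∞ := by simpa using three_le_infty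
    have h2 : minSmoothness ℝ 2 ≤ ∞ := by simpa using two_le_infty
    have : IsManifold 𝓘(ℝ, E) (minSmoothness ℝ 3) M := IsManifold.of_le h3
    exact leibniz_identity_mlieBracket_apply ((X.contMDiff x).of_le h2)
      ((Y.contMDiff x).of_le h2) ((Z.contMDiff x).of_le h2)

instance : LieAlgebra ℝ (VF E M) where
  lie_smul _ _ Y := ContMDiffSection.ext fun x =>
    have := FiniteDimensional.complete ℝ E
    mlieBracket_const_smul_right (Y.mdiffAt x)

section chart

/-- The derivative of a function along a vector field, in a chart. -/
lemma fderiv_chart (X : VF E M) (f : Fun E M) (x : M) {z : E}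
    (hz : z ∈ (extChartAt 𝓘(ℝ, E) x).target) :
    fderiv ℝ (f ∘ (extChartAt 𝓘(ℝ, E) x).symm) z
      (mpullbackWithin 𝓘(ℝ, E) 𝓘(ℝ, E) (extChartAt 𝓘(ℝ, E) x).symm X
        (Set.range 𝓘(ℝ, E)) z) = ⁅X, f⁆ ((extChartAt 𝓘(ℝ, E) x).symm z) := by
  have : IsManifold 𝓘(ℝ, E) 1 M := IsManifold.of_le (n := ∞) (by simp)
  have hinv := isInvertible_mfderivWithin_extChartAt_symm (I := 𝓘(ℝ, E)) hz
  have hd := mdifferentiableWithinAt_extChartAt_symm (I := 𝓘(ℝ, E)) hz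
  rw [lie_fun_apply]
  simp only [modelWithCornersSelf_coe, Set.range_id, mpullbackWithin_apply] at hinv hd ⊢
  rw [mfderivWithin_univ] at hinv ⊢
  rw [mdifferentiableWithinAt_univ] at hd
  have h1 := mvfderiv_comp_apply (I := 𝓘(ℝ, E)) (I' := 𝓘(ℝ, E)) z
    (fun_mdiffAt f ((extChartAt 𝓘(ℝ, E) x).symm z)) hd
    ((mfderiv 𝓘(ℝ, E) 𝓘(ℝ, E) (extChartAt 𝓘(ℝ, E) x).symm z).inverse
      (X ((extChartAt 𝓘(ℝ, E) x).symm z)))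
  have h2 : mfderiv 𝓘(ℝ, E) 𝓘(ℝ, E) (extChartAt 𝓘(ℝ, E) x).symm z
      ((mfderiv 𝓘(ℝ, E) 𝓘(ℝ, E) (extChartAt 𝓘(ℝ, E) x).symm z).inverse
      (X ((extChartAt 𝓘(ℝ, E) x).symm z))) = X ((extChartAt 𝓘(ℝ, E) x).symm z) := by
    obtain ⟨e, he⟩ := hinv
    rw [← he, ContinuousLinearMap.inverse_equiv]
    exact e.apply_symm_apply _
  rw [h2] at h1
  rw [← h1]
  change _ = (mfderiv 𝓘(ℝ, E) 𝓘(ℝ, ℝ) _ _) _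
  rw [mfderiv_eq_fderiv]
  rfl

/-- `[X, Y] f = X (Y f) - Y (X f)`. -/
lemma lie_lie_fun (X Y : VF E M) (f : Fun E M) : ⁅⁅X, Y⁆, f⁆ = ⁅X, ⁅Y, f⁆⁆ - ⁅Y, ⁅X, f⁆⁆ := by
  have := FiniteDimensional.complete ℝ E
  have : IsManifold 𝓘(ℝ, E) 1 M := IsManifold.of_le (n := ∞) (by simp)
  have : IsManifold 𝓘(ℝ, E) 2 M := IsManifold.of_le (n := ∞) two_le_infty
  ext x
  set φ := extChartAt 𝓘(ℝ, E) x with hφ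
  have htx : φ x ∈ φ.target := mem_extChartAt_target x
  have hopen : IsOpen φ.target := isOpen_extChartAt_target x
  have hback : φ.symm (φ x) = x := extChartAt_to_inv x
  set X' := mpullbackWithin 𝓘(ℝ, E) 𝓘(ℝ, E) φ.symm X (Set.range 𝓘(ℝ, E)) with hX'
  set Y' := mpullbackWithin 𝓘(ℝ, E) 𝓘(ℝ, E) φ.symm Y (Set.range 𝓘(ℝ, E)) with hY'
  have hdiff : ∀ Z : VF E M, DifferentiableAt ℝ
      (mpullbackWithin 𝓘(ℝ, E) 𝓘(ℝ, E) φ.symm Z (Set.range 𝓘(ℝ, E))) (φ x) := by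
    intro Z
    have h := contMDiffWithinAt_mpullbackWithin_extChartAt_symm (n := 2) (m := 1) (s := Set.univ)
      (x := x) (((Z.contMDiff x).of_le (by simp)).contMDiffWithinAt) uniqueMDiffOn_univ
      (Set.mem_univ x) (by norm_num)
    have h := contMDiffWithinAt_vectorSpace_iff_contDiffWithinAt.1 h
    exact (h.differentiableWithinAt (by simp)).differentiableAt (by
      rw [Set.preimage_univ, Set.inter_univ]; exact hopen.mem_nhds htx)
  have hf : ContDiffAt ℝ 2 (f ∘ φ.symm) (φ x) := by
    have h := (f.contMDiff (φ.symm (φ x))).comp (φ x)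
      ((contMDiffOn_extChartAt_symm (I := 𝓘(ℝ, E)) (n := ∞) x).contMDiffAt (hopen.mem_nhds htx))
    exact h.contDiffAt.of_le two_le_infty
  have hsec : ∀ Z : VF E M, (fun z => fderiv ℝ (f ∘ φ.symm) z
      (mpullbackWithin 𝓘(ℝ, E) 𝓘(ℝ, E) φ.symm Z (Set.range 𝓘(ℝ, E)) z)) =ᶠ[nhds (φ x)]
      ((⁅Z, f⁆ : Fun E M) ∘ φ.symm) := fun Z =>
    Filter.eventuallyEq_of_mem (hopen.mem_nhds htx) fun z hz => fderiv_chart Z f x hz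
  have key := fderiv_apply_lieBracket hf (by simp) (hdiff Y) (hdiff X)
  rw [(hsec Y).fderiv_eq, (hsec X).fderiv_eq, fderiv_chart X ⁅Y, f⁆ x htx,
    fderiv_chart Y ⁅X, f⁆ x htx, hback] at key
  change _ = ⁅X, ⁅Y, f⁆⁆ x - ⁅Y, ⁅X, f⁆⁆ x
  rw [← key, lie_fun_apply, lie_apply, ← mlieBracketWithin_univ, mlieBracketWithin_apply]
  simp only [modelWithCornersSelf_coe, Set.range_id, Set.preimage_univ, Set.inter_univ]
  have hinv := isInvertible_mfderiv_extChartAt (I := 𝓘(ℝ, E))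
    (mem_extChartAt_source (I := 𝓘(ℝ, E)) x)
  have hfx : ∀ v : TangentSpace 𝓘(ℝ, E) x, mvfderiv 𝓘(ℝ, E) f x v =
      fderiv ℝ (f ∘ φ.symm) (φ x) (mfderiv 𝓘(ℝ, E) 𝓘(ℝ, E) φ x v) := by
    intro v
    have h1 : (f : M → ℝ) =ᶠ[nhds x] (f ∘ φ.symm) ∘ φ :=
      Filter.eventuallyEq_of_mem (extChartAt_source_mem_nhds (I := 𝓘(ℝ, E)) x) fun y hy =>
        congrArg f (φ.left_inv hy).symm
    have h2 : MDifferentiableAt 𝓘(ℝ, E) 𝓘(ℝ, ℝ) (f ∘ φ.symm) (φ x) :=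
      (hf.differentiableAt (by norm_num)).mdifferentiableAt
    have h3 : mfderiv 𝓘(ℝ, E) 𝓘(ℝ, ℝ) f x = mfderiv 𝓘(ℝ, E) 𝓘(ℝ, ℝ) ((f ∘ φ.symm) ∘ φ) x :=
      h1.mfderiv_eq
    have h4 := mfderiv_comp_apply x h2
      (mdifferentiableAt_extChartAt (I := 𝓘(ℝ, E)) (mem_chart_source E x)) v
    rw [mfderiv_eq_fderiv] at h4
    change mfderiv 𝓘(ℝ, E) 𝓘(ℝ, ℝ) f x v = _
    rw [h3]
    exact h4
  rw [hfx]
  obtain ⟨e, he⟩ := hinv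
  rw [← he, ContinuousLinearMap.inverse_equiv]
  refine congrArg _ ((e.apply_symm_apply _).trans ?_)
  exact congrFun (lieBracketWithin_univ (𝕜 := ℝ) (E := E)) _

end chart

instance : LieRingModule (VF E M) (Fun E M) where
  add_lie X Y f := by
    ext x; exact map_add (mvfderiv 𝓘(ℝ, E) f x) (X x) (Y x)
  lie_add X f g := by
    ext x
    exact congrArg (fun L => L (X x)) (mvfderiv_add (fun_mdiffAt f x) (fun_mdiffAt g x))
  leibniz_lie X Y f := by rw [lie_lie_fun]; abel

instance : LieRinehartRing (Fun E M) (VF E M) where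
  lie_smul_eq_mul' f g X := by
    ext x; exact map_smul (mvfderiv 𝓘(ℝ, E) g x) (f x) (X x)
  leibniz_mul_right' X f g := by
    ext x
    refine (congrArg (fun L => L (X x)) (mvfderiv_mul (fun_mdiffAt f x) (fun_mdiffAt g x))).trans ?_
    change f x * mvfderiv 𝓘(ℝ, E) g x (X x) + g x * mvfderiv 𝓘(ℝ, E) f x (X x) =
      f x * mvfderiv 𝓘(ℝ, E) g x (X x) + mvfderiv 𝓘(ℝ, E) f x (X x) * g x
    ring
  leibniz_smul_right' X Y f := ContMDiffSection.ext fun x => by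
    have := FiniteDimensional.complete ℝ E
    refine (mlieBracket_smul_right (fun_mdiffAt f x) (Y.mdiffAt x)).trans ?_
    exact add_comm _ _

instance : LieRinehartAlgebra ℝ (Fun E M) (VF E M) where
  smul_assoc c f X := ContMDiffSection.ext fun x => smul_assoc c (f x) (X x)
  smul_lie c X f := by
    ext x; exact map_smul (mvfderiv 𝓘(ℝ, E) f x) c (X x)
  lie_smul c X f := by
    ext x
    have h := mvfderiv_smul (I := 𝓘(ℝ, E)) (a := fun _ : M => c) (x := x)
      mdifferentiableAt_const (fun_mdiffAt f x)
    refine (congrArg (fun L => L (X x)) h).trans ?_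
    rw [mvfderiv_const]
    simp only [ContinuousLinearMap.zero_smulRight, add_zero]
    rfl

end VF

variable (E M) in
/-- `Ω^k(M)`: families of alternating `k`-forms on the tangent spaces which are smooth, i.e. give a
smooth function whenever they are evaluated on smooth vector fields. -/
def DiffForm (k : ℕ) : Submodule ℝ (∀ x : M, TangentSpace 𝓘(ℝ, E) x [⋀^Fin k]→L[ℝ] ℝ) where
  carrier := {σ | ∀ V : Fin k → VF E M,
    ContMDiff 𝓘(ℝ, E) 𝓘(ℝ, ℝ) ∞ fun x => σ x fun i => V i x}
  add_mem' hσ hη V := (hσ V).add (hη V)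
  zero_mem' _ := contMDiff_const
  smul_mem' _ _ hσ V := contMDiff_const.mul (hσ V)

/-- The smooth function `σ(V_1, …, V_k)`. -/
def DiffForm.eval {k : ℕ} (σ : DiffForm E M k) (V : Fin k → VF E M) : Fun E M :=
  ⟨fun x => σ.1 x fun i => V i x, σ.2 V⟩

variable {E' M' : Type*} [NormedAddCommGroup E'] [NormedSpace ℝ E']
  [TopologicalSpace M'] [ChartedSpace E' M']

/-- The pullback `(h^* σ)_x (v_1, …, v_k) = σ_{h x} (dh v_1, …, dh v_k)`. -/
def pullback {k : ℕ} (h : M' → M) (σ : ∀ x : M, TangentSpace 𝓘(ℝ, E) x [⋀^Fin k]→L[ℝ] ℝ)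
    (x : M') : TangentSpace 𝓘(ℝ, E') x [⋀^Fin k]→L[ℝ] ℝ :=
  (σ (h x)).compContinuousLinearMap (mfderiv 𝓘(ℝ, E') 𝓘(ℝ, E) h x)

/-- The derivation `f ↦ Y f` of `C^∞(M)` given by a vector field `Y`. -/
def VF.toDer [FiniteDimensional ℝ E] (Y : VF E M) : Derivation ℝ (Fun E M) (Fun E M) :=
  LieRinehartAlgebra.anchor ℝ (Fun E M) (VF E M) Y

/-- The form `σ` represents the alternating map `α`:
`α(Y_1, …, Y_k) = σ(Y_1, …, Y_k)` for all vector fields `Y_i`. -/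
def Represents [FiniteDimensional ℝ E] {k : ℕ} (σ : DiffForm E M k) (α : CE ℝ (Fun E M) k) :
    Prop :=
  ∀ Y : Fin k → VF E M, α (fun i => (Y i).toDer) = DiffForm.eval σ Y

/-- `Γ(D)`: the smooth vector fields with values in `D`. -/
def secs (D : ∀ x : M, Submodule ℝ (TangentSpace 𝓘(ℝ, E) x)) : Set (VF E M) :=
  {W | ∀ x, W x ∈ D x}

variable (E M) in
/-- A regular foliation of `M`, given by its tangent distribution: a smooth involutive
distribution of constant rank. -/
structure RegularFoliation [FiniteDimensional ℝ E] where
  /-- the tangent distribution -/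
  D : ∀ x : M, Submodule ℝ (TangentSpace 𝓘(ℝ, E) x)
  const_rank : ∃ r : ℕ, ∀ x, Module.finrank ℝ (D x) = r
  smooth : ∀ x, ∀ v ∈ D x, ∃ W ∈ secs D, W x = v
  involutive : ∀ V ∈ secs D, ∀ W ∈ secs D, ⁅V, W⁆ ∈ secs D

namespace RegularFoliation

variable [FiniteDimensional ℝ E] (𝓓 : RegularFoliation E M)

/-- `x` and `y` lie on the same leaf: they are joined by a smooth curve tangent to the
foliation. -/
def SameLeaf (x y : M) : Prop :=
  ∃ γ : ℝ → M, ContMDiff 𝓘(ℝ, ℝ) 𝓘(ℝ, E) ∞ γ ∧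
    (∀ t, mfderiv 𝓘(ℝ, ℝ) 𝓘(ℝ, E) γ t (1 : ℝ) ∈ 𝓓.D (γ t)) ∧ γ 0 = x ∧ γ 1 = y

/-- The manifold `M'` with the map `p : M → M'` is the smooth leaf space of the foliation:
`p` is a surjective submersion whose fibres are the leaves; a leaf being an integral manifold of
the distribution, the tangent space of the fibre at `x` is `D x`. -/
structure IsLeafSpace (p : M → M') : Prop where
  submersion : Manifold.IsSubmersion 𝓘(ℝ, E) 𝓘(ℝ, E') ∞ p
  surjective : Function.Surjective p
  fibre : ∀ x y, p x = p y ↔ 𝓓.SameLeaf x y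
  tangent : ∀ x (v : TangentSpace 𝓘(ℝ, E) x),
    mfderiv 𝓘(ℝ, E) 𝓘(ℝ, E') p x v = 0 ↔ v ∈ 𝓓.D x

/-- A form `η` is basic: `ι_W η = 0` and `L_W η = 0` for all `W ∈ Γ(D)`. The first condition is
imposed in each slot, the second one is
`W (η(Z_1, …, Z_k)) = ∑ i, η(Z_1, …, [W, Z_i], …, Z_k)`. -/
def IsBasic {k : ℕ} (η : ∀ x : M, TangentSpace 𝓘(ℝ, E) x [⋀^Fin k]→L[ℝ] ℝ) : Prop :=
  ∀ W ∈ secs 𝓓.D, ∀ (Z : Fin k → VF E M) (x : M),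
    (∀ i, η x (Function.update (fun l => Z l x) i (W x)) = 0) ∧
    mvfderiv 𝓘(ℝ, E) (fun y => η y fun l => Z l y) x (W x) =
      ∑ i, η x (Function.update (fun l => Z l x) i (⁅W, Z i⁆ x))

end RegularFoliation

/-- The vector field `Y` on `M` restricts to the vector field `Z` on the submanifold
`j : M' → M`. -/
def Restricts [IsManifold 𝓘(ℝ, E') ∞ M'] (j : M' → M) (Y : VF E M) (Z : VF E' M') : Prop :=
  ∀ s, Y (j s) = mfderiv 𝓘(ℝ, E') 𝓘(ℝ, E) j s (Z s)

/-- The symmetry data of a constraint manifold: `I` is the ideal of functions vanishing on the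
submanifold `j : M' → M`, and `𝓕` consists of the derivations `X` of `C^∞(M)` with
`X|_{M'} ∈ Γ(D)`, that is, whose value at each point of the submanifold is the derivative along
some vector in `D`. -/
def symmetryData [IsManifold 𝓘(ℝ, E') ∞ M'] [FiniteDimensional ℝ E'] (j : M' → M)
    (𝓓 : RegularFoliation E' M') : SymmetryData ℝ (Fun E M) where
  I :=
    { carrier := {f | ∀ s, f (j s) = 0}
      add_mem' := fun {f g} hf hg s => by
        change f (j s) + g (j s) = 0
        rw [hf s, hg s, add_zero]
      zero_mem' := fun _ => rfl
      smul_mem' := fun g f hf s => by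
        change g (j s) * f (j s) = 0
        rw [hf s, mul_zero] }
  F :=
    { carrier := {X | ∀ s, ∃ v ∈ 𝓓.D s, ∀ f : Fun E M,
        X f (j s) = mvfderiv 𝓘(ℝ, E) f (j s) (mfderiv 𝓘(ℝ, E') 𝓘(ℝ, E) j s v)}
      add_mem' := fun {X Y} hX hY s => by
        obtain ⟨v, hv, h⟩ := hX s
        obtain ⟨w, hw, h'⟩ := hY s
        refine ⟨v + w, add_mem hv hw, fun f => ?_⟩
        rw [map_add, map_add, ← h, ← h']
        rfl
      zero_mem' := fun s => ⟨0, zero_mem _, fun f => by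
        rw [map_zero, map_zero]; rfl⟩
      smul_mem' := fun g X hX s => by
        obtain ⟨v, hv, h⟩ := hX s
        refine ⟨g (j s) • v, Submodule.smul_mem _ _ hv, fun f => ?_⟩
        rw [map_smul, map_smul, ← h]
        rfl }
  null_le X hX s := ⟨0, zero_mem _, fun f => by
    rw [map_zero, map_zero]; exact hX f s⟩
  le_wobs X hX f hf s := by
    obtain ⟨v, -, h⟩ := hX s
    rw [h]
    by_cases hj : MDifferentiableAt 𝓘(ℝ, E') 𝓘(ℝ, E) j s
    · rw [← mvfderiv_comp_apply s (VF.fun_mdiffAt f (j s)) hj]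
      have h0 : (f : M → ℝ) ∘ j = fun _ => 0 := funext hf
      rw [h0, mvfderiv_const]
      rfl
    · rw [mfderiv_zero_of_not_mdifferentiableAt hj]
      exact map_zero _

end Geometry

end ConstraintReduction

/-!
Vector fields on a manifold are the derivations of its smooth functions and, by tensoriality, forms
are the alternating maps on derivations; both reduce to cut-off coordinate functions and coordinate
fields around a point.

Restriction along the closed embedding `j` is surjective on functions, vector fields and forms.
Hence a condition involving all fields on `M` which restrict to `S` is a condition involving all
fields on `S`, and the conditions which define the constraint objects become conditions on
restrictions to `S`: constant along the leaves, projectable, basic.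

Those are exactly the objects which descend along the surjective submersion `π`, and they descend
uniquely. Reduction is therefore the relation of having the same restriction to `S` between objects
on `M` and objects on the leaf space; it respects brackets, contractions and differentials because
`j`-relatedness and `π`-relatedness of vector fields do.
-/

namespace ConstraintReduction

noncomputable section

open VectorField Filter Topology

section Hadamard

variable {E : Type*} [NormedAddCommGroup E] [NormedSpace ℝ E]

lemma contDiff_intervalIntegral_param [FiniteDimensional ℝ E] {G : E × ℝ → ℝ}
    (hG : ContDiff ℝ ∞ G) : ContDiff ℝ ∞ fun x => ∫ t in (0 : ℝ)..1, G (x, t) := by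
  -- The integral is the convolution at `0` of the indicator of `(0, 1]` with `s ↦ χ s * G (x, -s)`.
  obtain ⟨χ, hχ⟩ : ∃ χ : ContDiffBump (0 : ℝ), χ.rIn = 2 := ⟨⟨2, 3, by norm_num, by norm_num⟩, rfl⟩
  have hconv := MeasureTheory.contDiffOn_convolution_right_with_param_comp (𝕜 := ℝ) (G := ℝ)
    (μ := MeasureTheory.volume) (n := ⊤) (ContinuousLinearMap.mul ℝ ℝ) (s := (Set.univ : Set E))
    (v := fun _ => 0) contDiffOn_const (f := Set.indicator (Set.Ioc (0 : ℝ) 1) 1)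
    (g := fun x s => χ s * G (x, -s)) (k := tsupport χ) isOpen_univ χ.hasCompactSupport
    (fun p x _ hx => by rw [image_eq_zero_of_notMem_tsupport hx, zero_mul])
    ((MeasureTheory.integrable_indicator_iff measurableSet_Ioc).2
      (MeasureTheory.integrableOn_const (by simp)) |>.locallyIntegrable)
    (((χ.contDiff.comp contDiff_snd).mul
      (hG.comp (contDiff_fst.prodMk contDiff_snd.neg))).contDiffOn)
  rw [contDiffOn_univ] at hconv
  convert hconv using 2 with x
  rw [intervalIntegral.integral_of_le zero_le_one,
    ← MeasureTheory.integral_indicator measurableSet_Ioc]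
  refine MeasureTheory.integral_congr_ae (.of_forall fun t => ?_)
  by_cases ht : t ∈ Set.Ioc (0 : ℝ) 1
  · have hχt : χ (0 - t) = 1 := χ.one_of_mem_closedBall (by
      rw [hχ, zero_sub, mem_closedBall_zero_iff, norm_neg, Real.norm_of_nonneg ht.1.le]
      linarith [ht.2])
    simp only [Set.indicator_of_mem ht, ContinuousLinearMap.mul_apply', hχt]
    simp
  · simp [Set.indicator_of_notMem ht]

lemma exists_contDiff_eq_add_sum_repr_sub_mul {ι : Type*} [Fintype ι] (b : Module.Basis ι ℝ E)
    {F : E → ℝ} (hF : ContDiff ℝ ∞ F) (z₀ : E) :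
    ∃ H : ι → E → ℝ, (∀ i, ContDiff ℝ ∞ (H i)) ∧
      ∀ z, F z = F z₀ + ∑ i, (b.repr z i - b.repr z₀ i) * H i z := by
  have := b.finiteDimensional_of_finite
  have hdF : ContDiff ℝ ∞ (fderiv ℝ F) := hF.fderiv_right (by simp)
  have hparam (i : ι) : ContDiff ℝ ∞ fun p : E × ℝ => fderiv ℝ F (z₀ + p.2 • (p.1 - z₀)) (b i) :=
    (hdF.comp (by fun_prop)).clm_apply contDiff_const
  refine ⟨fun i z => ∫ t in (0 : ℝ)..1, fderiv ℝ F (z₀ + t • (z - z₀)) (b i),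
    fun i => contDiff_intervalIntegral_param (hparam i), fun z => ?_⟩
  have hderiv : ∀ t ∈ Set.uIcc (0 : ℝ) 1, HasDerivAt (fun t : ℝ => F (z₀ + t • (z - z₀)))
      (fderiv ℝ F (z₀ + t • (z - z₀)) (z - z₀)) t := fun t _ => by
    have hline : HasDerivAt (fun t : ℝ => z₀ + t • (z - z₀)) (z - z₀) t := by
      simpa using ((hasDerivAt_id t).smul_const (z - z₀)).const_add z₀
    exact (hF.differentiable (by simp)).differentiableAt.hasFDerivAt.comp_hasDerivAt t hline
  have hcont (v : E) : Continuous fun t : ℝ => fderiv ℝ F (z₀ + t • (z - z₀)) v :=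
    (hdF.continuous.comp (by fun_prop)).clm_apply continuous_const
  have hsum (t : ℝ) : fderiv ℝ F (z₀ + t • (z - z₀)) (z - z₀) =
      ∑ i, (b.repr z i - b.repr z₀ i) * fderiv ℝ F (z₀ + t • (z - z₀)) (b i) := by
    generalize fderiv ℝ F (z₀ + t • (z - z₀)) = L
    conv_lhs => rw [← b.sum_repr (z - z₀), map_sum]
    simp
  have hint := intervalIntegral.integral_eq_sub_of_hasDerivAt hderiv
    ((hcont (z - z₀)).intervalIntegrable 0 1)
  simp only [hsum, one_smul, zero_smul, add_zero, add_sub_cancel] at hint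
  rw [intervalIntegral.integral_finsetSum fun i _ =>
    ((hcont (b i)).const_mul _).intervalIntegrable 0 1] at hint
  simp only [intervalIntegral.integral_const_mul] at hint
  rw [hint, add_sub_cancel]

end Hadamard

section Cutoff

variable {E M : Type*} [NormedAddCommGroup E] [NormedSpace ℝ E] [FiniteDimensional ℝ E]
  [TopologicalSpace M] [ChartedSpace E M] [IsManifold 𝓘(ℝ, E) ∞ M] [T2Space M]

lemma exists_fun_eventuallyEq {x : M} {f : M → ℝ} {s : Set M} (hs : s ∈ 𝓝 x)
    (hf : ContMDiffOn 𝓘(ℝ, E) 𝓘(ℝ, ℝ) ∞ f s) : ∃ g : Fun E M, g =ᶠ[𝓝 x] f := by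
  obtain ⟨χ, -, hχ⟩ := (SmoothBumpFunction.nhds_basis_tsupport (I := 𝓘(ℝ, E)) x).mem_iff.1
    (interior_mem_nhds.2 hs)
  refine ⟨⟨fun y => χ y • f y, contMDiff_of_tsupport fun y hy => ?_⟩, ?_⟩
  · exact χ.contMDiffAt.smul (hf.contMDiffAt
      (mem_interior_iff_mem_nhds.1 (hχ (tsupport_smul_subset_left _ _ hy))))
  · filter_upwards [χ.eventuallyEq_one] with y hy
    simp [hy]

lemma exists_fun_eq_one_support_subset {x : M} {s : Set M} (hs : s ∈ 𝓝 x) :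
    ∃ χ : Fun E M, χ x = 1 ∧ Function.support χ ⊆ s := by
  obtain ⟨χ, -, hχ⟩ := (SmoothBumpFunction.nhds_basis_tsupport (I := 𝓘(ℝ, E)) x).mem_iff.1 hs
  exact ⟨⟨χ, χ.contMDiff⟩, χ.eq_one, (subset_tsupport _).trans hχ⟩

end Cutoff

section Coordinates

variable {E M : Type*} [NormedAddCommGroup E] [NormedSpace ℝ E] [FiniteDimensional ℝ E]
  [TopologicalSpace M] [ChartedSpace E M] [IsManifold 𝓘(ℝ, E) ∞ M] [T2Space M]

/-- A choice of bump function at `x₀`. -/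
def bumpAt (x₀ : M) : SmoothBumpFunction 𝓘(ℝ, E) x₀ := Classical.arbitrary _

/-- The coordinates of the preferred chart at `x₀`, cut off to globally defined functions. -/
def coordFun (x₀ : M) (i : Fin (Module.finrank ℝ E)) : Fun E M :=
  ⟨fun x => bumpAt (E := E) x₀ x •
      (Module.finBasis ℝ E).coord i (extChartAt 𝓘(ℝ, E) x₀ x),
    SmoothBumpFunction.contMDiff_smul _
      ((LinearMap.toContinuousLinearMap _).contMDiff.comp_contMDiffOn contMDiffOn_extChartAt)⟩

/-- The coordinate vector fields of the preferred chart at `x₀`, cut off to globally defined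
vector fields. -/
def coordField (x₀ : M) (i : Fin (Module.finrank ℝ E)) : VF E M :=
  ⟨fun x => bumpAt (E := E) x₀ x •
      (trivializationAt E (TangentSpace 𝓘(ℝ, E) : M → Type _) x₀).localFrame
        (Module.finBasis ℝ E) i x,
    ContMDiffOn.smul_section_of_tsupport
      (SmoothBumpFunction.contMDiff _).contMDiffOn (chartAt E x₀).open_source
      (SmoothBumpFunction.tsupport_subset_chartAt_source _)
      (Bundle.Trivialization.contMDiffOn_localFrame_baseSet _ _ _ i)⟩

lemma coordFun_eventuallyEq (x₀ : M) (i : Fin (Module.finrank ℝ E)) :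
    coordFun (E := E) x₀ i =ᶠ[𝓝 x₀]
      fun x => (Module.finBasis ℝ E).coord i (extChartAt 𝓘(ℝ, E) x₀ x) := by
  filter_upwards [(bumpAt (E := E) x₀).eventuallyEq_one] with x hx
  simp [coordFun, hx]

lemma coordField_eventuallyEq (x₀ : M) (i : Fin (Module.finrank ℝ E)) :
    ∀ᶠ x in 𝓝 x₀, coordField x₀ i x =
      (trivializationAt E (TangentSpace 𝓘(ℝ, E) : M → Type _) x₀).localFrame
        (Module.finBasis ℝ E) i x := by
  filter_upwards [(bumpAt (E := E) x₀).eventuallyEq_one] with x hx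
  simp [coordField, hx]

lemma mvfderiv_coordFun_eventuallyEq (x₀ : M) :
    ∀ᶠ x in 𝓝 x₀, ∀ i (v : TangentSpace 𝓘(ℝ, E) x), mvfderiv 𝓘(ℝ, E) (coordFun (E := E) x₀ i) x v =
      (Module.finBasis ℝ E).coord i
        ((trivializationAt E (TangentSpace 𝓘(ℝ, E) : M → Type _) x₀).continuousLinearMapAt
          ℝ x v) := by
  have : IsManifold 𝓘(ℝ, E) 1 M := IsManifold.of_le (n := ∞) (by simp)
  filter_upwards [eventually_all.2 fun i => (coordFun_eventuallyEq (E := E) x₀ i).eventually_nhds,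
    (chartAt E x₀).open_source.mem_nhds (mem_chart_source E x₀)] with x hcoord hx i v
  rw [TangentBundle.continuousLinearMapAt_trivializationAt hx]
  set L := LinearMap.toContinuousLinearMap ((Module.finBasis ℝ E).coord i)
  change mfderiv 𝓘(ℝ, E) 𝓘(ℝ, ℝ) (coordFun x₀ i) x v = _
  rw [Filter.EventuallyEq.mfderiv_eq (hcoord i)]
  have hcomp := mfderiv_comp_apply (I := 𝓘(ℝ, E)) (I' := 𝓘(ℝ, E)) (I'' := 𝓘(ℝ, ℝ))
    (f := extChartAt 𝓘(ℝ, E) x₀) (g := L) x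
    (L.differentiableAt.mdifferentiableAt) (mdifferentiableAt_extChartAt hx) v
  rw [mfderiv_eq_fderiv, L.fderiv] at hcomp
  exact hcomp

lemma mvfderiv_coordFun_coordField (x₀ : M) : ∀ᶠ x in 𝓝 x₀, ∀ i l,
    mvfderiv 𝓘(ℝ, E) (coordFun (E := E) x₀ i) x (coordField x₀ l x) = if i = l then 1 else 0 := by
  filter_upwards [mvfderiv_coordFun_eventuallyEq (E := E) x₀,
    eventually_all.2 (coordField_eventuallyEq (E := E) x₀),
    (chartAt E x₀).open_source.mem_nhds (mem_chart_source E x₀)] with x hcoord hfield hx i l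
  have hxT : x ∈ (trivializationAt E (TangentSpace 𝓘(ℝ, E) : M → Type _) x₀).baseSet := hx
  rw [hcoord, hfield, Bundle.Trivialization.localFrame_apply_of_mem_baseSet _ _ hxT]
  simp [Bundle.Trivialization.basisAt, Bundle.Trivialization.coe_linearMapAt_of_mem _ hxT,
    Bundle.Trivialization.apply_mk_symm _ hxT, Finsupp.single_apply, eq_comm]

lemma eq_sum_mvfderiv_coordFun_smul (x₀ : M) : ∀ᶠ x in 𝓝 x₀, ∀ v : TangentSpace 𝓘(ℝ, E) x,
    v = ∑ i, mvfderiv 𝓘(ℝ, E) (coordFun (E := E) x₀ i) x v • coordField x₀ i x := by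
  filter_upwards [mvfderiv_coordFun_eventuallyEq (E := E) x₀,
    eventually_all.2 (coordField_eventuallyEq (E := E) x₀),
    (chartAt E x₀).open_source.mem_nhds (mem_chart_source E x₀)] with x hcoord hfield hx v
  have hxT : x ∈ (trivializationAt E (TangentSpace 𝓘(ℝ, E) : M → Type _) x₀).baseSet := hx
  conv_lhs => rw [← (Bundle.Trivialization.basisAt _ (Module.finBasis ℝ E) hxT).sum_repr v]
  refine Finset.sum_congr rfl fun i _ => ?_
  rw [hcoord, hfield, Bundle.Trivialization.localFrame_apply_of_mem_baseSet _ _ hxT]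
  congr 1
  simp [Bundle.Trivialization.basisAt, Bundle.Trivialization.coe_linearMapAt_of_mem _ hxT]

lemma exists_eventually_eq_add_sum_coordFun_sub_mul (x₀ : M) (f : Fun E M) :
    ∃ h : Fin (Module.finrank ℝ E) → Fun E M, ∀ᶠ x in 𝓝 x₀,
      f x = f x₀ + ∑ i, (coordFun (E := E) x₀ i x - coordFun x₀ i x₀) * h i x := by
  set φ := extChartAt 𝓘(ℝ, E) x₀
  have hsource : (chartAt E x₀).source ∈ 𝓝 x₀ :=
    (chartAt E x₀).open_source.mem_nhds (mem_chart_source E x₀)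
  obtain ⟨F, hF⟩ := exists_fun_eventuallyEq (E := E) (M := E) (f := f ∘ φ.symm)
    (extChartAt_target_mem_nhds x₀) (f.contMDiff.comp_contMDiffOn (contMDiffOn_extChartAt_symm x₀))
  obtain ⟨H, hH, hFH⟩ := exists_contDiff_eq_add_sum_repr_sub_mul (Module.finBasis ℝ E)
    (contMDiff_iff_contDiff.1 F.contMDiff) (φ x₀)
  choose h hh using fun i => exists_fun_eventuallyEq (E := E) hsource
    (f := fun x => H i (φ x)) ((hH i).contMDiff.comp_contMDiffOn contMDiffOn_extChartAt)
  have hfF : ∀ᶠ x in 𝓝 x₀, F (φ x) = f x := by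
    filter_upwards [(continuousAt_extChartAt x₀).eventually hF,
      extChartAt_source_mem_nhds (I := 𝓘(ℝ, E)) x₀] with x hx hxs
    rw [hx, Function.comp_apply, φ.left_inv hxs]
  refine ⟨h, ?_⟩
  filter_upwards [hfF, eventually_all.2 (coordFun_eventuallyEq (E := E) x₀), eventually_all.2 hh]
    with x hfx hcoord hhx
  rw [← hfx, ← hfF.self_of_nhds, hFH]
  simp only [hcoord, hhx, fun i => (coordFun_eventuallyEq (E := E) x₀ i).self_of_nhds]
  rfl

end Coordinates

section Derivations

variable {E M : Type*} [NormedAddCommGroup E] [NormedSpace ℝ E]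
  [TopologicalSpace M] [ChartedSpace E M]

lemma fun_sum_apply {ι : Type*} (s : Finset ι) (f : ι → Fun E M) (x : M) :
    (∑ i ∈ s, f i) x = ∑ i ∈ s, f i x :=
  map_sum (ContMDiffMap.evalRingHom x) f s

variable [IsManifold 𝓘(ℝ, E) ∞ M]

lemma vf_sum_apply {ι : Type*} (s : Finset ι) (Y : ι → VF E M) (x : M) :
    (∑ i ∈ s, Y i) x = ∑ i ∈ s, Y i x :=
  (congrFun (map_sum (ContMDiffSection.coeAddHom 𝓘(ℝ, E) E ∞
    (fun x : M => TangentSpace 𝓘(ℝ, E) x)) Y s) x).trans (Finset.sum_apply _ _ _)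

lemma VF.smul_apply (f : Fun E M) (Y : VF E M) (x : M) : (f • Y) x = f x • Y x := rfl

/-- The derivation of germs at `x` given by the derivative in the direction of a tangent vector. -/
def dirDeriv {x : M} (v : TangentSpace 𝓘(ℝ, E) x) : PointDerivation 𝓘(ℝ, E) x :=
  Derivation.mk'
    { toFun := fun f => mvfderiv 𝓘(ℝ, E) f x v
      map_add' := fun f g => congrArg (fun L => L v)
        (mvfderiv_add (VF.fun_mdiffAt f x) (VF.fun_mdiffAt g x))
      map_smul' := fun c f => by
        have h := mvfderiv_smul (I := 𝓘(ℝ, E)) (a := fun _ : M => c) (x := x)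
          mdifferentiableAt_const (VF.fun_mdiffAt f x)
        rw [mvfderiv_const, ContinuousLinearMap.zero_smulRight, add_zero] at h
        exact congrArg (fun L => L v) h }
    fun f g => congrArg (fun L => L v) (mvfderiv_mul (VF.fun_mdiffAt f x) (VF.fun_mdiffAt g x))

lemma dirDeriv_apply {x : M} (v : TangentSpace 𝓘(ℝ, E) x) (f : Fun E M) :
    dirDeriv v f = mvfderiv 𝓘(ℝ, E) f x v := rfl

variable [FiniteDimensional ℝ E]

lemma VF.toDer_apply (Y : VF E M) (f : Fun E M) : Y.toDer f = ⁅Y, f⁆ := rfl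

lemma VF.toDer_add (Y Z : VF E M) : (Y + Z).toDer = Y.toDer + Z.toDer :=
  map_add (LinearMapClass.linearMap
    (LieRinehartAlgebra.anchor ℝ (Fun E M) (VF E M)).toLieHom) Y Z

lemma VF.toDer_smul (f : Fun E M) (Y : VF E M) : (f • Y).toDer = f • Y.toDer :=
  (LieRinehartAlgebra.anchor ℝ (Fun E M) (VF E M)).map_smul_apply f Y

lemma VF.toDer_lie (Y Z : VF E M) : ⁅Y, Z⁆.toDer = ⁅Y.toDer, Z.toDer⁆ :=
  (LieRinehartAlgebra.anchor ℝ (Fun E M) (VF E M)).toLieHom.map_lie Y Z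

variable [T2Space M] {x : M}

lemma pointDerivation_congr (D : PointDerivation 𝓘(ℝ, E) x) {f g : Fun E M} (h : f =ᶠ[𝓝 x] g) :
    D f = D g := by
  obtain ⟨χ, hχx, hχ⟩ := exists_fun_eq_one_support_subset (E := E) h
  have hmul : χ * (f - g) = 0 := by
    ext y
    by_cases hy : χ y = 0
    · exact mul_eq_zero_of_left hy _
    · exact mul_eq_zero_of_right _ (sub_eq_zero.2 (hχ hy))
  have hleibniz : D (χ * (f - g)) = χ x * D (f - g) + (f x - g x) * D χ := D.leibniz χ (f - g)
  rw [hmul, hχx, h.self_of_nhds, sub_self, zero_mul, add_zero, one_mul] at hleibniz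
  exact sub_eq_zero.1 ((map_sub D f g).symm.trans (hleibniz.symm.trans (map_zero D)))

lemma pointDerivation_eq_sum_mul (D : PointDerivation 𝓘(ℝ, E) x) {f : Fun E M}
    {h : Fin (Module.finrank ℝ E) → Fun E M}
    (hf : ∀ᶠ y in 𝓝 x, f y = f x + ∑ i, (coordFun (E := E) x i y - coordFun x i x) * h i y) :
    D f = ∑ i, D (coordFun x i) * h i x := by
  let const (c : ℝ) : Fun E M := algebraMap ℝ _ c
  let L : Fun E M →ₗ[ℝ] ℝ := D.toLinearMap
  have hmul (f g : Fun E M) : L (f * g) = f x * L g + g x * L f := D.leibniz f g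
  have hconst (c : ℝ) : L (const c) = 0 := D.map_algebraMap c
  let g (i) : Fun E M := coordFun x i - const (coordFun (E := E) x i x)
  have hg (i) : g i x = 0 := sub_self _
  have hLg (i) : L (g i) = D (coordFun x i) := by
    rw [map_sub, hconst, sub_zero]
    rfl
  have hgerm : f =ᶠ[𝓝 x] (const (f x) + ∑ i, g i * h i : Fun E M) := by
    filter_upwards [hf] with y hy
    exact hy.trans (congrArg (f x + ·) (fun_sum_apply Finset.univ (fun i => g i * h i) y).symm)
  calc D f = L (const (f x) + ∑ i, g i * h i) := pointDerivation_congr D hgerm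
    _ = ∑ i, D (coordFun x i) * h i x := by
      simp only [map_add, map_sum, hconst, hmul, hg, hLg, zero_add, zero_mul, add_zero, mul_comm]

lemma exists_eq_dirDeriv (D : PointDerivation 𝓘(ℝ, E) x) :
    ∃ v : TangentSpace 𝓘(ℝ, E) x, D = dirDeriv v := by
  refine ⟨∑ i, D (coordFun x i) • coordField x i x, Derivation.ext fun f => ?_⟩
  obtain ⟨h, hf⟩ := exists_eventually_eq_add_sum_coordFun_sub_mul x f
  rw [pointDerivation_eq_sum_mul D hf, pointDerivation_eq_sum_mul _ hf]
  refine Finset.sum_congr rfl fun i _ => congrArg (· * h i x) ?_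
  rw [dirDeriv_apply, map_sum]
  simp [(mvfderiv_coordFun_coordField (E := E) x).self_of_nhds]

lemma tangent_ext {v w : TangentSpace 𝓘(ℝ, E) x}
    (h : ∀ f : Fun E M, mvfderiv 𝓘(ℝ, E) f x v = mvfderiv 𝓘(ℝ, E) f x w) : v = w := by
  rw [(eq_sum_mvfderiv_coordFun_smul x).self_of_nhds v,
    (eq_sum_mvfderiv_coordFun_smul x).self_of_nhds w]
  simp only [h]

/-- A linear choice of vector fields through the tangent vectors at a point. -/
def extendVec (x : M) : TangentSpace 𝓘(ℝ, E) x →ₗ[ℝ] VF E M :=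
  ∑ i, (mvfderiv 𝓘(ℝ, E) (coordFun x i) x : TangentSpace 𝓘(ℝ, E) x →ₗ[ℝ] ℝ).smulRight
    (coordField x i)

lemma extendVec_apply (x : M) (v : TangentSpace 𝓘(ℝ, E) x) : extendVec x v x = v := by
  refine Eq.trans ?_ ((eq_sum_mvfderiv_coordFun_smul x).self_of_nhds v).symm
  rw [extendVec, LinearMap.sum_apply, vf_sum_apply]
  rfl

lemma contMDiff_of_forall_mvfderiv {X : ∀ x : M, TangentSpace 𝓘(ℝ, E) x}
    (hX : ∀ f : Fun E M, ContMDiff 𝓘(ℝ, E) 𝓘(ℝ, ℝ) ∞ fun x => mvfderiv 𝓘(ℝ, E) f x (X x)) :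
    ContMDiff 𝓘(ℝ, E) (𝓘(ℝ, E).prod 𝓘(ℝ, E)) ∞
      (fun y => (⟨y, X y⟩ : TangentBundle 𝓘(ℝ, E) M)) := by
  intro x
  let V : VF E M := ∑ i, (show Fun E M from ⟨_, hX (coordFun x i)⟩) • coordField x i
  refine (V.contMDiff x).congr_of_eventuallyEq ?_
  filter_upwards [eq_sum_mvfderiv_coordFun_smul (E := E) x] with y hy
  congr 1
  rw [vf_sum_apply]
  exact hy (X y)

lemma VF.toDer_bijective : Function.Bijective (VF.toDer (E := E) (M := M)) := by
  refine ⟨fun Y Z h => ContMDiffSection.ext fun x => tangent_ext fun f => ?_, fun D => ?_⟩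
  · exact congrArg (fun D : Derivation ℝ (Fun E M) (Fun E M) => D f x) h
  · choose X hX using fun x : M => exists_eq_dirDeriv (Derivation.evalAt x D)
    have hDX (f : Fun E M) (x : M) : D f x = mvfderiv 𝓘(ℝ, E) f x (X x) :=
      congrArg (fun D : PointDerivation 𝓘(ℝ, E) x => D f) (hX x)
    refine ⟨⟨X, contMDiff_of_forall_mvfderiv fun f => ?_⟩, ?_⟩
    · simpa only [← hDX] using (D f).contMDiff
    · ext f x
      exact (hDX f x).symm

/-- Vector fields as derivations of the algebra of smooth functions. -/
def derEquiv : VF E M ≃ₗ[Fun E M] Derivation ℝ (Fun E M) (Fun E M) :=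
  LinearEquiv.ofBijective
    { toFun := VF.toDer, map_add' := VF.toDer_add, map_smul' := VF.toDer_smul }
    VF.toDer_bijective

lemma toDer_derEquiv_symm (D : Derivation ℝ (Fun E M) (Fun E M)) :
    (derEquiv.symm D).toDer = D := derEquiv.apply_symm_apply D

lemma derEquiv_symm_toDer (Y : VF E M) : derEquiv.symm Y.toDer = Y := derEquiv.symm_apply_apply Y

lemma derEquiv_symm_const_smul (c : ℝ) (D : Derivation ℝ (Fun E M) (Fun E M)) :
    derEquiv.symm (c • D) = c • derEquiv.symm D := by
  rw [LinearEquiv.symm_apply_eq]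
  conv_lhs => rw [← derEquiv.apply_symm_apply D]
  exact ((LieRinehartAlgebra.anchor ℝ (Fun E M) (VF E M)).toLieHom.map_smul c _).symm

end Derivations

section Multilinear

lemma multilinearMap_eq_of_sub_mem {R ι V W : Type*} [Ring R] [Finite ι]
    [AddCommGroup V] [Module R V] [AddCommGroup W] [Module R W]
    (f : MultilinearMap R (fun _ : ι => V) W) {N : Set V}
    (hf : ∀ v i, v i ∈ N → f v = 0) {v w : ι → V} (h : ∀ i, v i - w i ∈ N) : f v = f w := by
  classical
  cases nonempty_fintype ι
  rw [← add_sub_cancel w v, f.map_add_univ, Finset.sum_eq_single Finset.univ]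
  · rw [Finset.piecewise_univ]
  · intro s _ hs
    obtain ⟨i, hi⟩ : ∃ i, i ∉ s := by simpa [Finset.eq_univ_iff_forall] using hs
    exact hf _ i (by simpa [hi] using h i)
  · simp

lemma multilinearMap_apply_eq_sum_basis {R ι κ V W : Type*} [CommSemiring R] [Fintype ι]
    [DecidableEq ι] [Fintype κ] [AddCommMonoid V] [Module R V] [AddCommMonoid W] [Module R W]
    (f : MultilinearMap R (fun _ : ι => V) W) {c : ι → κ → R} {e : κ → V} {v : ι → V}
    (hv : ∀ a, v a = ∑ i, c a i • e i) :
    f v = ∑ r : ι → κ, (∏ a, c a (r a)) • f fun a => e (r a) := by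
  rw [funext hv, f.map_sum]
  exact Finset.sum_congr rfl fun r _ => f.map_smul_univ _ _

lemma continuous_multilinearMap {ι E F : Type*} [Finite ι] [NormedAddCommGroup E]
    [NormedSpace ℝ E] [FiniteDimensional ℝ E] [TopologicalSpace F] [AddCommGroup F] [Module ℝ F]
    [ContinuousAdd F] [ContinuousSMul ℝ F] (f : MultilinearMap ℝ (fun _ : ι => E) F) :
    Continuous f := by
  classical
  cases nonempty_fintype ι
  let b := Module.finBasis ℝ E
  have hf : (f : (ι → E) → F) = fun v => ∑ r : ι → Fin (Module.finrank ℝ E),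
      (∏ a, b.coord (r a) (v a)) • f fun a => b (r a) := funext fun v =>
    multilinearMap_apply_eq_sum_basis f fun a => (b.sum_repr (v a)).symm
  rw [hf]
  refine continuous_finsetSum _ fun r _ => (continuous_finsetProd _ fun a _ => ?_).smul
    continuous_const
  exact (b.coord (r a)).continuous_of_finiteDimensional.comp (continuous_apply a)

end Multilinear

section Forms

variable {E M : Type*} [NormedAddCommGroup E] [NormedSpace ℝ E] [FiniteDimensional ℝ E]
  [TopologicalSpace M] [ChartedSpace E M]

/-- An alternating form on a tangent space, with its automatic continuity. -/
def toContAlt {k : ℕ} {x : M} (f : TangentSpace 𝓘(ℝ, E) x [⋀^Fin k]→ₗ[ℝ] ℝ) :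
    TangentSpace 𝓘(ℝ, E) x [⋀^Fin k]→L[ℝ] ℝ :=
  { f with cont := continuous_multilinearMap (E := E) f.toMultilinearMap }

variable [IsManifold 𝓘(ℝ, E) ∞ M] {k : ℕ}

omit [FiniteDimensional ℝ E] in
lemma vf_update_apply [DecidableEq (Fin k)] (V : Fin k → VF E M) (i : Fin k) (Z : VF E M) (x : M) :
    (fun l => Function.update V i Z l x) = Function.update (fun l => V l x) i (Z x) :=
  funext fun l => Function.apply_update (fun _ (Z : VF E M) => Z x) V i Z l

omit [FiniteDimensional ℝ E] in
lemma DiffForm.eval_apply (σ : DiffForm E M k) (V : Fin k → VF E M) (x : M) :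
    DiffForm.eval σ V x = σ.1 x fun i => V i x := rfl

/-- A differential form as an alternating `C^∞(M)`-multilinear map on the vector fields. -/
def DiffForm.toAlt (σ : DiffForm E M k) : VF E M [⋀^Fin k]→ₗ[Fun E M] Fun E M where
  toFun := DiffForm.eval σ
  map_update_add' V i X Y := by
    ext x
    change σ.1 x _ = σ.1 x _ + σ.1 x _
    rw [vf_update_apply, vf_update_apply, vf_update_apply]
    exact (σ.1 x).map_update_add _ i (X x) (Y x)
  map_update_smul' V i f X := by
    ext x
    change σ.1 x _ = f x * σ.1 x _
    rw [vf_update_apply, vf_update_apply]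
    exact (σ.1 x).map_update_smul _ i (f x) (X x)
  map_eq_zero_of_eq' V i l h hne := by
    ext x
    exact (σ.1 x).map_eq_zero_of_eq (fun i => V i x) (congrArg (fun X : VF E M => X x) h) hne

/-- The value at `x` of an alternating map on vector fields, as a real form. -/
def evalAlt (α : VF E M [⋀^Fin k]→ₗ[Fun E M] Fun E M) (x : M) : VF E M [⋀^Fin k]→ₗ[ℝ] ℝ :=
  { ((LinearMap.proj x).comp ContMDiffMap.coeFnLinearMap : Fun E M →ₗ[ℝ] ℝ).compMultilinearMap
      (α.toMultilinearMap.restrictScalars ℝ) with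
    map_eq_zero_of_eq' := fun V _ _ h hne =>
      congrArg (fun f : Fun E M => f x) (α.map_eq_zero_of_eq V h hne) }

variable [T2Space M]

lemma exists_smul_eq_sum_coordField (x : M) : ∃ χ : Fun E M, χ x = 1 ∧
    ∀ Y : VF E M, χ • Y = ∑ i, (χ * ⁅Y, coordFun x i⁆) • coordField x i := by
  obtain ⟨χ, hχx, hχ⟩ :=
    exists_fun_eq_one_support_subset (E := E) (eq_sum_mvfderiv_coordFun_smul (E := E) x)
  refine ⟨χ, hχx, fun Y => ContMDiffSection.ext fun y => ?_⟩
  rw [vf_sum_apply, VF.smul_apply]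
  change _ = ∑ i, (χ y * mvfderiv 𝓘(ℝ, E) (coordFun x i) y (Y y)) • coordField x i y
  simp only [mul_smul, ← Finset.smul_sum]
  by_cases hy : χ y = 0
  · rw [hy, zero_smul, zero_smul]
  · rw [← hχ hy (Y y)]

lemma linearMap_apply_eq_zero (β : VF E M →ₗ[Fun E M] Fun E M) {Y : VF E M} {x : M}
    (h : Y x = 0) : β Y x = 0 := by
  obtain ⟨χ, hχx, hχ⟩ := exists_smul_eq_sum_coordField (E := E) x
  have hsum : χ * β Y = ∑ i, (χ * ⁅Y, coordFun x i⁆) * β (coordField x i) := by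
    simpa only [map_smul, map_sum, smul_eq_mul] using congrArg β (hχ Y)
  have hx : χ x * β Y x = 0 := by
    refine (congrArg (fun f : Fun E M => f x) hsum).trans ?_
    refine (fun_sum_apply _ _ x).trans (Finset.sum_eq_zero fun i _ => ?_)
    change χ x * mvfderiv 𝓘(ℝ, E) (coordFun x i) x (Y x) * _ = 0
    rw [h, map_zero, mul_zero, zero_mul]
  rwa [hχx, one_mul] at hx

lemma alternatingMap_apply_congr (α : VF E M [⋀^Fin k]→ₗ[Fun E M] Fun E M)
    {Y Z : Fin k → VF E M} {x : M} (h : ∀ i, Y i x = Z i x) : α Y x = α Z x := by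
  refine multilinearMap_eq_of_sub_mem (evalAlt α x).toMultilinearMap (N := {Y | Y x = 0})
    (fun V i hV => ?_) fun i => sub_eq_zero.2 (h i)
  have hzero := linearMap_apply_eq_zero (α.toMultilinearMap.toLinearMap V i) hV
  rwa [MultilinearMap.toLinearMap_apply, Function.update_eq_self] at hzero

/-- The differential form defined by an alternating `C^∞(M)`-multilinear map on the vector
fields. -/
def formOfAlt (α : VF E M [⋀^Fin k]→ₗ[Fun E M] Fun E M) : DiffForm E M k :=
  ⟨fun x => toContAlt ((evalAlt α x).compLinearMap (extendVec x)), fun V =>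
    (α V).contMDiff.congr fun _ => alternatingMap_apply_congr α fun _ => extendVec_apply _ _⟩

lemma eval_formOfAlt (α : VF E M [⋀^Fin k]→ₗ[Fun E M] Fun E M) (V : Fin k → VF E M) :
    DiffForm.eval (formOfAlt α) V = α V :=
  ContMDiffMap.ext fun _ => alternatingMap_apply_congr α fun _ => extendVec_apply _ _

lemma DiffForm.ext_eval {σ τ : DiffForm E M k}
    (h : ∀ V, DiffForm.eval σ V = DiffForm.eval τ V) : σ = τ := by
  refine Subtype.ext (funext fun x => ContinuousAlternatingMap.ext fun v => ?_)
  have hx := congrArg (fun f : Fun E M => f x) (h fun i => extendVec x (v i))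
  simpa only [DiffForm.eval_apply, extendVec_apply] using hx

variable (E M k) in
/-- Differential forms as alternating multilinear maps on the derivations of `C^∞(M)`. -/
def formEquiv : DiffForm E M k ≃ₗ[ℝ] CE ℝ (Fun E M) k where
  toFun σ := (DiffForm.toAlt σ).compLinearMap derEquiv.symm.toLinearMap
  map_add' _ _ := rfl
  map_smul' _ _ := rfl
  invFun α := formOfAlt (α.compLinearMap derEquiv.toLinearMap)
  left_inv σ := DiffForm.ext_eval fun V => by
    rw [eval_formOfAlt]
    exact congrArg (DiffForm.eval σ) (funext fun i => derEquiv_symm_toDer (V i))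
  right_inv α := by
    ext X : 1
    refine (eval_formOfAlt _ _).trans (congrArg α (funext fun i => toDer_derEquiv_symm (X i)))

lemma formEquiv_apply (σ : DiffForm E M k) (X : Fin k → Derivation ℝ (Fun E M) (Fun E M)) :
    formEquiv E M k σ X = DiffForm.eval σ fun i => derEquiv.symm (X i) := rfl

lemma represents_formEquiv (σ : DiffForm E M k) : Represents σ (formEquiv E M k σ) := fun Y => by
  simp only [formEquiv_apply, derEquiv_symm_toDer]

lemma represents_iff {σ : DiffForm E M k} {α : CE ℝ (Fun E M) k} :
    Represents σ α ↔ formEquiv E M k σ = α := by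
  refine ⟨fun h => ?_, fun h => h ▸ represents_formEquiv σ⟩
  ext X : 1
  have hX := h fun i => derEquiv.symm (X i)
  simp only [toDer_derEquiv_symm] at hX
  exact hX.symm

lemma existsUnique_represents (α : CE ℝ (Fun E M) k) : ∃! σ : DiffForm E M k, Represents σ α := by
  simpa only [represents_iff] using (formEquiv E M k).bijective.existsUnique α

lemma existsUnique_represented (σ : DiffForm E M k) :
    ∃! α : CE ℝ (Fun E M) k, Represents σ α := by
  simp only [represents_iff, existsUnique_eq']

end Forms

section Maps

variable {E M E' M' : Type*} [NormedAddCommGroup E] [NormedSpace ℝ E]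
  [TopologicalSpace M] [ChartedSpace E M] [NormedAddCommGroup E'] [NormedSpace ℝ E']
  [TopologicalSpace M'] [ChartedSpace E' M'] {h : M' → M}

/-- The pullback of smooth functions along a smooth map. -/
def comapFun (hh : ContMDiff 𝓘(ℝ, E') 𝓘(ℝ, E) ∞ h) : Fun E M →ₐ[ℝ] Fun E' M' where
  toFun f := ⟨f ∘ h, f.contMDiff.comp hh⟩
  map_one' := rfl
  map_mul' _ _ := rfl
  map_zero' := rfl
  map_add' _ _ := rfl
  commutes' _ := rfl

lemma comapFun_apply (hh : ContMDiff 𝓘(ℝ, E') 𝓘(ℝ, E) ∞ h) (f : Fun E M) (s : M') :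
    comapFun hh f s = f (h s) := rfl

lemma comapFun_injective (hh : ContMDiff 𝓘(ℝ, E') 𝓘(ℝ, E) ∞ h) (hsurj : Function.Surjective h) :
    Function.Injective (comapFun hh) := fun _ _ hfg =>
  ContMDiffMap.ext <| hsurj.forall.2 fun s => congrArg (fun f : Fun E' M' => f s) hfg

lemma pullback_apply {k : ℕ} (σ : ∀ x : M, TangentSpace 𝓘(ℝ, E) x [⋀^Fin k]→L[ℝ] ℝ) (s : M')
    (v : Fin k → TangentSpace 𝓘(ℝ, E') s) : pullback (E' := E') h σ s v =
      σ (h s) fun i => mfderiv 𝓘(ℝ, E') 𝓘(ℝ, E) h s (v i) := rfl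

variable [IsManifold 𝓘(ℝ, E) ∞ M] [IsManifold 𝓘(ℝ, E') ∞ M']

omit [IsManifold 𝓘(ℝ, E') ∞ M'] in
lemma mvfderiv_comapFun (hh : ContMDiff 𝓘(ℝ, E') 𝓘(ℝ, E) ∞ h) (f : Fun E M) (s : M')
    (v : TangentSpace 𝓘(ℝ, E') s) : mvfderiv 𝓘(ℝ, E') (comapFun hh f) s v =
      mvfderiv 𝓘(ℝ, E) f (h s) (mfderiv 𝓘(ℝ, E') 𝓘(ℝ, E) h s v) :=
  mvfderiv_comp_apply s (VF.fun_mdiffAt f (h s)) ((hh s).mdifferentiableAt (by simp)) v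

lemma pullback_apply_restricts {k : ℕ} (σ : DiffForm E M k) {Y : Fin k → VF E M}
    {Z : Fin k → VF E' M'} (H : ∀ i, Restricts h (Y i) (Z i)) (s : M') :
    pullback (E' := E') h σ.1 s (fun i => Z i s) = DiffForm.eval σ Y (h s) := by
  rw [pullback_apply, DiffForm.eval_apply]
  exact congrArg _ (funext fun i => (H i s).symm)

namespace Restricts

variable {Y Y' : VF E M} {Z Z' : VF E' M'}

lemma lie_comapFun (H : Restricts h Y Z) (hh : ContMDiff 𝓘(ℝ, E') 𝓘(ℝ, E) ∞ h) (f : Fun E M) :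
    ⁅Z, comapFun hh f⁆ = comapFun hh ⁅Y, f⁆ := by
  ext s
  rw [VF.lie_fun_apply, mvfderiv_comapFun, ← H s]
  rfl

lemma add (H : Restricts h Y Z) (H' : Restricts h Y' Z') : Restricts h (Y + Y') (Z + Z') :=
  fun s => (congrArg₂ (· + ·) (H s) (H' s)).trans (map_add _ (Z s) (Z' s)).symm

lemma const_smul (H : Restricts h Y Z) (c : ℝ) : Restricts h (c • Y) (c • Z) :=
  fun s => (congrArg (c • ·) (H s)).trans (map_smul _ c (Z s)).symm

lemma comapFun_smul (H : Restricts h Y Z) (hh : ContMDiff 𝓘(ℝ, E') 𝓘(ℝ, E) ∞ h) (f : Fun E M) :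
    Restricts h (f • Y) (comapFun hh f • Z) :=
  fun s => (congrArg (f (h s) • ·) (H s)).trans (map_smul _ (f (h s)) (Z s)).symm

variable [FiniteDimensional ℝ E] [T2Space M]

lemma of_lie_comapFun (hh : ContMDiff 𝓘(ℝ, E') 𝓘(ℝ, E) ∞ h)
    (H : ∀ f : Fun E M, ⁅Z, comapFun hh f⁆ = comapFun hh ⁅Y, f⁆) : Restricts h Y Z :=
  fun s => tangent_ext fun f => by
    rw [← mvfderiv_comapFun hh]
    exact congrArg (fun g : Fun E' M' => g s) (H f).symm

lemma lie [FiniteDimensional ℝ E'] (hh : ContMDiff 𝓘(ℝ, E') 𝓘(ℝ, E) ∞ h) (H : Restricts h Y Z)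
    (H' : Restricts h Y' Z') : Restricts h ⁅Y, Y'⁆ ⁅Z, Z'⁆ := of_lie_comapFun hh fun f => by
  rw [VF.lie_lie_fun, VF.lie_lie_fun, map_sub, H'.lie_comapFun hh, H.lie_comapFun hh,
    H.lie_comapFun hh, H'.lie_comapFun hh]

end Restricts

end Maps

section Embedding

variable {E M E' S : Type*} [NormedAddCommGroup E] [NormedSpace ℝ E] [TopologicalSpace M]
  [ChartedSpace E M] [NormedAddCommGroup E'] [NormedSpace ℝ E'] [TopologicalSpace S]
  [ChartedSpace E' S] {j : S → M}

lemma exists_local_retraction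
    (hj : Manifold.IsSmoothEmbedding 𝓘(ℝ, E') 𝓘(ℝ, E) ∞ j) (s₀ : S) :
    ∃ (U : Set M) (ρ : M → S), IsOpen U ∧ j s₀ ∈ U ∧ ContMDiffOn 𝓘(ℝ, E) 𝓘(ℝ, E') ∞ ρ U ∧
      ∀ s, j s ∈ U → ρ (j s) = s := by
  have c := hj.isImmersion.isImmersionAt s₀
  obtain ⟨V, hV, hVs⟩ := hj.isEmbedding.isInducing.isOpen_iff.1 c.domChart.open_source
  set T : E → E' := fun z => (c.equiv.symm z).1 with hT
  have hTc : ContDiff ℝ ∞ T := contDiff_fst.comp c.equiv.symm.contDiff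
  have hcoord : ∀ s ∈ c.domChart.source, T (c.codChart (j s)) = c.domChart s := fun s hs => by
    have hchart := c.writtenInCharts (show c.domChart s ∈ (c.domChart.extend 𝓘(ℝ, E')).target by
      simpa using c.domChart.map_source hs)
    simp only [Function.comp_apply, OpenPartialHomeomorph.extend_coe,
      OpenPartialHomeomorph.extend_coe_symm, modelWithCornersSelf_coe,
      modelWithCornersSelf_coe_symm, id_eq, c.domChart.left_inv hs] at hchart
    simp only [hT, hchart, ContinuousLinearEquiv.symm_apply_apply]
  have hmem : ∀ s, j s ∈ V → s ∈ c.domChart.source := fun s hs => by rwa [← hVs]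
  have hopen : IsOpen (c.codChart.source ∩ (T ∘ c.codChart) ⁻¹' c.domChart.target) :=
    (hTc.continuous.comp_continuousOn c.codChart.continuousOn).isOpen_inter_preimage
      c.codChart.open_source c.domChart.open_target
  refine ⟨V ∩ (c.codChart.source ∩ (T ∘ c.codChart) ⁻¹' c.domChart.target),
    c.domChart.symm ∘ T ∘ c.codChart, hV.inter hopen,
    ⟨hVs.superset c.mem_domChart_source, c.mem_codChart_source, ?_⟩, ?_, fun s hs => ?_⟩
  · rw [Set.mem_preimage, Function.comp_apply, hcoord _ c.mem_domChart_source]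
    exact c.domChart.map_source c.mem_domChart_source
  · have hcod := contMDiffOn_of_mem_maximalAtlas c.codChart_mem_maximalAtlas
    exact (contMDiffOn_symm_of_mem_maximalAtlas c.domChart_mem_maximalAtlas).comp
      (hTc.contMDiff.comp_contMDiffOn (hcod.mono fun x hx => hx.2.1)) fun x hx => hx.2.2
  · rw [Function.comp_apply, Function.comp_apply, hcoord s (hmem s hs.1),
      c.domChart.left_inv (hmem s hs.1)]

lemma mfderiv_injective_of_isSmoothEmbedding
    (hj : Manifold.IsSmoothEmbedding 𝓘(ℝ, E') 𝓘(ℝ, E) ∞ j) (s : S) :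
    Function.Injective (mfderiv 𝓘(ℝ, E') 𝓘(ℝ, E) j s) := by
  obtain ⟨U, ρ, hU, hs, hρ, hρj⟩ := exists_local_retraction hj s
  have hρd : MDifferentiableAt 𝓘(ℝ, E) 𝓘(ℝ, E') ρ (j s) :=
    (hρ.contMDiffAt (hU.mem_nhds hs)).mdifferentiableAt (by simp)
  have hid : ρ ∘ j =ᶠ[𝓝 s] id :=
    eventuallyEq_of_mem (hj.contMDiff.continuous.continuousAt (hU.mem_nhds hs)) hρj
  have hleft : ∀ v, mfderiv 𝓘(ℝ, E) 𝓘(ℝ, E') ρ (j s) (mfderiv 𝓘(ℝ, E') 𝓘(ℝ, E) j s v) = v :=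
    fun v => by
      have hcomp := mfderiv_comp_apply s hρd ((hj.contMDiff s).mdifferentiableAt (by simp)) v
      rw [hid.mfderiv_eq, mfderiv_id] at hcomp
      exact hcomp.symm
  intro v w hvw
  have hρvw := congrArg (mfderiv 𝓘(ℝ, E) 𝓘(ℝ, E') ρ (j s)) hvw
  exact (hleft v).symm.trans (hρvw.trans (hleft w))

variable [IsManifold 𝓘(ℝ, E) ∞ M]

lemma Restricts.unique [IsManifold 𝓘(ℝ, E') ∞ S]
    (hj : Manifold.IsSmoothEmbedding 𝓘(ℝ, E') 𝓘(ℝ, E) ∞ j) {Y : VF E M} {Z Z' : VF E' S}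
    (H : Restricts j Y Z) (H' : Restricts j Y Z') : Z = Z' :=
  ContMDiffSection.ext fun s =>
    mfderiv_injective_of_isSmoothEmbedding hj s ((H s).symm.trans (H' s))

variable [FiniteDimensional ℝ E] [T2Space M] [SigmaCompactSpace M]

lemma comapFun_surjective (hj : Manifold.IsSmoothEmbedding 𝓘(ℝ, E') 𝓘(ℝ, E) ∞ j)
    (hcl : IsClosed (Set.range j)) : Function.Surjective (comapFun hj.contMDiff) := by
  intro f
  have hconv : ∀ x : M, Convex ℝ {z : ℝ | ∀ s, j s = x → z = f s} :=
    fun x y hy z hz a b _ _ hab s hs => by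
      rw [hy s hs, hz s hs, ← add_smul, hab, one_smul]
  have hloc : ∀ x : M, ∃ U ∈ 𝓝 x, ∃ g : M → ℝ, ContMDiffOn 𝓘(ℝ, E) 𝓘(ℝ, ℝ) ∞ g U ∧
      ∀ y ∈ U, g y ∈ {z : ℝ | ∀ s, j s = y → z = f s} := fun x => by
    by_cases hx : x ∈ Set.range j
    · obtain ⟨s₀, rfl⟩ := hx
      obtain ⟨U, ρ, hU, hmem, hρ, hρj⟩ := exists_local_retraction hj s₀
      refine ⟨U, hU.mem_nhds hmem, f ∘ ρ, f.contMDiff.comp_contMDiffOn hρ, ?_⟩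
      rintro _ hy s rfl
      exact congrArg f (hρj s hy)
    · exact ⟨(Set.range j)ᶜ, hcl.isOpen_compl.mem_nhds hx, fun _ => 0, contMDiffOn_const,
        fun y hy s hs => absurd ⟨s, hs⟩ hy⟩
  obtain ⟨F, hF⟩ := exists_contMDiffMap_forall_mem_convex_of_local (n := ⊤) 𝓘(ℝ, E) (M := M)
    hconv hloc
  exact ⟨F, ContMDiffMap.ext fun s => hF (j s) s rfl⟩

variable [IsManifold 𝓘(ℝ, E') ∞ S]

lemma exists_vf_eventually_eq_mfderiv (hj : Manifold.IsSmoothEmbedding 𝓘(ℝ, E') 𝓘(ℝ, E) ∞ j)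
    (hcl : IsClosed (Set.range j)) (Z : VF E' S) (x : M) : ∃ Y : VF E M, ∀ᶠ y in 𝓝 x,
      ∀ s, j s = y → Y (j s) = mfderiv 𝓘(ℝ, E') 𝓘(ℝ, E) j s (Z s) := by
  choose C hC using fun i =>
    comapFun_surjective hj hcl ⁅Z, comapFun hj.contMDiff (coordFun (E := E) x i)⁆
  refine ⟨∑ i, C i • coordField x i, ?_⟩
  filter_upwards [eq_sum_mvfderiv_coordFun_smul (E := E) x]
  rintro _ hframe s rfl
  rw [hframe (mfderiv 𝓘(ℝ, E') 𝓘(ℝ, E) j s (Z s)), vf_sum_apply]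
  refine Finset.sum_congr rfl fun i _ => ?_
  rw [VF.smul_apply, ← mvfderiv_comapFun hj.contMDiff]
  exact congrArg (fun f : Fun E' S => f s • coordField x i (j s)) (hC i)

lemma exists_restricts_of_isSmoothEmbedding
    (hj : Manifold.IsSmoothEmbedding 𝓘(ℝ, E') 𝓘(ℝ, E) ∞ j) (hcl : IsClosed (Set.range j))
    (Z : VF E' S) : ∃ Y : VF E M, Restricts j Y Z := by
  -- Testing against functions avoids comparing the tangent spaces at `j s` and `x`.
  let t (x : M) : Set (TangentSpace 𝓘(ℝ, E) x) := {v | ∀ s, j s = x → ∀ f : Fun E M,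
    mvfderiv 𝓘(ℝ, E) f x v = ⁅Z, comapFun hj.contMDiff f⁆ s}
  have hconv : ∀ x, Convex ℝ (t x) := fun x v hv w hw a b _ _ hab s hs f => by
    rw [map_add, map_smul, map_smul, hv s hs f, hw s hs f, ← add_smul, hab, one_smul]
  obtain ⟨Y, hY⟩ := exists_contMDiffSection_forall_mem_convex_of_local (n := ⊤) 𝓘(ℝ, E)
    (F_fiber := E) (fun x : M => TangentSpace 𝓘(ℝ, E) x) t hconv fun x => by
      obtain ⟨Y, hY⟩ := exists_vf_eventually_eq_mfderiv hj hcl Z x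
      refine ⟨_, hY, Y, Y.contMDiff.contMDiffOn, ?_⟩
      rintro _ hy s rfl f
      rw [hy s rfl]
      exact (mvfderiv_comapFun hj.contMDiff f s (Z s)).symm
  exact ⟨Y, Restricts.of_lie_comapFun hj.contMDiff fun f =>
    ContMDiffMap.ext fun s => (hY (j s) s rfl f).symm⟩

end Embedding

section Submersion

lemma linearMap_apply_sum_adjugate_mulVec_smul {ι A V : Type*} [CommRing A] [Fintype ι]
    [DecidableEq ι] [AddCommGroup V] [Module A V] (φ : ι → V →ₗ[A] A) (e : ι → V) (b : ι → A)
    (i : ι) : φ i (∑ l, (Matrix.of fun i l => φ i (e l)).adjugate.mulVec b l • e l) =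
      (Matrix.of fun i l => φ i (e l)).det * b i := by
  set a := Matrix.of fun i l => φ i (e l)
  calc φ i (∑ l, a.adjugate.mulVec b l • e l)
      = a.mulVec (a.adjugate.mulVec b) i := by
        rw [map_sum]
        exact Finset.sum_congr rfl fun l _ => (map_smul _ _ _).trans (mul_comm _ _)
    _ = a.det * b i := by
        rw [Matrix.mulVec_mulVec, Matrix.mul_adjugate, Matrix.smul_mulVec, Matrix.one_mulVec]
        rfl

variable {E S E' Q : Type*} [NormedAddCommGroup E] [NormedSpace ℝ E] [TopologicalSpace S]
  [ChartedSpace E S] [NormedAddCommGroup E'] [NormedSpace ℝ E'] [TopologicalSpace Q]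
  [ChartedSpace E' Q] {π : S → Q}

lemma fun_det_apply {ι : Type*} [Fintype ι] [DecidableEq ι] (a : Matrix ι ι (Fun E S)) (s : S) :
    a.det s = (Matrix.of fun i l => a i l s).det :=
  RingHom.map_det ((Pi.evalRingHom (fun _ : S => ℝ) s).comp ContMDiffMap.coeFnRingHom) a

/-- The differential of a function, as a linear form on the vector fields. -/
def differential [IsManifold 𝓘(ℝ, E) ∞ S] [FiniteDimensional ℝ E] (f : Fun E S) :
    VF E S →ₗ[Fun E S] Fun E S where
  toFun Y := ⁅Y, f⁆
  map_add' Y Z := add_lie Y Z f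
  map_smul' g Y := LieRinehartRing.lie_smul_eq_mul g f Y

lemma exists_local_section (hπ : Manifold.IsSubmersion 𝓘(ℝ, E) 𝓘(ℝ, E') ∞ π) (s₀ : S) :
    ∃ (U : Set Q) (τ : Q → S), IsOpen U ∧ π s₀ ∈ U ∧
    ContMDiffOn 𝓘(ℝ, E') 𝓘(ℝ, E) ∞ τ U ∧ τ (π s₀) = s₀ ∧ ∀ q ∈ U, π (τ q) = q := by
  have c := hπ.isSubmersionAt s₀
  have hcoord : ∀ z ∈ c.domChart.target, c.codChart (π (c.domChart.symm z)) = (c.equiv z).1 :=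
    fun z hz => by
    have hchart := c.writtenInCharts
      (show z ∈ (c.domChart.extend 𝓘(ℝ, E)).target by simpa using hz)
    simpa only [Function.comp_apply, OpenPartialHomeomorph.extend_coe,
      OpenPartialHomeomorph.extend_coe_symm, modelWithCornersSelf_coe,
      modelWithCornersSelf_coe_symm, id_eq] using hchart
  set T : E' → E := fun y => c.equiv.symm (y, (c.equiv (c.domChart s₀)).2) with hT
  have hTc : ContDiff ℝ ∞ T := c.equiv.symm.contDiff.comp (contDiff_id.prodMk contDiff_const)
  have hs₀ := c.mem_domChart_source
  have hTs : T (c.codChart (π s₀)) = c.domChart s₀ := by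
    have hchart := hcoord _ (c.domChart.map_source hs₀)
    rw [c.domChart.left_inv hs₀] at hchart
    simp only [hT, hchart]
    exact c.equiv.symm_apply_apply _
  have hcod := contMDiffOn_of_mem_maximalAtlas c.codChart_mem_maximalAtlas
  have hdom := contMDiffOn_symm_of_mem_maximalAtlas c.domChart_mem_maximalAtlas
  refine ⟨c.codChart.source ∩ (T ∘ c.codChart) ⁻¹' c.domChart.target,
    c.domChart.symm ∘ T ∘ c.codChart,
    (hTc.continuous.comp_continuousOn c.codChart.continuousOn).isOpen_inter_preimage
      c.codChart.open_source c.domChart.open_target, ⟨c.mem_codChart_source, ?_⟩,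
    hdom.comp (hTc.contMDiff.comp_contMDiffOn (hcod.mono fun x hx => hx.1)) fun x hx => hx.2, ?_,
    fun q hq => ?_⟩
  · rw [Set.mem_preimage, Function.comp_apply, hTs]
    exact c.domChart.map_source hs₀
  · rw [Function.comp_apply, Function.comp_apply, hTs, c.domChart.left_inv hs₀]
  · refine c.codChart.injOn (c.source_subset_preimage_source (c.domChart.map_target hq.2)) hq.1 ?_
    rw [hcoord _ hq.2]
    simp only [hT, Function.comp_apply, ContinuousLinearEquiv.apply_symm_apply]

lemma mfderiv_surjective_of_isSubmersion (hπ : Manifold.IsSubmersion 𝓘(ℝ, E) 𝓘(ℝ, E') ∞ π)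
    (s : S) : Function.Surjective (mfderiv 𝓘(ℝ, E) 𝓘(ℝ, E') π s) := by
  intro v
  obtain ⟨U, τ, hU, hmem, hτ, hs, hsec⟩ := exists_local_section hπ s
  have hτd : MDifferentiableAt 𝓘(ℝ, E') 𝓘(ℝ, E) τ (π s) :=
    (hτ.contMDiffAt (hU.mem_nhds hmem)).mdifferentiableAt (by simp)
  have hid : π ∘ τ =ᶠ[𝓝 (π s)] id := eventuallyEq_of_mem (hU.mem_nhds hmem) hsec
  have hcomp := mfderiv_comp_apply_of_eq (I := 𝓘(ℝ, E')) (I' := 𝓘(ℝ, E)) (I'' := 𝓘(ℝ, E'))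
    (π s) ((hπ.contMDiff s).mdifferentiableAt (by simp)) hτd hs v
  rw [hid.mfderiv_eq, mfderiv_id] at hcomp
  exact ⟨_, hcomp.symm⟩

lemma exists_comapFun_eq_of_fibre (hπ : Manifold.IsSubmersion 𝓘(ℝ, E) 𝓘(ℝ, E') ∞ π)
    (hsurj : Function.Surjective π) (f : Fun E S) (hf : ∀ s t, π s = π t → f s = f t) :
    ∃ g : Fun E' Q, comapFun hπ.contMDiff g = f := by
  choose r hr using hsurj
  refine ⟨⟨f ∘ r, fun q => ?_⟩, ContMDiffMap.ext fun s => hf _ _ (hr _)⟩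
  obtain ⟨U, τ, hU, hmem, hτ, -, hsec⟩ := exists_local_section hπ (r q)
  rw [hr] at hmem
  refine ((f.contMDiff _).comp q (hτ.contMDiffAt (hU.mem_nhds hmem))).congr_of_eventuallyEq ?_
  filter_upwards [hU.mem_nhds hmem] with q' hq'
  exact hf _ _ (by rw [hr, hsec q' hq'])

variable [IsManifold 𝓘(ℝ, E) ∞ S] [IsManifold 𝓘(ℝ, E') ∞ Q] [FiniteDimensional ℝ E]
  [FiniteDimensional ℝ E'] [T2Space S] [T2Space Q]

/- If vector fields `L l` on `S` lift the coordinate frame of `Q` at the single point `s₀`, the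
matrix of their derivatives of the pulled back coordinates is invertible near `s₀`, and Cramer's
rule solves for the coefficients of a lift. -/
lemma exists_eventually_smul_eq_mfderiv (hπ : Manifold.IsSubmersion 𝓘(ℝ, E) 𝓘(ℝ, E') ∞ π)
    (V : VF E' Q) (s₀ : S) : ∃ (δ : Fun E S) (Z : VF E S), δ s₀ ≠ 0 ∧
      ∀ᶠ s in 𝓝 s₀, δ s • V (π s) = mfderiv 𝓘(ℝ, E) 𝓘(ℝ, E') π s (Z s) := by
  let φ i := differential (comapFun hπ.contMDiff (coordFun (E := E') (π s₀) i))
  choose u hu using fun l => mfderiv_surjective_of_isSubmersion hπ s₀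
    (coordField (E := E') (π s₀) l (π s₀))
  let L l := extendVec s₀ (u l)
  let b i := comapFun hπ.contMDiff ⁅V, coordFun (E := E') (π s₀) i⁆
  set a := Matrix.of fun i l => φ i (L l)
  have hone : (Matrix.of fun i l => a i l s₀) = 1 := by
    ext i l
    change mvfderiv 𝓘(ℝ, E) (comapFun hπ.contMDiff (coordFun (E := E') (π s₀) i)) s₀ (L l s₀) = _
    rw [extendVec_apply, mvfderiv_comapFun, hu,
      (mvfderiv_coordFun_coordField (E := E') (π s₀)).self_of_nhds, Matrix.one_apply]
  refine ⟨a.det, ∑ l, a.adjugate.mulVec b l • L l, ?_, ?_⟩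
  · rw [fun_det_apply, hone, Matrix.det_one]
    exact one_ne_zero
  filter_upwards [(hπ.contMDiff.continuous.tendsto s₀).eventually
    (eq_sum_mvfderiv_coordFun_smul (E := E') (π s₀))] with s hframe
  rw [hframe (V (π s)), hframe (mfderiv 𝓘(ℝ, E) 𝓘(ℝ, E') π s _), Finset.smul_sum]
  refine Finset.sum_congr rfl fun i _ => ?_
  rw [smul_smul, ← mvfderiv_comapFun hπ.contMDiff]
  exact congrArg (· • coordField (E := E') (π s₀) i (π s)) (congrArg (fun f : Fun E S => f s)
    (linearMap_apply_sum_adjugate_mulVec_smul φ L b i).symm)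

lemma exists_restricts_of_isSubmersion [SigmaCompactSpace S]
    (hπ : Manifold.IsSubmersion 𝓘(ℝ, E) 𝓘(ℝ, E') ∞ π) (V : VF E' Q) :
    ∃ Z : VF E S, Restricts π V Z := by
  have hconv : ∀ s : S, Convex ℝ {v : TangentSpace 𝓘(ℝ, E) s |
      mfderiv 𝓘(ℝ, E) 𝓘(ℝ, E') π s v = V (π s)} := fun s =>
    (convex_singleton (V (π s))).linear_preimage
      (mfderiv 𝓘(ℝ, E) 𝓘(ℝ, E') π s : TangentSpace 𝓘(ℝ, E) s →ₗ[ℝ] TangentSpace 𝓘(ℝ, E') (π s))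
  obtain ⟨Z, hZ⟩ := exists_contMDiffSection_forall_mem_convex_of_local (n := ⊤) 𝓘(ℝ, E)
    (F_fiber := E) (fun s : S => TangentSpace 𝓘(ℝ, E) s) _ hconv fun s₀ => by
      obtain ⟨δ, Z, hδ, hZ⟩ := exists_eventually_smul_eq_mfderiv hπ V s₀
      refine ⟨_, (δ.contMDiff.continuous.continuousAt.eventually_ne hδ).and hZ,
        fun s => (δ s)⁻¹ • Z s, fun s hs => ?_, fun s hs => ?_⟩
      · exact (((δ.contMDiff s).inv₀ hs.1).smul_section (Z.contMDiff s)).contMDiffWithinAt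
      · change mfderiv 𝓘(ℝ, E) 𝓘(ℝ, E') π s ((δ s)⁻¹ • Z s) = _
        rw [map_smul, ← hs.2, inv_smul_smul₀ hs.1]
  exact ⟨Z, fun s => (hZ s).symm⟩

end Submersion

section Foliation

lemma exists_derivation_of_injective {R A B : Type*} [CommRing R] [CommRing A] [Algebra R A]
    [CommRing B] [Algebra R B] {q : B →ₐ[R] A} (hq : Function.Injective q) (D : Derivation R A A)
    (hD : ∀ b, D (q b) ∈ q.range) : ∃ D' : Derivation R B B, ∀ b, q (D' b) = D (q b) := by
  choose d hd using hD
  refine ⟨Derivation.mk' ⟨⟨d, fun a b => hq ?_⟩, fun c a => hq ?_⟩ fun a b => hq ?_, hd⟩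
  · rw [map_add]
    exact (hd _).trans (by rw [map_add, map_add, ← hd a, ← hd b]; rfl)
  · exact (hd _).trans (by
      rw [map_smul, Derivation.map_smul, ← hd a]
      exact (map_smul q c (d a)).symm)
  · exact (hd _).trans (by
      rw [map_mul, Derivation.leibniz, ← hd a, ← hd b, smul_eq_mul, smul_eq_mul, smul_eq_mul,
        smul_eq_mul, map_add, map_mul, map_mul]
      rfl)

variable {E S E' Q : Type*} [NormedAddCommGroup E] [NormedSpace ℝ E] [FiniteDimensional ℝ E]
  [TopologicalSpace S] [ChartedSpace E S] [IsManifold 𝓘(ℝ, E) ∞ S]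
  [NormedAddCommGroup E'] [NormedSpace ℝ E'] [TopologicalSpace Q] [ChartedSpace E' Q]
  {𝓓 : RegularFoliation E S} {π : S → Q}

namespace RegularFoliation

lemma SameLeaf.apply_eq {f : Fun E S} (hf : ∀ W ∈ secs 𝓓.D, ⁅W, f⁆ = 0) {s t : S}
    (hst : 𝓓.SameLeaf s t) : f s = f t := by
  obtain ⟨γ, hγ, hD, rfl, rfl⟩ := hst
  have hfγ : ContDiff ℝ ∞ (f ∘ γ) := (f.contMDiff.comp hγ).contDiff
  refine is_const_of_deriv_eq_zero (hfγ.differentiable (by simp)) (fun t => ?_) 0 1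
  obtain ⟨W, hW, hWt⟩ := 𝓓.smooth (γ t) _ (hD t)
  have hderiv : mvfderiv 𝓘(ℝ, ℝ) (f ∘ γ) t (1 : ℝ) = 0 := calc
    mvfderiv 𝓘(ℝ, ℝ) (f ∘ γ) t (1 : ℝ) = mvfderiv 𝓘(ℝ, E) f (γ t) (W (γ t)) :=
      (mvfderiv_comapFun hγ f t (1 : ℝ)).trans (congrArg _ hWt.symm)
    _ = 0 := congrArg (fun g : Fun E S => g (γ t)) (hf W hW)
  change mfderiv 𝓘(ℝ, ℝ) 𝓘(ℝ, ℝ) (f ∘ γ) t (1 : ℝ) = 0 at hderiv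
  rw [← fderiv_apply_one_eq_deriv]
  rwa [mfderiv_eq_fderiv] at hderiv

namespace IsLeafSpace

lemma contMDiff (hπ : 𝓓.IsLeafSpace (E' := E') π) : ContMDiff 𝓘(ℝ, E) 𝓘(ℝ, E') ∞ π :=
  hπ.submersion.contMDiff

lemma mem_range_comapFun_iff_sameLeaf (hπ : 𝓓.IsLeafSpace (E' := E') π) {f : Fun E S} :
    f ∈ (comapFun hπ.contMDiff).range ↔ ∀ s t, 𝓓.SameLeaf s t → f s = f t := by
  refine ⟨?_, fun hf => exists_comapFun_eq_of_fibre hπ.submersion hπ.surjective f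
    fun s t hst => hf s t ((hπ.fibre s t).1 hst)⟩
  rintro ⟨g, rfl⟩ s t hst
  exact congrArg g ((hπ.fibre s t).2 hst)

variable [IsManifold 𝓘(ℝ, E') ∞ Q]

lemma mem_secs_iff (hπ : 𝓓.IsLeafSpace (E' := E') π) {W : VF E S} :
    W ∈ secs 𝓓.D ↔ Restricts π (0 : VF E' Q) W :=
  forall_congr' fun s => (hπ.tangent s (W s)).symm.trans eq_comm

lemma mem_range_comapFun_iff_lie_eq_zero (hπ : 𝓓.IsLeafSpace (E' := E') π) {f : Fun E S} :
    f ∈ (comapFun hπ.contMDiff).range ↔ ∀ W ∈ secs 𝓓.D, ⁅W, f⁆ = 0 := by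
  refine ⟨?_, fun hf => hπ.mem_range_comapFun_iff_sameLeaf.2 fun s t hst => hst.apply_eq hf⟩
  rintro ⟨g, rfl⟩ W hW
  refine ((hπ.mem_secs_iff.1 hW).lie_comapFun hπ.contMDiff g).trans (ContMDiffMap.ext fun s => ?_)
  exact map_zero (mvfderiv 𝓘(ℝ, E') g (π s))

variable [FiniteDimensional ℝ E'] [T2Space Q]

lemma exists_restricts_iff (hπ : 𝓓.IsLeafSpace (E' := E') π) {Z : VF E S} :
    (∃ V : VF E' Q, Restricts π V Z) ↔ ∀ W ∈ secs 𝓓.D, ⁅Z, W⁆ ∈ secs 𝓓.D := by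
  constructor
  · rintro ⟨V, hV⟩ W hW
    rw [hπ.mem_secs_iff] at hW ⊢
    simpa only [lie_zero] using hV.lie hπ.contMDiff hW
  · intro hZ
    obtain ⟨D, hD⟩ := exists_derivation_of_injective
      (comapFun_injective hπ.contMDiff hπ.surjective)
      (LieRinehartAlgebra.anchor ℝ (Fun E S) (VF E S) Z) fun g => by
        have hg := hπ.mem_range_comapFun_iff_lie_eq_zero.1
          ((comapFun hπ.contMDiff).mem_range_self g)
        refine hπ.mem_range_comapFun_iff_lie_eq_zero.2 fun W hW => ?_
        have hlie := VF.lie_lie_fun Z W (comapFun hπ.contMDiff g)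
        rwa [hg W hW, hg _ (hZ W hW), lie_zero, zero_sub, zero_eq_neg] at hlie
    refine ⟨derEquiv.symm D, Restricts.of_lie_comapFun hπ.contMDiff fun g => (hD g).symm.trans ?_⟩
    rw [← VF.toDer_apply, toDer_derEquiv_symm]

lemma exists_restricts_apply_eq [T2Space S] [SigmaCompactSpace S]
    (hπ : 𝓓.IsLeafSpace (E' := E') π) (s : S) (v : TangentSpace 𝓘(ℝ, E) s) :
    ∃ (V : VF E' Q) (Z : VF E S), Restricts π V Z ∧ Z s = v := by
  let V := extendVec (π s) (mfderiv 𝓘(ℝ, E) 𝓘(ℝ, E') π s v)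
  obtain ⟨Z, hZ⟩ := exists_restricts_of_isSubmersion hπ.submersion V
  have hD : v - Z s ∈ 𝓓.D s := by
    rw [← hπ.tangent, map_sub, ← hZ s, extendVec_apply, sub_self]
  obtain ⟨W, hW, hWs⟩ := 𝓓.smooth s _ hD
  refine ⟨V, Z + W, ?_, ?_⟩
  · simpa only [add_zero] using hZ.add (hπ.mem_secs_iff.1 hW)
  · change Z s + W s = v
    rw [hWs, add_sub_cancel]

end IsLeafSpace

end RegularFoliation

end Foliation

section Constraint

variable {EM M E S : Type*} [NormedAddCommGroup EM] [NormedSpace ℝ EM] [TopologicalSpace M]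
  [ChartedSpace EM M] [IsManifold 𝓘(ℝ, EM) ∞ M] [NormedAddCommGroup E] [NormedSpace ℝ E]
  [FiniteDimensional ℝ E] [TopologicalSpace S] [ChartedSpace E S] [IsManifold 𝓘(ℝ, E) ∞ S]
  {j : S → M} {𝓓 : RegularFoliation E S}

lemma mem_symmetryData_I_iff (hj : ContMDiff 𝓘(ℝ, E) 𝓘(ℝ, EM) ∞ j) {f : Fun EM M} :
    f ∈ (symmetryData j 𝓓).I ↔ comapFun hj f = 0 :=
  ⟨fun hf => ContMDiffMap.ext hf, fun hf s => congrArg (fun f : Fun E S => f s) hf⟩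

variable [FiniteDimensional ℝ EM] [T2Space M] [SigmaCompactSpace M] [T2Space S]

lemma mem_derWobs_iff (hj : Manifold.IsSmoothEmbedding 𝓘(ℝ, E) 𝓘(ℝ, EM) ∞ j)
    (hcl : IsClosed (Set.range j)) {Y : VF EM M} :
    Y.toDer ∈ derWobs (R := ℝ) (symmetryData j 𝓓).I ↔ ∃ Z : VF E S, Restricts j Y Z := by
  have hI (f : Fun EM M) := mem_symmetryData_I_iff (𝓓 := 𝓓) hj.contMDiff (f := f)
  refine ⟨fun hY => ?_, fun ⟨Z, hZ⟩ f hf => ?_⟩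
  · have hker : ∀ f, comapFun hj.contMDiff f = 0 → comapFun hj.contMDiff (Y.toDer f) = 0 :=
      fun f hf => (hI _).1 (hY f ((hI f).2 hf))
    refine ⟨derEquiv.symm (Derivation.liftOfSurjective (comapFun_surjective hj hcl) hker),
      Restricts.of_lie_comapFun hj.contMDiff fun f => ?_⟩
    rw [← VF.toDer_apply, toDer_derEquiv_symm]
    exact Derivation.liftOfSurjective_apply (comapFun_surjective hj hcl) hker f
  · rw [hI] at hf ⊢
    rw [VF.toDer_apply, ← hZ.lie_comapFun hj.contMDiff, hf, lie_zero]

lemma mem_symmetryData_F_iff (hj : Manifold.IsSmoothEmbedding 𝓘(ℝ, E) 𝓘(ℝ, EM) ∞ j)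
    (hcl : IsClosed (Set.range j)) {Y : VF EM M} :
    Y.toDer ∈ (symmetryData j 𝓓).F ↔ ∃ Z ∈ secs 𝓓.D, Restricts j Y Z := by
  refine ⟨fun hY => ?_, fun ⟨Z, hZD, hZ⟩ s => ⟨Z s, hZD s, fun f => ?_⟩⟩
  · obtain ⟨Z, hZ⟩ := (mem_derWobs_iff hj hcl).1 ((symmetryData j 𝓓).le_wobs _ hY)
    refine ⟨Z, fun s => ?_, hZ⟩
    obtain ⟨v, hv, hvf⟩ := hY s
    have hZs : Z s = v := mfderiv_injective_of_isSmoothEmbedding hj s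
      ((hZ s).symm.trans (tangent_ext fun f => hvf f))
    rwa [hZs]
  · rw [← hZ s]
    rfl

lemma mem_lieWobs_iff (hj : Manifold.IsSmoothEmbedding 𝓘(ℝ, E) 𝓘(ℝ, EM) ∞ j)
    (hcl : IsClosed (Set.range j)) {Y : VF EM M} : Y.toDer ∈ (symmetryData j 𝓓).lieWobs ↔
      ∃ Z : VF E S, Restricts j Y Z ∧ ∀ W ∈ secs 𝓓.D, ⁅Z, W⁆ ∈ secs 𝓓.D := by
  have hskew : ∀ Z W : VF E S, ⁅Z, W⁆ ∈ secs 𝓓.D → ⁅W, Z⁆ ∈ secs 𝓓.D := fun Z W h s => by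
    rw [← lie_skew]
    exact (𝓓.D s).neg_mem (h s)
  refine ⟨fun hY => ?_, fun ⟨Z, hZ, hD⟩ => ⟨(mem_derWobs_iff hj hcl).2 ⟨Z, hZ⟩, fun X hX => ?_⟩⟩
  · obtain ⟨Z, hZ⟩ := (mem_derWobs_iff hj hcl).1 hY.1
    refine ⟨Z, hZ, fun W hW => hskew _ _ ?_⟩
    obtain ⟨X, hX⟩ := exists_restricts_of_isSmoothEmbedding hj hcl W
    have hXY := hY.2 X.toDer ((mem_symmetryData_F_iff hj hcl).2 ⟨W, hW, hX⟩)
    rw [← VF.toDer_lie, mem_symmetryData_F_iff hj hcl] at hXY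
    obtain ⟨W', hW', hXW⟩ := hXY
    rwa [(hX.lie hj.contMDiff hZ).unique hj hXW]
  · obtain ⟨X, rfl⟩ := VF.toDer_bijective.surjective X
    obtain ⟨W, hW, hXW⟩ := (mem_symmetryData_F_iff hj hcl).1 hX
    rw [← VF.toDer_lie, mem_symmetryData_F_iff hj hcl]
    exact ⟨⁅W, Z⁆, hskew _ _ (hD W hW), hXW.lie hj.contMDiff hZ⟩

lemma F_le_lieWobs (hj : Manifold.IsSmoothEmbedding 𝓘(ℝ, E) 𝓘(ℝ, EM) ∞ j)
    (hcl : IsClosed (Set.range j)) {X : Derivation ℝ (Fun EM M) (Fun EM M)}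
    (hX : X ∈ (symmetryData j 𝓓).F) : X ∈ (symmetryData j 𝓓).lieWobs := by
  obtain ⟨X, rfl⟩ := VF.toDer_bijective.surjective X
  obtain ⟨W, hW, hXW⟩ := (mem_symmetryData_F_iff hj hcl).1 hX
  exact (mem_lieWobs_iff hj hcl).2 ⟨W, hXW, 𝓓.involutive W hW⟩

lemma mem_algWobs_iff (hj : Manifold.IsSmoothEmbedding 𝓘(ℝ, E) 𝓘(ℝ, EM) ∞ j)
    (hcl : IsClosed (Set.range j)) {f : Fun EM M} : f ∈ (symmetryData j 𝓓).algWobs ↔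
      ∀ W ∈ secs 𝓓.D, ⁅W, comapFun hj.contMDiff f⁆ = 0 := by
  refine ⟨fun hf W hW => ?_, fun hf X hX => ?_⟩
  · obtain ⟨X, hX⟩ := exists_restricts_of_isSmoothEmbedding hj hcl W
    rw [hX.lie_comapFun hj.contMDiff]
    exact (mem_symmetryData_I_iff hj.contMDiff).1
      (hf X.toDer ((mem_symmetryData_F_iff hj hcl).2 ⟨W, hW, hX⟩))
  · obtain ⟨X, rfl⟩ := VF.toDer_bijective.surjective X
    obtain ⟨W, hW, hXW⟩ := (mem_symmetryData_F_iff hj hcl).1 hX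
    rw [mem_symmetryData_I_iff hj.contMDiff, VF.toDer_apply, ← hXW.lie_comapFun hj.contMDiff,
      hf W hW]

end Constraint

section Reduction

variable {EM M E S E' Q : Type*} [NormedAddCommGroup EM] [NormedSpace ℝ EM]
  [TopologicalSpace M] [ChartedSpace EM M] [IsManifold 𝓘(ℝ, EM) ∞ M]
  [NormedAddCommGroup E] [NormedSpace ℝ E] [TopologicalSpace S] [ChartedSpace E S]
  [IsManifold 𝓘(ℝ, E) ∞ S] [NormedAddCommGroup E'] [NormedSpace ℝ E'] [TopologicalSpace Q]
  [ChartedSpace E' Q] [IsManifold 𝓘(ℝ, E') ∞ Q] {j : S → M} {π : S → Q}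

/-- The vector field `Y` on `M` reduces to the vector field `V` on the leaf space `Q`: it restricts
along `j : S → M` to a vector field on `S` which projects to `V` along `π : S → Q`. -/
def ReducesTo (j : S → M) (π : S → Q) (Y : VF EM M) (V : VF E' Q) : Prop :=
  ∃ Z : VF E S, Restricts j Y Z ∧ Restricts π V Z

namespace ReducesTo

variable {Y Y' : VF EM M} {V V' : VF E' Q}

lemma add (H : ReducesTo (E := E) j π Y V) (H' : ReducesTo (E := E) j π Y' V') :
    ReducesTo (E := E) j π (Y + Y') (V + V') := by
  obtain ⟨Z, hY, hV⟩ := H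
  obtain ⟨Z', hY', hV'⟩ := H'
  exact ⟨Z + Z', hY.add hY', hV.add hV'⟩

lemma const_smul (H : ReducesTo (E := E) j π Y V) (c : ℝ) :
    ReducesTo (E := E) j π (c • Y) (c • V) := by
  obtain ⟨Z, hY, hV⟩ := H
  exact ⟨c • Z, hY.const_smul c, hV.const_smul c⟩

lemma fun_smul (hj : ContMDiff 𝓘(ℝ, E) 𝓘(ℝ, EM) ∞ j) (hπ : ContMDiff 𝓘(ℝ, E) 𝓘(ℝ, E') ∞ π)
    (H : ReducesTo (E := E) j π Y V) {f : Fun EM M} {g : Fun E' Q}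
    (hfg : comapFun hπ g = comapFun hj f) : ReducesTo (E := E) j π (f • Y) (g • V) := by
  obtain ⟨Z, hY, hV⟩ := H
  exact ⟨comapFun hj f • Z, hY.comapFun_smul hj f, hfg ▸ hV.comapFun_smul hπ g⟩

lemma comapFun_lie_fun (hj : ContMDiff 𝓘(ℝ, E) 𝓘(ℝ, EM) ∞ j)
    (hπ : ContMDiff 𝓘(ℝ, E) 𝓘(ℝ, E') ∞ π) (H : ReducesTo (E := E) j π Y V) {f : Fun EM M}
    {g : Fun E' Q} (hfg : comapFun hπ g = comapFun hj f) :
    comapFun hπ ⁅V, g⁆ = comapFun hj ⁅Y, f⁆ := by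
  obtain ⟨Z, hY, hV⟩ := H
  rw [← hV.lie_comapFun hπ, hfg, hY.lie_comapFun hj]

lemma apply_eq_mfderiv (hj : Manifold.IsSmoothEmbedding 𝓘(ℝ, E) 𝓘(ℝ, EM) ∞ j)
    (H : ReducesTo (E := E) j π Y V) {Z : VF E S} (hZ : Restricts j Y Z) (s : S) :
    V (π s) = mfderiv 𝓘(ℝ, E) 𝓘(ℝ, E') π s (Z s) := by
  obtain ⟨Z', hY, hV⟩ := H
  rw [hZ.unique hj hY]
  exact hV s

lemma unique (hj : Manifold.IsSmoothEmbedding 𝓘(ℝ, E) 𝓘(ℝ, EM) ∞ j)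
    (hsurj : Function.Surjective π) (H : ReducesTo (E := E) j π Y V)
    (H' : ReducesTo (E := E) j π Y V') : V = V' := by
  obtain ⟨Z, hY, hV⟩ := H
  exact ContMDiffSection.ext <| hsurj.forall.2 fun s =>
    (hV s).trans (H'.apply_eq_mfderiv hj hY s).symm

variable [FiniteDimensional ℝ EM] [T2Space M] [FiniteDimensional ℝ E] [FiniteDimensional ℝ E']
  [T2Space Q]

lemma lie (hj : ContMDiff 𝓘(ℝ, E) 𝓘(ℝ, EM) ∞ j) (hπ : ContMDiff 𝓘(ℝ, E) 𝓘(ℝ, E') ∞ π)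
    (H : ReducesTo (E := E) j π Y V) (H' : ReducesTo (E := E) j π Y' V') :
    ReducesTo (E := E) j π ⁅Y, Y'⁆ ⁅V, V'⁆ := by
  obtain ⟨Z, hY, hV⟩ := H
  obtain ⟨Z', hY', hV'⟩ := H'
  exact ⟨⁅Z, Z'⁆, hY.lie hj hY', hV.lie hπ hV'⟩

end ReducesTo

variable [FiniteDimensional ℝ EM] [T2Space M] [SigmaCompactSpace M] [FiniteDimensional ℝ E]
  [T2Space S] {𝓓 : RegularFoliation E S}

lemma mem_algWobs_iff_mem_range (hj : Manifold.IsSmoothEmbedding 𝓘(ℝ, E) 𝓘(ℝ, EM) ∞ j)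
    (hcl : IsClosed (Set.range j)) (hπ : 𝓓.IsLeafSpace (E' := E') π) {f : Fun EM M} :
    f ∈ (symmetryData j 𝓓).algWobs ↔
      comapFun hj.contMDiff f ∈ (comapFun hπ.contMDiff).range :=
  (mem_algWobs_iff hj hcl).trans hπ.mem_range_comapFun_iff_lie_eq_zero.symm

lemma mem_algWobs_iff_sameLeaf (hj : Manifold.IsSmoothEmbedding 𝓘(ℝ, E) 𝓘(ℝ, EM) ∞ j)
    (hcl : IsClosed (Set.range j)) (hπ : 𝓓.IsLeafSpace (E' := E') π) {f : Fun EM M} :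
    f ∈ (symmetryData j 𝓓).algWobs ↔ ∀ s t, 𝓓.SameLeaf s t → f (j s) = f (j t) :=
  (mem_algWobs_iff_mem_range hj hcl hπ).trans hπ.mem_range_comapFun_iff_sameLeaf

variable (hj : Manifold.IsSmoothEmbedding 𝓘(ℝ, E) 𝓘(ℝ, EM) ∞ j) (hcl : IsClosed (Set.range j))
  (hπ : 𝓓.IsLeafSpace (E' := E') π)

/-- The function on the leaf space induced by a function on `M` which is constant on the leaves. -/
def reduceFun : (symmetryData (E := EM) j 𝓓).algWobs →ₐ[ℝ] Fun E' Q :=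
  AlgHom.comp (AlgEquiv.ofInjective (comapFun hπ.contMDiff)
      (comapFun_injective hπ.contMDiff hπ.surjective)).symm.toAlgHom
    (((comapFun hj.contMDiff).comp (symmetryData (E := EM) j 𝓓).algWobs.val).codRestrict
      (comapFun hπ.contMDiff).range fun f => (mem_algWobs_iff_mem_range hj hcl hπ).1 f.2)

lemma comapFun_reduceFun (f : (symmetryData (E := EM) j 𝓓).algWobs) :
    comapFun hπ.contMDiff (reduceFun hj hcl hπ f) = comapFun hj.contMDiff f.1 :=
  congrArg Subtype.val ((AlgEquiv.ofInjective (comapFun hπ.contMDiff)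
    (comapFun_injective hπ.contMDiff hπ.surjective)).apply_symm_apply _)

lemma ker_reduceFun : RingHom.ker (reduceFun hj hcl hπ) = (symmetryData (E := EM) j 𝓓).algNull := by
  refine Ideal.ext fun f => ?_
  rw [RingHom.mem_ker, ← (comapFun_injective hπ.contMDiff hπ.surjective).eq_iff,
    comapFun_reduceFun, map_zero]
  exact (mem_symmetryData_I_iff (𝓓 := 𝓓) hj.contMDiff).symm

lemma reduceFun_surjective : Function.Surjective (reduceFun hj hcl hπ) := fun g => by
  obtain ⟨f, hf⟩ := comapFun_surjective hj hcl (comapFun hπ.contMDiff g)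
  have hfW : f ∈ (symmetryData (E := EM) j 𝓓).algWobs :=
    (mem_algWobs_iff_mem_range hj hcl hπ).2 (hf ▸ (comapFun hπ.contMDiff).mem_range_self g)
  exact ⟨⟨f, hfW⟩, comapFun_injective hπ.contMDiff hπ.surjective
    ((comapFun_reduceFun hj hcl hπ _).trans hf)⟩

/-- The isomorphism of the reduced algebra with the smooth functions on the leaf space. -/
def algRedEquiv : (symmetryData (E := EM) j 𝓓).AlgRed ≃ₐ[ℝ] Fun E' Q :=
  (Ideal.quotientEquivAlgOfEq ℝ (ker_reduceFun hj hcl hπ).symm).trans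
    (Ideal.quotientKerAlgEquivOfSurjective (reduceFun_surjective hj hcl hπ))

lemma algRedEquiv_mk_apply (f : (symmetryData (E := EM) j 𝓓).algWobs) (s : S) :
    algRedEquiv hj hcl hπ (Ideal.Quotient.mk _ f) (π s) = f.1 (j s) :=
  congrArg (fun g : Fun E S => g s) (comapFun_reduceFun hj hcl hπ f)

variable (E') in
include hj hcl hπ in
lemma mem_symmetryData_F_iff_reducesTo_zero {Y : VF EM M} :
    Y.toDer ∈ (symmetryData (E := EM) j 𝓓).F ↔ ReducesTo (E := E) j π Y (0 : VF E' Q) := by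
  rw [mem_symmetryData_F_iff hj hcl]
  exact exists_congr fun Z => by rw [hπ.mem_secs_iff, and_comm]

variable [FiniteDimensional ℝ E'] [T2Space Q]

section

include hj hcl hπ

lemma mem_lieWobs_iff_exists_reducesTo {Y : VF EM M} :
    Y.toDer ∈ (symmetryData (E := EM) j 𝓓).lieWobs ↔ ∃ V : VF E' Q, ReducesTo (E := E) j π Y V := by
  unfold ReducesTo
  rw [mem_lieWobs_iff hj hcl, exists_comm]
  exact exists_congr fun Z => by rw [exists_and_left, hπ.exists_restricts_iff]

lemma exists_reducesTo [SigmaCompactSpace S] (V : VF E' Q) :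
    ∃ Y : VF EM M, ReducesTo (E := E) j π Y V := by
  obtain ⟨Z, hZ⟩ := exists_restricts_of_isSubmersion hπ.submersion V
  obtain ⟨Y, hY⟩ := exists_restricts_of_isSmoothEmbedding hj hcl Z
  exact ⟨Y, Z, hY, hZ⟩

lemma exists_reducesTo_derEquiv_symm (X : (symmetryData (E := EM) j 𝓓).lieWobs) :
    ∃ V : VF E' Q, ReducesTo (E := E) j π (derEquiv.symm X.1) V :=
  (mem_lieWobs_iff_exists_reducesTo hj hcl hπ).1 <| by
    rw [toDer_derEquiv_symm]
    exact X.2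

end

/-- The vector field on the leaf space to which an element of the normalizer of `F` reduces. -/
def reduceVF : (symmetryData (E := EM) j 𝓓).lieWobs →ₗ[ℝ] VF E' Q where
  toFun X := (exists_reducesTo_derEquiv_symm hj hcl hπ X).choose
  map_add' X X' := by
    refine (exists_reducesTo_derEquiv_symm hj hcl hπ (X + X')).choose_spec.unique hj
      hπ.surjective ?_
    rw [AddMemClass.coe_add, map_add]
    exact (exists_reducesTo_derEquiv_symm hj hcl hπ X).choose_spec.add
      (exists_reducesTo_derEquiv_symm hj hcl hπ X').choose_spec
  map_smul' c X := by
    refine (exists_reducesTo_derEquiv_symm hj hcl hπ (c • X)).choose_spec.unique hj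
      hπ.surjective ?_
    rw [SetLike.val_smul, derEquiv_symm_const_smul]
    exact (exists_reducesTo_derEquiv_symm hj hcl hπ X).choose_spec.const_smul c

lemma reducesTo_reduceVF (X : (symmetryData (E := EM) j 𝓓).lieWobs) :
    ReducesTo (E := E) j π (derEquiv.symm X.1) (reduceVF hj hcl hπ X) :=
  (exists_reducesTo_derEquiv_symm hj hcl hπ X).choose_spec

lemma ReducesTo.reduceVF_eq {X : (symmetryData (E := EM) j 𝓓).lieWobs} {Y : VF EM M}
    (hY : Y.toDer = X.1) {V : VF E' Q} (H : ReducesTo (E := E) j π Y V) :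
    reduceVF hj hcl hπ X = V := by
  refine (reducesTo_reduceVF hj hcl hπ X).unique hj hπ.surjective ?_
  rwa [← hY, derEquiv_symm_toDer]

lemma ker_reduceVF : LinearMap.ker (reduceVF hj hcl hπ) =
    (symmetryData (E := EM) j 𝓓).lieNull.toSubmodule := by
  ext X
  have hX : X.1 ∈ (symmetryData (E := EM) j 𝓓).F ↔
      ReducesTo (E := E) j π (derEquiv.symm X.1) (0 : VF E' Q) := by
    rw [← mem_symmetryData_F_iff_reducesTo_zero E' hj hcl hπ, toDer_derEquiv_symm]
  refine ⟨fun h => hX.2 (LinearMap.mem_ker.1 h ▸ reducesTo_reduceVF hj hcl hπ X), fun h => ?_⟩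
  exact (hX.1 h).reduceVF_eq hj hcl hπ (toDer_derEquiv_symm X.1)

lemma reduceVF_lie (X X' : (symmetryData (E := EM) j 𝓓).lieWobs) :
    reduceVF hj hcl hπ ⁅X, X'⁆ = ⁅reduceVF hj hcl hπ X, reduceVF hj hcl hπ X'⁆ := by
  refine ReducesTo.reduceVF_eq hj hcl hπ ?_ ((reducesTo_reduceVF hj hcl hπ X).lie hj.contMDiff
    hπ.contMDiff (reducesTo_reduceVF hj hcl hπ X'))
  rw [VF.toDer_lie, toDer_derEquiv_symm, toDer_derEquiv_symm, LieSubalgebra.coe_bracket]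

lemma reduceVF_smul (f : (symmetryData (E := EM) j 𝓓).algWobs)
    (X : (symmetryData (E := EM) j 𝓓).lieWobs) :
    reduceVF hj hcl hπ ⟨f.1 • X.1, SymmetryData.smul_mem_lieWobs _ f.2 X.2⟩ =
      reduceFun hj hcl hπ f • reduceVF hj hcl hπ X := by
  refine ReducesTo.reduceVF_eq hj hcl hπ ?_ ((reducesTo_reduceVF hj hcl hπ X).fun_smul hj.contMDiff
    hπ.contMDiff (comapFun_reduceFun hj hcl hπ f))
  rw [VF.toDer_smul, toDer_derEquiv_symm]

lemma reduceFun_apply_derivation (X : (symmetryData (E := EM) j 𝓓).lieWobs)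
    (f : (symmetryData (E := EM) j 𝓓).algWobs) :
    reduceFun hj hcl hπ ⟨X.1 f.1, SymmetryData.apply_mem_algWobs _ X.2 f.2⟩ =
      ⁅reduceVF hj hcl hπ X, reduceFun hj hcl hπ f⁆ := by
  apply comapFun_injective hπ.contMDiff hπ.surjective
  rw [comapFun_reduceFun, (reducesTo_reduceVF hj hcl hπ X).comapFun_lie_fun hj.contMDiff
    hπ.contMDiff (comapFun_reduceFun hj hcl hπ f), ← VF.toDer_apply, toDer_derEquiv_symm]

variable [SigmaCompactSpace S]

lemma reduceVF_surjective : Function.Surjective (reduceVF hj hcl hπ) := fun V => by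
  obtain ⟨Y, hY⟩ := exists_reducesTo hj hcl hπ V
  exact ⟨⟨Y.toDer, (mem_lieWobs_iff_exists_reducesTo hj hcl hπ).2 ⟨V, hY⟩⟩,
    hY.reduceVF_eq hj hcl hπ rfl⟩

/-- The linear isomorphism underlying `lieRedHom`. -/
def lieRedEquiv : (symmetryData (E := EM) j 𝓓).LieRed ≃ₗ[ℝ] VF E' Q :=
  (Submodule.quotEquivOfEq _ _ (ker_reduceVF hj hcl hπ).symm).trans
    (LinearMap.quotKerEquivOfSurjective (reduceVF hj hcl hπ) (reduceVF_surjective hj hcl hπ))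

/-- The isomorphism of Lie-Rinehart algebras, over `algRedEquiv`, of the reduced Lie algebra with
the vector fields on the leaf space. -/
def lieRedHom : LieRinehartAlgebra.Hom (A₁ := (symmetryData (E := EM) j 𝓓).AlgRed)
    (algRedEquiv hj hcl hπ).toAlgHom (symmetryData (E := EM) j 𝓓).LieRed (VF E' Q) where
  __ := lieRedEquiv hj hcl hπ
  map_lie' {x y} := by
    obtain ⟨X, rfl⟩ := Submodule.Quotient.mk_surjective _ x
    obtain ⟨X', rfl⟩ := Submodule.Quotient.mk_surjective _ y
    exact reduceVF_lie hj hcl hπ X X'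
  map_smul_apply' a x := by
    obtain ⟨f, rfl⟩ := Ideal.Quotient.mk_surjective a
    obtain ⟨X, rfl⟩ := Submodule.Quotient.mk_surjective _ x
    exact reduceVF_smul hj hcl hπ f X
  apply_lie' a x := by
    obtain ⟨f, rfl⟩ := Ideal.Quotient.mk_surjective a
    obtain ⟨X, rfl⟩ := Submodule.Quotient.mk_surjective _ x
    exact reduceFun_apply_derivation hj hcl hπ X f

lemma lieRedHom_mk_apply {X : (symmetryData (E := EM) j 𝓓).lieWobs} {Y : VF EM M} {Z : VF E S}
    (hY : Y.toDer = X.1) (hZ : Restricts j Y Z) (s : S) :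
    lieRedHom hj hcl hπ (LieSubmodule.Quotient.mk X) (π s) =
      mfderiv 𝓘(ℝ, E) 𝓘(ℝ, E') π s (Z s) := by
  have hred := reducesTo_reduceVF hj hcl hπ X
  rw [← hY, derEquiv_symm_toDer] at hred
  exact hred.apply_eq_mfderiv hj hZ s

lemma lieRedHom_bijective : Function.Bijective fun x => lieRedHom hj hcl hπ x :=
  (lieRedEquiv hj hcl hπ).bijective

end Reduction

section Cartan

variable {E M : Type*} [NormedAddCommGroup E] [NormedSpace ℝ E] [FiniteDimensional ℝ E]
  [TopologicalSpace M] [ChartedSpace E M] [IsManifold 𝓘(ℝ, E) ∞ M] {k : ℕ}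

/-- The contraction of a differential form with a vector field, in the first slot. -/
def DiffForm.contract (X : VF E M) (σ : DiffForm E M (k + 1)) : DiffForm E M k :=
  ⟨fun x => toContAlt ((σ.1 x).toAlternatingMap.curryLeft (X x)), fun V =>
    (DiffForm.eval σ (Matrix.vecCons X V)).contMDiff.congr fun x =>
      congrArg (σ.1 x) (funext fun i => by cases i using Fin.cases <;> rfl)⟩

lemma DiffForm.contract_apply (X : VF E M) (σ : DiffForm E M (k + 1)) (x : M)
    (v : Fin k → TangentSpace 𝓘(ℝ, E) x) :
    (DiffForm.contract X σ).1 x v = σ.1 x (Matrix.vecCons (X x) v) := rfl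

lemma DiffForm.eval_contract (X : VF E M) (σ : DiffForm E M (k + 1)) (V : Fin k → VF E M) :
    DiffForm.eval (DiffForm.contract X σ) V = DiffForm.eval σ (Matrix.vecCons X V) :=
  ContMDiffMap.ext fun x =>
    congrArg (σ.1 x) (funext fun i => by cases i using Fin.cases <;> rfl)

variable [T2Space M]

lemma formEquiv_contract (X : VF E M) (σ : DiffForm E M (k + 1)) :
    formEquiv E M k (DiffForm.contract X σ) =
      ConstraintReduction.contract X.toDer (formEquiv E M (k + 1) σ) := by
  ext Y : 1
  rw [formEquiv_apply, DiffForm.eval_contract]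
  refine congrArg (DiffForm.eval σ) (funext fun i => ?_)
  cases i using Fin.cases
  · exact (derEquiv_symm_toDer X).symm
  · rfl

/-- The Lie derivative of a differential form along a vector field. -/
def DiffForm.lieDer (X : VF E M) (σ : DiffForm E M k) : DiffForm E M k :=
  (formEquiv E M k).symm (ConstraintReduction.lieDer X.toDer (formEquiv E M k σ))

lemma formEquiv_lieDer (X : VF E M) (σ : DiffForm E M k) : formEquiv E M k (DiffForm.lieDer X σ) =
    ConstraintReduction.lieDer X.toDer (formEquiv E M k σ) :=
  (formEquiv E M k).apply_symm_apply _

lemma DiffForm.eval_lieDer (X : VF E M) (σ : DiffForm E M k) (V : Fin k → VF E M) :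
    DiffForm.eval (DiffForm.lieDer X σ) V =
      ⁅X, DiffForm.eval σ V⁆ - ∑ i, DiffForm.eval σ (Function.update V i ⁅X, V i⁆) := by
  refine (represents_formEquiv (DiffForm.lieDer X σ) V).symm.trans ?_
  rw [formEquiv_lieDer]
  refine congrArg₂ (fun f g : Fun E M => f - g) ?_ (Finset.sum_congr rfl fun i _ => ?_)
  · exact congrArg X.toDer (represents_formEquiv σ V)
  · rw [← VF.toDer_lie, ← represents_formEquiv σ]
    exact congrArg _ (funext fun l =>
      (Function.apply_update (fun _ (Z : VF E M) => Z.toDer) V i ⁅X, V i⁆ l).symm)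

end Cartan

section Pullback

variable {E M E' M' : Type*} [NormedAddCommGroup E] [NormedSpace ℝ E] [FiniteDimensional ℝ E]
  [TopologicalSpace M] [ChartedSpace E M] [IsManifold 𝓘(ℝ, E) ∞ M] [T2Space M]
  [NormedAddCommGroup E'] [NormedSpace ℝ E'] [TopologicalSpace M'] [ChartedSpace E' M']
  [IsManifold 𝓘(ℝ, E') ∞ M'] {h : M' → M} {k : ℕ}

lemma contMDiff_pullback_apply (hh : ContMDiff 𝓘(ℝ, E') 𝓘(ℝ, E) ∞ h) (σ : DiffForm E M k)
    (Z : Fin k → VF E' M') : ContMDiff 𝓘(ℝ, E') 𝓘(ℝ, ℝ) ∞ fun s =>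
      pullback (E' := E') h σ.1 s fun i => Z i s := fun s₀ => by
  let b := coordFun (E := E) (h s₀)
  let e := coordField (E := E) (h s₀)
  let g : Fun E' M' := ∑ r : Fin k → Fin (Module.finrank ℝ E),
    (∏ a, ⁅Z a, comapFun hh (b (r a))⁆) * comapFun hh (DiffForm.eval σ fun a => e (r a))
  refine (g.contMDiff s₀).congr_of_eventuallyEq ?_
  filter_upwards [(hh.continuous.tendsto s₀).eventually
    (eq_sum_mvfderiv_coordFun_smul (E := E) (h s₀))] with s hframe
  rw [pullback_apply]
  refine (multilinearMap_apply_eq_sum_basis (σ.1 (h s)).toMultilinearMap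
    fun a => hframe (mfderiv 𝓘(ℝ, E') 𝓘(ℝ, E) h s (Z a s))).trans ?_
  refine Eq.trans (Finset.sum_congr rfl fun r _ => ?_) (fun_sum_apply _ _ s).symm
  refine congrArg₂ (· * ·) ?_ rfl
  refine Eq.trans (Finset.prod_congr rfl fun a _ => ?_)
    (map_prod ((Pi.evalRingHom (fun _ : M' => ℝ) s).comp ContMDiffMap.coeFnRingHom) _ _).symm
  exact (mvfderiv_comapFun hh (b (r a)) s (Z a s)).symm

/-- The pullback of differential forms along a smooth map. -/
def pullbackForm (hh : ContMDiff 𝓘(ℝ, E') 𝓘(ℝ, E) ∞ h) : DiffForm E M k →ₗ[ℝ] DiffForm E' M' k where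
  toFun σ := ⟨pullback h σ.1, contMDiff_pullback_apply hh σ⟩
  map_add' _ _ := rfl
  map_smul' _ _ := rfl

lemma pullbackForm_apply (hh : ContMDiff 𝓘(ℝ, E') 𝓘(ℝ, E) ∞ h) (σ : DiffForm E M k) (s : M')
    (v : Fin k → TangentSpace 𝓘(ℝ, E') s) : (pullbackForm hh σ).1 s v =
      σ.1 (h s) fun i => mfderiv 𝓘(ℝ, E') 𝓘(ℝ, E) h s (v i) := rfl

lemma eval_pullbackForm (hh : ContMDiff 𝓘(ℝ, E') 𝓘(ℝ, E) ∞ h) (σ : DiffForm E M k)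
    {Y : Fin k → VF E M} {Z : Fin k → VF E' M'} (H : ∀ i, Restricts h (Y i) (Z i)) :
    DiffForm.eval (pullbackForm hh σ) Z = comapFun hh (DiffForm.eval σ Y) :=
  ContMDiffMap.ext fun s => pullback_apply_restricts σ H s

lemma pullbackForm_injective (hh : ContMDiff 𝓘(ℝ, E') 𝓘(ℝ, E) ∞ h)
    (hsurj : Function.Surjective h)
    (hd : ∀ s, Function.Surjective (mfderiv 𝓘(ℝ, E') 𝓘(ℝ, E) h s)) :
    Function.Injective (pullbackForm (k := k) hh) := fun σ τ hστ => by
  refine Subtype.ext (funext <| hsurj.forall.2 fun s => ContinuousAlternatingMap.ext fun v => ?_)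
  choose w hw using fun i => hd s (v i)
  rw [← funext hw, ← pullbackForm_apply hh, ← pullbackForm_apply hh, hστ]

omit [FiniteDimensional ℝ E] [T2Space M] in
lemma Restricts.update {ι : Type*} [DecidableEq ι] {Y : ι → VF E M} {Z : ι → VF E' M'}
    (H : ∀ i, Restricts h (Y i) (Z i)) (i : ι) {X : VF E M} {W : VF E' M'}
    (H' : Restricts h X W) (l : ι) :
    Restricts h (Function.update Y i X l) (Function.update Z i W l) := by
  rcases eq_or_ne l i with rfl | hl
  · simpa only [Function.update_self] using H'
  · simpa only [Function.update_of_ne hl] using H l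

lemma pullbackForm_contract [FiniteDimensional ℝ E']
    (hh : ContMDiff 𝓘(ℝ, E') 𝓘(ℝ, E) ∞ h) {X : VF E M} {W : VF E' M'}
    (H : Restricts h X W) (σ : DiffForm E M (k + 1)) :
    pullbackForm hh (DiffForm.contract X σ) = DiffForm.contract W (pullbackForm hh σ) := by
  refine Subtype.ext (funext fun s => ContinuousAlternatingMap.ext fun v => ?_)
  rw [pullbackForm_apply, DiffForm.contract_apply, DiffForm.contract_apply, pullbackForm_apply, H s]
  exact congrArg _ (funext fun i => by cases i using Fin.cases <;> rfl)

variable (E E') in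
/-- Every tangent vector of the source of `h` belongs to a vector field which is `h`-related to one
on the target. It allows one to test forms on the source on related vector fields only. -/
def HasRelatedFields (h : M' → M) : Prop :=
  ∀ s (v : TangentSpace 𝓘(ℝ, E') s), ∃ (Y : VF E M) (Z : VF E' M'), Restricts h Y Z ∧ Z s = v

namespace HasRelatedFields

omit [FiniteDimensional ℝ E] [T2Space M] in
lemma form_ext (hr : HasRelatedFields E E' h) {σ τ : DiffForm E' M' k}
    (H : ∀ (Y : Fin k → VF E M) Z, (∀ i, Restricts h (Y i) (Z i)) →
      DiffForm.eval σ Z = DiffForm.eval τ Z) : σ = τ := by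
  refine Subtype.ext (funext fun s => ContinuousAlternatingMap.ext fun v => ?_)
  choose Y Z hYZ hZ using fun i => hr s (v i)
  rw [← funext hZ]
  exact congrArg (fun f : Fun E' M' => f s) (H Y Z hYZ)

lemma pullbackForm_lieDer [FiniteDimensional ℝ E'] [T2Space M'] (hr : HasRelatedFields E E' h)
    (hh : ContMDiff 𝓘(ℝ, E') 𝓘(ℝ, E) ∞ h)
    {X : VF E M} {W : VF E' M'} (H : Restricts h X W) (σ : DiffForm E M k) :
    pullbackForm hh (DiffForm.lieDer X σ) = DiffForm.lieDer W (pullbackForm hh σ) :=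
  hr.form_ext fun Y Z hYZ => by
    rw [eval_pullbackForm hh _ hYZ, DiffForm.eval_lieDer, DiffForm.eval_lieDer, map_sub, map_sum,
      eval_pullbackForm hh _ hYZ, H.lie_comapFun hh]
    exact congrArg _ (Finset.sum_congr rfl fun i _ =>
      (eval_pullbackForm hh _ (Restricts.update hYZ i (H.lie hh (hYZ i)))).symm)

end HasRelatedFields

end Pullback

section Basic

variable {E S E' Q : Type*} [NormedAddCommGroup E] [NormedSpace ℝ E] [TopologicalSpace S]
  [ChartedSpace E S] [IsManifold 𝓘(ℝ, E) ∞ S] [FiniteDimensional ℝ E] [T2Space S]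
  [NormedAddCommGroup E'] [NormedSpace ℝ E'] [TopologicalSpace Q] [ChartedSpace E' Q]
  [IsManifold 𝓘(ℝ, E') ∞ Q] [FiniteDimensional ℝ E'] [T2Space Q]
  {𝓓 : RegularFoliation E S} {π : S → Q} {k : ℕ} {η : DiffForm E S k}

lemma RegularFoliation.isBasic_iff : 𝓓.IsBasic η.1 ↔ ∀ W ∈ secs 𝓓.D,
    (∀ Z i, DiffForm.eval η (Function.update Z i W) = 0) ∧ DiffForm.lieDer W η = 0 := by
  have heval (Z : Fin k → VF E S) (i : Fin k) (W : VF E S) (x : S) :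
      DiffForm.eval η (Function.update Z i W) x =
        η.1 x (Function.update (fun l => Z l x) i (W x)) := by
    rw [DiffForm.eval_apply, vf_update_apply]
  have hlie (W : VF E S) (Z : Fin k → VF E S) (x : S) :
      DiffForm.eval (DiffForm.lieDer W η) Z x =
        mvfderiv 𝓘(ℝ, E) (fun y => η.1 y fun l => Z l y) x (W x) -
          ∑ i, η.1 x (Function.update (fun l => Z l x) i (⁅W, Z i⁆ x)) := by
    simp only [← heval, ← fun_sum_apply]
    exact congrArg (fun f : Fun E S => f x) (DiffForm.eval_lieDer W η Z)
  refine forall₂_congr fun W _ => ⟨fun H => ⟨fun Z i => ContMDiffMap.ext fun x => ?_, ?_⟩,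
    fun ⟨H, H'⟩ Z x => ⟨fun i => ?_, ?_⟩⟩
  · exact (heval Z i W x).trans ((H Z x).1 i)
  · exact DiffForm.ext_eval fun Z => ContMDiffMap.ext fun x =>
      (hlie W Z x).trans (sub_eq_zero.2 (H Z x).2)
  · rw [← heval, H]
    rfl
  · rw [← sub_eq_zero, ← hlie, H']
    rfl

variable [SigmaCompactSpace S]

namespace RegularFoliation.IsLeafSpace

lemma hasRelatedFields (hπ : 𝓓.IsLeafSpace (E' := E') π) : HasRelatedFields E' E π :=
  hπ.exists_restricts_apply_eq

omit [T2Space S] [SigmaCompactSpace S] in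
lemma pullbackForm_injective (hπ : 𝓓.IsLeafSpace (E' := E') π) :
    Function.Injective (pullbackForm (k := k) hπ.contMDiff) :=
  ConstraintReduction.pullbackForm_injective hπ.contMDiff hπ.surjective
    (mfderiv_surjective_of_isSubmersion hπ.submersion)

lemma isBasic_pullbackForm (hπ : 𝓓.IsLeafSpace (E' := E') π) (τ : DiffForm E' Q k) :
    𝓓.IsBasic (pullbackForm hπ.contMDiff τ).1 := by
  refine RegularFoliation.isBasic_iff.2 fun W hW => ⟨fun Z i => ContMDiffMap.ext fun s => ?_, ?_⟩
  · refine (τ.1 (π s)).map_coord_zero i ?_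
    simp only [Function.update_self]
    exact (hπ.tangent s (W s)).2 (hW s)
  · have hzero : DiffForm.lieDer 0 τ = 0 := DiffForm.ext_eval fun V => by
      rw [DiffForm.eval_lieDer, zero_lie, zero_sub]
      refine neg_eq_zero.2 <| Finset.sum_eq_zero fun i _ => (DiffForm.toAlt τ).map_coord_zero i ?_
      rw [Function.update_self, zero_lie]
    rw [← hπ.hasRelatedFields.pullbackForm_lieDer hπ.contMDiff (hπ.mem_secs_iff.1 hW), hzero,
      map_zero]

/- On projectable fields `Z i` the Lie condition says that `η(Z)` is constant along the leaves,
since `⁅W, Z i⁆` is again tangent to the leaves; horizontality makes `η(Z)` independent of the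
lifts. -/
lemma exists_comapFun_eq_eval (hπ : 𝓓.IsLeafSpace (E' := E') π) (hη : 𝓓.IsBasic η.1)
    (V : Fin k → VF E' Q) : ∃ g : Fun E' Q, ∀ Z : Fin k → VF E S,
      (∀ i, Restricts π (V i) (Z i)) → comapFun hπ.contMDiff g = DiffForm.eval η Z := by
  rw [RegularFoliation.isBasic_iff] at hη
  choose L hL using fun i => exists_restricts_of_isSubmersion hπ.submersion (V i)
  have hrange : DiffForm.eval η L ∈ (comapFun hπ.contMDiff).range := by
    refine hπ.mem_range_comapFun_iff_lie_eq_zero.2 fun W hW => ?_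
    have hlie := DiffForm.eval_lieDer W η L
    rw [(hη W hW).2, Finset.sum_eq_zero fun i _ => (hη _ ?_).1 L i, sub_zero] at hlie
    · exact hlie.symm
    · rw [hπ.mem_secs_iff] at hW ⊢
      simpa only [zero_lie] using hW.lie hπ.contMDiff (hL i)
  obtain ⟨g, hg⟩ := hrange
  refine ⟨g, fun Z hZ => hg.trans ?_⟩
  refine multilinearMap_eq_of_sub_mem (DiffForm.toAlt η).toMultilinearMap (N := secs 𝓓.D)
    (fun Y i hY => ?_) fun i s => ?_
  · have hYi := (hη _ hY).1 Y i
    rwa [Function.update_eq_self] at hYi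
  · rw [← hπ.tangent]
    change mfderiv 𝓘(ℝ, E) 𝓘(ℝ, E') π s (L i s - Z i s) = 0
    rw [map_sub, ← hL i s, ← hZ i s, sub_self]

lemma mem_range_pullbackForm_iff (hπ : 𝓓.IsLeafSpace (E' := E') π) :
    η ∈ LinearMap.range (pullbackForm (k := k) hπ.contMDiff) ↔ 𝓓.IsBasic η.1 := by
  refine ⟨fun ⟨τ, hτ⟩ => hτ ▸ hπ.isBasic_pullbackForm τ, fun hη => ?_⟩
  choose g hg using hπ.exists_comapFun_eq_eval hη
  choose L hL using exists_restricts_of_isSubmersion hπ.submersion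
  have hinj := comapFun_injective hπ.contMDiff hπ.surjective
  let α : VF E' Q [⋀^Fin k]→ₗ[Fun E' Q] Fun E' Q :=
    { toFun := g
      map_update_add' := fun V i X Y => hinj <| by
        rw [map_add, hg _ _ (Restricts.update (fun i => hL (V i)) i ((hL X).add (hL Y))),
          hg _ _ (Restricts.update (fun i => hL (V i)) i (hL X)),
          hg _ _ (Restricts.update (fun i => hL (V i)) i (hL Y))]
        exact (DiffForm.toAlt η).map_update_add _ i _ _
      map_update_smul' := fun V i f X => hinj <| by
        rw [smul_eq_mul, map_mul, hg _ _ (Restricts.update (fun i => hL (V i)) i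
            ((hL X).comapFun_smul hπ.contMDiff f)),
          hg _ _ (Restricts.update (fun i => hL (V i)) i (hL X))]
        exact (DiffForm.toAlt η).map_update_smul _ i _ _
      map_eq_zero_of_eq' := fun V i l h hne => hinj <| by
        rw [map_zero, hg V _ fun i => hL (V i)]
        exact (DiffForm.toAlt η).map_eq_zero_of_eq _ (congrArg L h) hne }
  refine ⟨formOfAlt α, hπ.hasRelatedFields.form_ext fun V Z hVZ => ?_⟩
  rw [eval_pullbackForm hπ.contMDiff _ hVZ, eval_formOfAlt]
  exact hg V Z hVZ

end RegularFoliation.IsLeafSpace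

end Basic

section PartitionOfUnity

variable {E M : Type*} [NormedAddCommGroup E] [NormedSpace ℝ E] [FiniteDimensional ℝ E]
  [TopologicalSpace M] [ChartedSpace E M] [IsManifold 𝓘(ℝ, E) ∞ M] [T2Space M]
  [SigmaCompactSpace M] {k : ℕ}

lemma DiffForm.exists_forall_of_local
    {p : ∀ x : M, (TangentSpace 𝓘(ℝ, E) x [⋀^Fin k]→L[ℝ] ℝ) → Prop}
    (hconv : ∀ x, Convex ℝ {θ | p x θ})
    (hloc : ∀ x, ∃ τ : DiffForm E M k, ∀ᶠ y in 𝓝 x, p y (τ.1 y)) :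
    ∃ σ : DiffForm E M k, ∀ x, p x (σ.1 x) := by
  choose τ hτ using hloc
  obtain ⟨ρ, hρ⟩ := SmoothPartitionOfUnity.exists_isSubordinate 𝓘(ℝ, E) isClosed_univ
    (fun x => interior {y | p y ((τ x).1 y)}) (fun _ => isOpen_interior)
    fun x _ => Set.mem_iUnion.2 ⟨x, mem_interior_iff_mem_nhds.2 (hτ x)⟩
  refine ⟨⟨fun x => ∑ i ∈ ρ.finsupport x, ρ i x • (τ i).1 x, fun V => ?_⟩, fun x => ?_⟩
  · refine (ρ.contMDiff_finsum_smul fun i x _ =>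
      (DiffForm.eval (τ i) V).contMDiff x).congr fun x => ?_
    rw [← ρ.sum_finsupport_smul_eq_finsum]
    exact ContinuousAlternatingMap.sum_apply _ _
  · refine (hconv x).sum_mem (fun i _ => ρ.nonneg i x) (ρ.sum_finsupport x (Set.mem_univ x))
      fun i hi => ?_
    exact interior_subset (s := {y | p y ((τ i).1 y)})
      (hρ i (subset_tsupport _ ((ρ.mem_finsupport x).1 hi)))

end PartitionOfUnity

section Embedding

variable {EM M E S : Type*} [NormedAddCommGroup EM] [NormedSpace ℝ EM] [FiniteDimensional ℝ EM]
  [TopologicalSpace M] [ChartedSpace EM M] [IsManifold 𝓘(ℝ, EM) ∞ M] [T2Space M]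
  [SigmaCompactSpace M] [NormedAddCommGroup E] [NormedSpace ℝ E] [FiniteDimensional ℝ E]
  [TopologicalSpace S] [ChartedSpace E S] [IsManifold 𝓘(ℝ, E) ∞ S] [T2Space S]
  {j : S → M} {k : ℕ}

lemma hasRelatedFields_of_isSmoothEmbedding
    (hj : Manifold.IsSmoothEmbedding 𝓘(ℝ, E) 𝓘(ℝ, EM) ∞ j) (hcl : IsClosed (Set.range j)) :
    HasRelatedFields EM E j := fun s v =>
  (exists_restricts_of_isSmoothEmbedding hj hcl (extendVec s v)).imp fun _ hY =>
    ⟨extendVec s v, hY, extendVec_apply s v⟩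

/- The coefficients of `η` in a local frame are extended one by one, so the resulting multilinear
map need not be alternating. -/
lemma exists_multilinearMap_eventuallyEq
    (hj : Manifold.IsSmoothEmbedding 𝓘(ℝ, E) 𝓘(ℝ, EM) ∞ j) (hcl : IsClosed (Set.range j))
    (η : DiffForm E S k) (s₀ : S) :
    ∃ f : MultilinearMap (Fun EM M) (fun _ : Fin k => VF EM M) (Fun EM M), ∀ᶠ s in 𝓝 s₀,
      ∀ Y Z, (∀ i, Restricts j (Y i) (Z i)) → f Y (j s) = DiffForm.eval η Z s := by
  let e := coordField (E := E) s₀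
  choose G hG using fun i => comapFun_surjective hj hcl (coordFun (E := E) s₀ i)
  choose C hC using fun r : Fin k → Fin (Module.finrank ℝ E) =>
    comapFun_surjective hj hcl (DiffForm.eval η fun a => e (r a))
  refine ⟨∑ r, C r • (MultilinearMap.mkPiAlgebra (Fun EM M) (Fin k) (Fun EM M)).compLinearMap
    fun a => differential (G (r a)), ?_⟩
  filter_upwards [eq_sum_mvfderiv_coordFun_smul (E := E) s₀] with s hframe Y Z hYZ
  rw [DiffForm.eval_apply]
  refine Eq.trans ?_ (multilinearMap_apply_eq_sum_basis (η.1 s).toMultilinearMap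
    fun a => hframe (Z a s)).symm
  rw [sum_apply, ← comapFun_apply hj.contMDiff, map_sum, fun_sum_apply]
  refine Finset.sum_congr rfl fun r _ => ?_
  refine (congrArg (· * _) (congrArg (fun g : Fun E S => g s) (hC r))).trans
    ((mul_comm _ _).trans (congrArg (· * _) ?_))
  refine (map_prod ((Pi.evalRingHom (fun _ : M => ℝ) (j s)).comp ContMDiffMap.coeFnRingHom)
    _ _).trans (Finset.prod_congr rfl fun a _ => ?_)
  rw [← hG, mvfderiv_comapFun hj.contMDiff, ← hYZ a s]
  rfl

lemma exists_form_eventually_pullback_eq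
    (hj : Manifold.IsSmoothEmbedding 𝓘(ℝ, E) 𝓘(ℝ, EM) ∞ j) (hcl : IsClosed (Set.range j))
    (η : DiffForm E S k) (s₀ : S) : ∃ σ : DiffForm EM M k, ∀ᶠ s in 𝓝 s₀,
      pullback (E' := E) j σ.1 s = η.1 s := by
  obtain ⟨f, hf⟩ := exists_multilinearMap_eventuallyEq hj hcl η s₀
  refine ⟨(k.factorial : ℝ)⁻¹ • formOfAlt (MultilinearMap.alternatization f), ?_⟩
  filter_upwards [hf] with s hs
  refine ContinuousAlternatingMap.ext fun v => ?_
  choose Y Z hYZ hZ using fun i => hasRelatedFields_of_isSmoothEmbedding hj hcl s (v i)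
  rw [← funext hZ]
  have hsum : MultilinearMap.alternatization f Y (j s) =
      MultilinearMap.alternatization (η.1 s).toMultilinearMap fun i => Z i s := by
    rw [MultilinearMap.alternatization_apply, MultilinearMap.alternatization_apply, fun_sum_apply]
    refine Finset.sum_congr rfl fun p _ => ?_
    have hp := hs _ _ fun i => hYZ (p i)
    rw [Units.smul_def, Units.smul_def]
    exact (map_zsmul (ContMDiffMap.evalRingHom (j s)) _ _).trans (congrArg _ hp)
  calc pullback (E' := E) j ((k.factorial : ℝ)⁻¹ • formOfAlt f.alternatization).1 s _
      = (k.factorial : ℝ)⁻¹ * MultilinearMap.alternatization f Y (j s) := by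
        rw [← eval_formOfAlt]
        exact pullback_apply_restricts _ hYZ s
    _ = (k.factorial : ℝ)⁻¹ * ((k.factorial : ℝ) * η.1 s fun i => Z i s) := by
        have halt := AlternatingMap.coe_alternatization (η.1 s).toAlternatingMap
        rw [Fintype.card_fin] at halt
        rw [hsum, ← nsmul_eq_mul k.factorial]
        exact congrArg _ (congrArg (fun g => g fun i => Z i s) halt)
    _ = η.1 s fun i => Z i s := inv_mul_cancel_left₀ (Nat.cast_ne_zero.2 k.factorial_ne_zero) _

lemma pullbackForm_surjective
    (hj : Manifold.IsSmoothEmbedding 𝓘(ℝ, E) 𝓘(ℝ, EM) ∞ j) (hcl : IsClosed (Set.range j)) :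
    Function.Surjective (pullbackForm (k := k) hj.contMDiff) := fun η => by
  have hr := hasRelatedFields_of_isSmoothEmbedding hj hcl
  let p (x : M) (θ : TangentSpace 𝓘(ℝ, EM) x [⋀^Fin k]→L[ℝ] ℝ) : Prop :=
    ∀ s, j s = x → ∀ (Y : Fin k → VF EM M) (Z : Fin k → VF E S),
      (∀ i, Restricts j (Y i) (Z i)) → θ (fun i => Y i x) = DiffForm.eval η Z s
  have hconv : ∀ x, Convex ℝ {θ | p x θ} := fun x v hv w hw a b _ _ hab s hs Y Z hYZ => by
    change a * v _ + b * w _ = _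
    rw [hv s hs Y Z hYZ, hw s hs Y Z hYZ, ← add_mul, hab, one_mul]
  suffices hloc : ∀ x, ∃ τ : DiffForm EM M k, ∀ᶠ y in 𝓝 x, p y (τ.1 y) by
    obtain ⟨σ, hσ⟩ := DiffForm.exists_forall_of_local hconv hloc
    exact ⟨σ, hr.form_ext fun Y Z hYZ => (eval_pullbackForm hj.contMDiff σ hYZ).trans <|
      ContMDiffMap.ext fun s => hσ (j s) s rfl Y Z hYZ⟩
  intro x
  by_cases hx : x ∈ Set.range j
  · obtain ⟨s₀, rfl⟩ := hx
    obtain ⟨τ, hτ⟩ := exists_form_eventually_pullback_eq hj hcl η s₀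
    rw [hj.isEmbedding.nhds_eq_comap, eventually_comap] at hτ
    refine ⟨τ, hτ.mono ?_⟩
    rintro _ hy s rfl Y Z hYZ
    rw [DiffForm.eval_apply, ← hy s rfl]
    exact (pullback_apply_restricts τ hYZ s).symm
  · exact ⟨0, (hcl.isOpen_compl.eventually_mem hx).mono fun y hy s hs => absurd ⟨s, hs⟩ hy⟩

end Embedding

lemma curryLeft_eq_zero_iff {R V W : Type*} [CommSemiring R] [AddCommMonoid V] [Module R V]
    [AddCommGroup W] [Module R W] {k : ℕ} {f : V [⋀^Fin (k + 1)]→ₗ[R] W} {w : V} :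
    f.curryLeft w = 0 ↔ ∀ v i, f (Function.update v i w) = 0 := by
  refine ⟨fun hw v i => ?_, fun hw => AlternatingMap.ext fun v => ?_⟩
  · have hswap : Function.update v i w ∘ Equiv.swap 0 i =
        Matrix.vecCons w (Matrix.vecTail (v ∘ Equiv.swap 0 i)) := by
      refine funext fun l => ?_
      cases l using Fin.cases with
      | zero => simp
      | succ l =>
        have hne : Equiv.swap 0 i l.succ ≠ i := fun h =>
          l.succ_ne_zero ((Equiv.swap 0 i).injective (h.trans (Equiv.swap_apply_left 0 i).symm))
        simp [Function.update_of_ne hne, Matrix.vecTail]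
    have hperm := f.map_perm (Function.update v i w) (Equiv.swap 0 i)
    rw [hswap, ← AlternatingMap.curryLeft_apply_apply, hw] at hperm
    exact (smul_eq_zero_iff_eq _).1 hperm.symm
  · have hupdate := hw (Matrix.vecCons 0 v) 0
    rwa [Matrix.vecCons, Fin.update_cons_zero] at hupdate

lemma DiffForm.contract_eq_zero_iff {E S : Type*} [NormedAddCommGroup E] [NormedSpace ℝ E]
    [FiniteDimensional ℝ E] [TopologicalSpace S] [ChartedSpace E S] [IsManifold 𝓘(ℝ, E) ∞ S]
    [T2Space S] {k : ℕ} {W : VF E S} {η : DiffForm E S (k + 1)} :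
    DiffForm.contract W η = 0 ↔ ∀ Z i, DiffForm.eval η (Function.update Z i W) = 0 := by
  refine Iff.trans ⟨fun h => AlternatingMap.ext fun V => ?_, fun h => DiffForm.ext_eval fun V => ?_⟩
    (curryLeft_eq_zero_iff (f := DiffForm.toAlt η) (w := W))
  · exact (DiffForm.eval_contract W η V).symm.trans (h ▸ rfl)
  · exact (DiffForm.eval_contract W η V).trans (congrArg (fun f => f V) h)

section Constraint

variable {EM M E S : Type*} [NormedAddCommGroup EM] [NormedSpace ℝ EM] [FiniteDimensional ℝ EM]
  [TopologicalSpace M] [ChartedSpace EM M] [IsManifold 𝓘(ℝ, EM) ∞ M] [T2Space M]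
  [SigmaCompactSpace M] [NormedAddCommGroup E] [NormedSpace ℝ E] [FiniteDimensional ℝ E]
  [TopologicalSpace S] [ChartedSpace E S] [IsManifold 𝓘(ℝ, E) ∞ S] [T2Space S]
  {j : S → M} {𝓓 : RegularFoliation E S} {k : ℕ}

lemma forall_mem_derWobs_iff
    (hj : Manifold.IsSmoothEmbedding 𝓘(ℝ, E) 𝓘(ℝ, EM) ∞ j) (hcl : IsClosed (Set.range j))
    {ι : Type*} {p : (ι → Derivation ℝ (Fun EM M) (Fun EM M)) → Prop} :
    (∀ X, (∀ i, X i ∈ derWobs (symmetryData (E := EM) j 𝓓).I) → p X) ↔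
      ∀ (Y : ι → VF EM M) (Z : ι → VF E S), (∀ i, Restricts j (Y i) (Z i)) →
        p fun i => (Y i).toDer := by
  refine ⟨fun H Y Z hYZ => H _ fun i => (mem_derWobs_iff hj hcl).2 ⟨Z i, hYZ i⟩,
    fun H X hX => ?_⟩
  have hX' (i) : (derEquiv.symm (X i)).toDer = X i := toDer_derEquiv_symm (X i)
  choose Z hZ using fun i => (mem_derWobs_iff hj hcl).1 ((hX' i).symm ▸ hX i)
  simpa only [hX'] using H _ Z hZ

lemma formEquiv_mem_formNull_iff
    (hj : Manifold.IsSmoothEmbedding 𝓘(ℝ, E) 𝓘(ℝ, EM) ∞ j) (hcl : IsClosed (Set.range j))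
    {σ : DiffForm EM M k} :
    formEquiv EM M k σ ∈ (symmetryData (E := EM) j 𝓓).formNull k ↔
      pullbackForm hj.contMDiff σ = 0 := by
  have hmem (Y : Fin k → VF EM M) (Z : Fin k → VF E S) (hYZ : ∀ i, Restricts j (Y i) (Z i)) :
      formEquiv EM M k σ (fun i => (Y i).toDer) ∈ (symmetryData (E := EM) j 𝓓).I ↔
        DiffForm.eval (pullbackForm hj.contMDiff σ) Z = 0 := by
    rw [represents_formEquiv σ Y, mem_symmetryData_I_iff hj.contMDiff, eval_pullbackForm _ _ hYZ]
  refine (forall_mem_derWobs_iff hj hcl).trans ⟨fun H => ?_, fun H Y Z hYZ => ?_⟩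
  · exact (hasRelatedFields_of_isSmoothEmbedding hj hcl).form_ext fun Y Z hYZ =>
      (hmem Y Z hYZ).1 (H Y Z hYZ)
  · rw [hmem Y Z hYZ, H]
    rfl

lemma mem_formTan_symmetryData
    (hj : Manifold.IsSmoothEmbedding 𝓘(ℝ, E) 𝓘(ℝ, EM) ∞ j) (hcl : IsClosed (Set.range j))
    (σ : DiffForm EM M k) :
    formEquiv EM M k σ ∈ (symmetryData (E := EM) j 𝓓).formTan k := by
  refine (forall_mem_derWobs_iff hj hcl).2 fun Y Z hYZ ⟨i, hi⟩ => ?_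
  have hnull : Restricts j (Y i) (0 : VF E S) :=
    Restricts.of_lie_comapFun hj.contMDiff fun f => by
      rw [zero_lie]
      exact ((mem_symmetryData_I_iff hj.contMDiff).1 (hi f)).symm
  have hZ : Z i = 0 := (hYZ i).unique hj hnull
  rw [represents_formEquiv σ Y, mem_symmetryData_I_iff hj.contMDiff,
    ← eval_pullbackForm hj.contMDiff _ hYZ]
  exact (DiffForm.toAlt _).map_coord_zero i hZ

lemma contract_formEquiv_mem_formNull_iff
    (hj : Manifold.IsSmoothEmbedding 𝓘(ℝ, E) 𝓘(ℝ, EM) ∞ j) (hcl : IsClosed (Set.range j))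
    {X : VF EM M} {W : VF E S} (H : Restricts j X W) {σ : DiffForm EM M k} :
    contract X.toDer (formEquiv EM M k σ) ∈ (symmetryData (E := EM) j 𝓓).formNull (k - 1) ↔
      ∀ Z i, DiffForm.eval (pullbackForm hj.contMDiff σ) (Function.update Z i W) = 0 := by
  cases k with
  | zero => exact iff_of_true (zero_mem _) fun _ i => i.elim0
  | succ k =>
    rw [← formEquiv_contract, ← DiffForm.contract_eq_zero_iff, ← pullbackForm_contract _ H]
    exact formEquiv_mem_formNull_iff hj hcl

lemma formEquiv_mem_formWobs_iff
    (hj : Manifold.IsSmoothEmbedding 𝓘(ℝ, E) 𝓘(ℝ, EM) ∞ j) (hcl : IsClosed (Set.range j))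
    {σ : DiffForm EM M k} :
    formEquiv EM M k σ ∈ (symmetryData (E := EM) j 𝓓).formWobs k ↔
      𝓓.IsBasic (pullbackForm hj.contMDiff σ).1 := by
  have hlie {X : VF EM M} {W : VF E S} (H : Restricts j X W) :
      lieDer X.toDer (formEquiv EM M k σ) ∈ (symmetryData (E := EM) j 𝓓).formNull k ↔
        DiffForm.lieDer W (pullbackForm hj.contMDiff σ) = 0 := by
    rw [← formEquiv_lieDer, formEquiv_mem_formNull_iff hj hcl,
      (hasRelatedFields_of_isSmoothEmbedding hj hcl).pullbackForm_lieDer hj.contMDiff H]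
  rw [RegularFoliation.isBasic_iff]
  refine (and_iff_right (mem_formTan_symmetryData hj hcl σ)).trans
    ⟨fun H W hW => ?_, fun H X hX => ?_⟩
  · obtain ⟨X, hXW⟩ := exists_restricts_of_isSmoothEmbedding hj hcl W
    have hX := H X.toDer ((mem_symmetryData_F_iff hj hcl).2 ⟨W, hW, hXW⟩)
    exact hX.imp (contract_formEquiv_mem_formNull_iff hj hcl hXW).1 (hlie hXW).1
  · obtain ⟨X, rfl⟩ := VF.toDer_bijective.2 X
    obtain ⟨W, hW, hXW⟩ := (mem_symmetryData_F_iff hj hcl).1 hX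
    exact (H W hW).imp (contract_formEquiv_mem_formNull_iff hj hcl hXW).2 (hlie hXW).2

lemma formNull_le_formWobs
    (hj : Manifold.IsSmoothEmbedding 𝓘(ℝ, E) 𝓘(ℝ, EM) ∞ j) (hcl : IsClosed (Set.range j)) :
    (symmetryData (E := EM) j 𝓓).formNull k ≤ (symmetryData (E := EM) j 𝓓).formWobs k := by
  refine (formEquiv EM M k).surjective.forall.2 fun σ hσ => ?_
  rw [formEquiv_mem_formWobs_iff hj hcl, (formEquiv_mem_formNull_iff hj hcl).1 hσ,
    ← map_zero (pullbackForm hj.contMDiff), ← formEquiv_mem_formWobs_iff hj hcl, map_zero]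
  exact zero_mem _

lemma Represents.mem_formWobs_iff (hj : Manifold.IsSmoothEmbedding 𝓘(ℝ, E) 𝓘(ℝ, EM) ∞ j)
    (hcl : IsClosed (Set.range j)) {α : CE ℝ (Fun EM M) k} {σ : DiffForm EM M k}
    (h : Represents σ α) :
    α ∈ (symmetryData j 𝓓).formWobs k ↔ 𝓓.IsBasic (pullback j σ.1) := by
  rw [← represents_iff.1 h]
  exact formEquiv_mem_formWobs_iff hj hcl

lemma Represents.mem_formNull_iff (hj : Manifold.IsSmoothEmbedding 𝓘(ℝ, E) 𝓘(ℝ, EM) ∞ j)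
    (hcl : IsClosed (Set.range j)) {α : CE ℝ (Fun EM M) k} {σ : DiffForm EM M k}
    (h : Represents σ α) :
    α ∈ (symmetryData j 𝓓).formNull k ↔ ∀ s, pullback (E' := E) j σ.1 s = 0 := by
  rw [← represents_iff.1 h, formEquiv_mem_formNull_iff hj hcl]
  exact Subtype.ext_iff.trans funext_iff

end Constraint

section Cochains

variable {L V : Type*} [LieRing L] [AddCommGroup V] [LieRingModule L V] {k : ℕ}

omit [LieRing L] in
lemma removeNth_succ_cons (x : L) (Y : Fin (k + 1) → L) (i : Fin (k + 1)) :
    i.succ.removeNth (Fin.cons x Y : Fin (k + 2) → L) = Fin.cons x (i.removeNth Y) :=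
  funext (Fin.cases rfl fun l => by simp [Fin.removeNth])

lemma ceDiff_cons (α : (Fin (k + 1) → L) → V) (x : L) (Y : Fin (k + 1) → L) :
    ceDiff α (Fin.cons x Y) = (⁅x, α Y⁆ - ∑ i, α (Function.update Y i ⁅x, Y i⁆)) -
      ceDiff (fun Z => α (Fin.cons x Z)) Y := by
  have removeNth_zero_eq : ∀ z : Fin (k + 2) → L, Fin.removeNth 0 z = Fin.tail z :=
    fun z => Fin.removeNth_zero z
  rw [ceDiff, Fin.sum_univ_succ, sub_eq_add_neg (_ - _), ceDiff, ← Finset.sum_neg_distrib]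
  congr 1
  · simp only [Fin.val_zero, pow_zero, one_smul, removeNth_zero_eq, Fin.cons_zero, Fin.tail_cons,
      Finset.sum_filter, Fin.sum_univ_succ, lt_irrefl, if_false, zero_add, Fin.succ_pos, if_true,
      Fin.cons_succ, ← Fin.cons_update]
  · refine Finset.sum_congr rfl fun i _ => ?_
    simp only [Finset.sum_filter, Fin.sum_univ_succ, Fin.not_lt_zero, if_false, zero_add,
      Fin.succ_lt_succ_iff, Fin.cons_succ, ← Fin.cons_update, removeNth_succ_cons, Fin.val_succ,
      pow_succ, mul_neg, mul_one, neg_smul]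

lemma ceDiff_zero_degree (α : (Fin 0 → L) → V) (X : Fin 1 → L) :
    ceDiff α X = ⁅X 0, α Fin.elim0⁆ := by
  have eq_elim0 : ∀ z : Fin 0 → L, z = Fin.elim0 := fun z => Subsingleton.elim _ _
  simp [ceDiff, Finset.filter_singleton, eq_elim0]

lemma ceDiff_add (α β : (Fin k → L) → V) (X : Fin (k + 1) → L) :
    ceDiff (fun Y => α Y + β Y) X = ceDiff α X + ceDiff β X := by
  simp only [ceDiff, lie_add, ← Finset.sum_add_distrib, ← smul_add]
  refine Finset.sum_congr rfl fun i _ => congrArg _ ?_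
  rw [Finset.sum_add_distrib]
  abel

lemma ceDiff_zero (X : Fin (k + 1) → L) : ceDiff (fun _ => (0 : V)) X = 0 := by
  simp only [ceDiff, lie_zero, Finset.sum_const_zero, sub_zero, smul_zero]

lemma map_ceDiff {L' V' : Type*} [LieRing L'] [AddCommGroup V'] [LieRingModule L' V']
    (r : L → L' → Prop) (hr : ∀ {x y x' y'}, r x y → r x' y' → r ⁅x, x'⁆ ⁅y, y'⁆) (f : V →+ V')
    (hf : ∀ {x y} (v : V), r x y → f ⁅x, v⁆ = ⁅y, f v⁆)
    {α : (Fin k → L) → V} {β : (Fin k → L') → V'}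
    (h : ∀ X Y, (∀ i, r (X i) (Y i)) → f (α X) = β Y) {X : Fin (k + 1) → L}
    {Y : Fin (k + 1) → L'} (hXY : ∀ i, r (X i) (Y i)) : f (ceDiff α X) = ceDiff β Y := by
  rw [ceDiff, map_sum, ceDiff]
  refine Finset.sum_congr rfl fun i _ => ?_
  rw [map_zsmul, map_sub, map_sum, hf _ (hXY i),
    h (i.removeNth X) (i.removeNth Y) fun l => hXY (i.succAbove l)]
  refine congrArg _ (congrArg _ (Finset.sum_congr rfl fun l _ => h _ _ fun m => ?_))
  by_cases hm : i.succAbove m = l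
  · simp only [Fin.removeNth_apply, hm, Function.update_self]
    exact hr (hXY i) (hXY l)
  · simp only [Fin.removeNth_apply, Function.update_of_ne hm]
    exact hXY _

end Cochains

section Derivations

variable {R A : Type*} [CommRing R] [CommRing A] [Algebra R A] {k : ℕ}

lemma lieDer_apply (X : Derivation R A A) (α : CE R A k) (Y : Fin k → Derivation R A A) :
    lieDer X α Y = X (α Y) - ∑ i, α (Function.update Y i ⁅X, Y i⁆) := rfl

lemma lieDer_add_left (X X' : Derivation R A A) (α : CE R A k) (Y : Fin k → Derivation R A A) :
    lieDer (X + X') α Y = lieDer X α Y + lieDer X' α Y := by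
  simp only [lieDer_apply, Derivation.add_apply, add_lie, AlternatingMap.map_update_add,
    Finset.sum_add_distrib]
  abel

lemma lieDer_smul_left (f : A) (X : Derivation R A A) (α : CE R A k)
    (Y : Fin k → Derivation R A A) :
    lieDer (f • X) α Y = f * lieDer X α Y + ∑ i, Y i f * α (Function.update Y i X) := by
  have lie_smul_field : ∀ i, ⁅f • X, Y i⁆ = f • ⁅X, Y i⁆ - Y i f • X := fun i => by
    rw [← lie_skew, LieRinehartRing.leibniz_smul_right, ← lie_skew X, smul_neg,
      Derivation.bracket_eq_fun]
    abel
  simp only [lieDer_apply, Derivation.smul_apply, smul_eq_mul, lie_smul_field,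
    AlternatingMap.map_update_sub, AlternatingMap.map_update_smul, Finset.sum_sub_distrib,
    mul_sub, Finset.mul_sum]
  abel

lemma ceDiff_smul (f : A) (α : CE R A k) (Y : Fin (k + 1) → Derivation R A A) :
    ceDiff (fun Z => f * α Z) Y = f * ceDiff α Y +
      ∑ i : Fin (k + 1), (-1 : ℤ) ^ (i : ℕ) • (Y i f * α (i.removeNth Y)) := by
  simp only [ceDiff, Derivation.bracket_eq_fun, Derivation.leibniz, smul_eq_mul, ← Finset.mul_sum]
  rw [Finset.mul_sum, ← Finset.sum_add_distrib]
  refine Finset.sum_congr rfl fun i _ => ?_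
  rw [mul_smul_comm, ← smul_add]
  congr 1
  ring

lemma lieDer_cons_self (X : Derivation R A A) (α : CE R A (k + 1))
    (Y : Fin k → Derivation R A A) :
    lieDer X α (Matrix.vecCons X Y) = lieDer X (α.curryLeft X) Y := by
  rw [lieDer_apply, lieDer_apply, Fin.sum_univ_succ]
  have bracket_self_term :
      α (Function.update (Matrix.vecCons X Y) 0 ⁅X, Matrix.vecCons X Y 0⁆) = 0 :=
    α.map_coord_zero 0 (by simp)
  rw [bracket_self_term, zero_add]
  refine congrArg _ (Finset.sum_congr rfl fun i _ => congrArg α ?_)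
  exact (Fin.cons_update (α := fun _ => Derivation R A A) X Y i _).symm

lemma map_cons_removeNth (X : Derivation R A A) (α : CE R A (k + 1))
    (Y : Fin (k + 1) → Derivation R A A) (i : Fin (k + 1)) :
    (-1 : ℤ) ^ (i : ℕ) • α (Matrix.vecCons X (i.removeNth Y)) = α (Function.update Y i X) := by
  rw [← Fin.insertNth_removeNth, ← α.neg_one_pow_smul_map_insertNth i, smul_smul, ← pow_add,
    Even.neg_one_pow ⟨_, rfl⟩, one_smul]

lemma exists_uncurry_eq {V W : Type*} [AddCommGroup V] [Module A V] [AddCommGroup W] [Module A W]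
    (T : V →ₗ[A] V [⋀^Fin k]→ₗ[A] W) (hT : ∀ x v i, T x (Function.update v i x) = 0) :
    ∃ β : V [⋀^Fin (k + 1)]→ₗ[A] W, ∀ x v, β (Matrix.vecCons x v) = T x v := by
  have hT' {x : V} {v : Fin k → V} {i : Fin k} (h : x = v i) : T x v = 0 := by
    rw [← hT x v i, h, Function.update_eq_self]
  let T' : V →ₗ[A] MultilinearMap A (fun _ : Fin k => V) W :=
    { toFun := fun x => (T x).toMultilinearMap
      map_add' := fun x y => by rw [map_add]; rfl
      map_smul' := fun a x => by rw [map_smul]; rfl }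
  refine ⟨{ T'.uncurryLeft with map_eq_zero_of_eq' := fun v i l hil hne => ?_ }, fun _ _ => rfl⟩
  change T (v 0) (Fin.tail v) = 0
  cases i using Fin.cases with
  | zero =>
    cases l using Fin.cases with
    | zero => exact absurd rfl hne
    | succ l => exact hT' hil
  | succ i =>
    cases l using Fin.cases with
    | zero => exact hT' hil.symm
    | succ l => exact (T (v 0)).map_eq_zero_of_eq (Fin.tail v) hil (mt (congrArg Fin.succ) hne)

lemma ceDiff_curryLeft_cons_self (X : Derivation R A A) (α : CE R A (k + 1))
    (Y : Fin k → Derivation R A A) :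
    ceDiff (α.curryLeft X) (Matrix.vecCons X Y) = lieDer X (α.curryLeft X) Y := by
  cases k with
  | zero =>
    rw [ceDiff_zero_degree, lieDer_apply, Finset.univ_eq_empty, Finset.sum_empty, sub_zero]
    exact congrArg (fun Y => X (α.curryLeft X Y)) (Subsingleton.elim _ _)
  | succ k =>
    refine (ceDiff_cons (α.curryLeft X) X Y).trans ?_
    have hzero : (fun Z => α.curryLeft X (Fin.cons X Z)) = fun _ => 0 :=
      funext fun Z => congrArg (fun β => β Z) (α.curryLeft_same X)
    rw [hzero, ceDiff_zero, sub_zero]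
    rfl

/-- The right hand side `X ↦ L_X α - d (ι_X α)` of Cartan's formula for `ι_X (d α)`, where `d` is
the differential in one degree less. -/
def cartanMap {d : CE R A k → CE R A (k + 1)} (hd : ∀ α X, d α X = ceDiff α X)
    (α : CE R A (k + 1)) : Derivation R A A →ₗ[A] CE R A (k + 1) where
  toFun X := lieDer X α - d (α.curryLeft X)
  map_add' X X' := AlternatingMap.ext fun Y => by
    have hadd := ceDiff_add (α.curryLeft X) (α.curryLeft X') Y
    simp only [AlternatingMap.sub_apply, AlternatingMap.add_apply, hd, map_add, lieDer_add_left]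
    rw [show ceDiff (⇑(α.curryLeft X + α.curryLeft X')) Y = _ from hadd]
    abel
  map_smul' f X := AlternatingMap.ext fun Y => by
    have hsmul := ceDiff_smul f (α.curryLeft X) Y
    have hsum (i : Fin (k + 1)) : (-1 : ℤ) ^ (i : ℕ) • (Y i f * α.curryLeft X (i.removeNth Y)) =
        Y i f * α (Function.update Y i X) := by
      rw [← mul_smul_comm, ← map_cons_removeNth]
      rfl
    simp only [AlternatingMap.sub_apply, AlternatingMap.smul_apply, hd, map_smul,
      lieDer_smul_left, RingHom.id_apply, smul_eq_mul]
    rw [show ceDiff (⇑(f • α.curryLeft X)) Y = _ from hsmul, Finset.sum_congr rfl fun i _ => hsum i]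
    ring

lemma cartanMap_apply {d : CE R A k → CE R A (k + 1)} (hd : ∀ α X, d α X = ceDiff α X)
    (α : CE R A (k + 1)) (X : Derivation R A A) (Y : Fin (k + 1) → Derivation R A A) :
    cartanMap hd α X Y = lieDer X α Y - ceDiff (α.curryLeft X) Y :=
  congrArg _ (hd _ _)

lemma cartanMap_curryLeft_self {d : CE R A k → CE R A (k + 1)} (hd : ∀ α X, d α X = ceDiff α X)
    (α : CE R A (k + 1)) (X : Derivation R A A) : (cartanMap hd α X).curryLeft X = 0 :=
  AlternatingMap.ext fun Y => by
    refine (cartanMap_apply hd α X (Matrix.vecCons X Y)).trans ?_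
    rw [lieDer_cons_self, ceDiff_curryLeft_cons_self, sub_self]
    rfl

lemma exists_forall_eq_ceDiff (k : ℕ) (α : CE R A k) :
    ∃ β : CE R A (k + 1), ∀ X, β X = ceDiff α X := by
  induction k with
  | zero =>
    obtain ⟨β, hβ⟩ := exists_uncurry_eq (k := 0) (A := A)
      { toFun := fun X => lieDer X α
        map_add' := fun X X' => AlternatingMap.ext fun Y => lieDer_add_left X X' α Y
        map_smul' := fun f X => AlternatingMap.ext fun Y => by
          rw [lieDer_smul_left, Finset.univ_eq_empty, Finset.sum_empty, add_zero]
          rfl } fun _ _ i => i.elim0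
    refine ⟨β, fun X => ?_⟩
    rw [← Matrix.cons_head_tail X, hβ, ceDiff_zero_degree]
    change Matrix.vecHead X (α _) - ∑ i : Fin 0, _ = Matrix.vecHead X (α _)
    rw [Finset.univ_eq_empty, Finset.sum_empty, sub_zero]
    exact congrArg (fun Y => Matrix.vecHead X (α Y)) (Subsingleton.elim _ _)
  | succ k ih =>
    choose d hd using ih
    obtain ⟨β, hβ⟩ := exists_uncurry_eq (cartanMap hd α) fun X =>
      curryLeft_eq_zero_iff.1 (cartanMap_curryLeft_self hd α X)
    refine ⟨β, fun X => ?_⟩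
    rw [← Matrix.cons_head_tail X, hβ, cartanMap_apply]
    exact (ceDiff_cons α (Matrix.vecHead X) (Matrix.vecTail X)).symm

/-- The exterior derivative of an alternating form on derivations. -/
def exteriorDeriv (α : CE R A k) : CE R A (k + 1) :=
  (exists_forall_eq_ceDiff k α).choose

lemma exteriorDeriv_apply (α : CE R A k) (X : Fin (k + 1) → Derivation R A A) :
    exteriorDeriv α X = ceDiff α X :=
  (exists_forall_eq_ceDiff k α).choose_spec X

end Derivations

section ExteriorDerivative

variable {E M E' M' : Type*} [NormedAddCommGroup E] [NormedSpace ℝ E] [FiniteDimensional ℝ E]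
  [TopologicalSpace M] [ChartedSpace E M] [IsManifold 𝓘(ℝ, E) ∞ M] [T2Space M]
  [NormedAddCommGroup E'] [NormedSpace ℝ E'] [FiniteDimensional ℝ E'] [TopologicalSpace M']
  [ChartedSpace E' M'] [IsManifold 𝓘(ℝ, E') ∞ M'] [T2Space M'] {h : M' → M} {k : ℕ}

/-- The exterior derivative of a differential form, transported from the forms on derivations. -/
def DiffForm.extDeriv (σ : DiffForm E M k) : DiffForm E M (k + 1) :=
  (formEquiv E M (k + 1)).symm (exteriorDeriv (formEquiv E M k σ))

lemma formEquiv_extDeriv (σ : DiffForm E M k) :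
    formEquiv E M (k + 1) (DiffForm.extDeriv σ) = exteriorDeriv (formEquiv E M k σ) :=
  (formEquiv E M (k + 1)).apply_symm_apply _

lemma DiffForm.eval_extDeriv (σ : DiffForm E M k) (V : Fin (k + 1) → VF E M) :
    DiffForm.eval (DiffForm.extDeriv σ) V = ceDiff (DiffForm.eval σ) V := by
  rw [← represents_formEquiv (DiffForm.extDeriv σ), formEquiv_extDeriv, exteriorDeriv_apply]
  refine map_ceDiff (fun D Y => Y.toDer = D) ?_ (AddMonoidHom.id (Fun E M)) ?_ ?_ fun i => rfl
  · rintro _ Y _ Y' rfl rfl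
    exact VF.toDer_lie Y Y'
  · rintro _ Y f rfl
    rfl
  · intro D Y hDY
    rw [← funext hDY]
    exact represents_formEquiv σ Y

lemma HasRelatedFields.pullbackForm_extDeriv (hr : HasRelatedFields E E' h)
    (hh : ContMDiff 𝓘(ℝ, E') 𝓘(ℝ, E) ∞ h) (σ : DiffForm E M k) :
    pullbackForm hh (DiffForm.extDeriv σ) = DiffForm.extDeriv (pullbackForm hh σ) :=
  hr.form_ext fun Y Z hYZ => by
    rw [eval_pullbackForm hh _ hYZ, DiffForm.eval_extDeriv, DiffForm.eval_extDeriv]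
    exact map_ceDiff (Restricts h) (fun H H' => H.lie hh H')
      (comapFun hh : Fun E M →+ Fun E' M') (fun f H => (H.lie_comapFun hh f).symm)
      (fun Y Z hYZ => (eval_pullbackForm hh σ hYZ).symm) hYZ

end ExteriorDerivative

section FormMultiplication

variable {E M E' M' : Type*} [NormedAddCommGroup E] [NormedSpace ℝ E] [FiniteDimensional ℝ E]
  [TopologicalSpace M] [ChartedSpace E M] [IsManifold 𝓘(ℝ, E) ∞ M] [NormedAddCommGroup E']
  [NormedSpace ℝ E'] [TopologicalSpace M'] [ChartedSpace E' M'] [IsManifold 𝓘(ℝ, E') ∞ M']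
  {h : M' → M} {k : ℕ}

/-- The multiplication of differential forms by smooth functions, pointwise. -/
instance DiffForm.instSMulFun : SMul (Fun E M) (DiffForm E M k) where
  smul f σ := ⟨fun x => f x • σ.1 x, fun V => (f * DiffForm.eval σ V).contMDiff⟩

variable [T2Space M]

lemma formEquiv_fun_smul (f : Fun E M) (σ : DiffForm E M k) :
    formEquiv E M k (f • σ) = f • formEquiv E M k σ := rfl

lemma pullbackForm_fun_smul [FiniteDimensional ℝ E'] (hh : ContMDiff 𝓘(ℝ, E') 𝓘(ℝ, E) ∞ h)
    (f : Fun E M) (σ : DiffForm E M k) :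
    pullbackForm hh (f • σ) = comapFun hh f • pullbackForm hh σ := rfl

end FormMultiplication

section FormReduction

variable {EM M E S E' Q : Type*} [NormedAddCommGroup EM] [NormedSpace ℝ EM]
  [FiniteDimensional ℝ EM] [TopologicalSpace M] [ChartedSpace EM M] [IsManifold 𝓘(ℝ, EM) ∞ M]
  [T2Space M] [SigmaCompactSpace M] [NormedAddCommGroup E] [NormedSpace ℝ E]
  [FiniteDimensional ℝ E] [TopologicalSpace S] [ChartedSpace E S] [IsManifold 𝓘(ℝ, E) ∞ S]
  [T2Space S] [SigmaCompactSpace S] [NormedAddCommGroup E'] [NormedSpace ℝ E']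
  [FiniteDimensional ℝ E'] [TopologicalSpace Q] [ChartedSpace E' Q] [IsManifold 𝓘(ℝ, E') ∞ Q]
  [T2Space Q] {j : S → M} {𝓓 : RegularFoliation E S} {π : S → Q} {k : ℕ}
  (hj : Manifold.IsSmoothEmbedding 𝓘(ℝ, E) 𝓘(ℝ, EM) ∞ j) (hcl : IsClosed (Set.range j))
  (hπ : 𝓓.IsLeafSpace (E' := E') π)

section

include hj hcl hπ

lemma formEquiv_mem_formWobs_iff_exists {σ : DiffForm EM M k} :
    formEquiv EM M k σ ∈ (symmetryData j 𝓓).formWobs k ↔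
      ∃ τ : DiffForm E' Q k, pullbackForm hπ.contMDiff τ = pullbackForm hj.contMDiff σ :=
  (formEquiv_mem_formWobs_iff hj hcl).trans hπ.mem_range_pullbackForm_iff.symm

lemma exists_pullbackForm_eq_of_mem_formWobs
    (α : (symmetryData (E := EM) j 𝓓).formWobs k) : ∃ τ : DiffForm E' Q k,
      pullbackForm hπ.contMDiff τ = pullbackForm hj.contMDiff ((formEquiv EM M k).symm α.1) :=
  (formEquiv_mem_formWobs_iff_exists hj hcl hπ).1 <| by
    rw [LinearEquiv.apply_symm_apply]
    exact α.2

end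

/-- The form on the leaf space to which a form on `M` with basic restriction to `S` reduces. -/
def reduceForm : (symmetryData (E := EM) j 𝓓).formWobs k →+ DiffForm E' Q k where
  toFun α := (exists_pullbackForm_eq_of_mem_formWobs hj hcl hπ α).choose
  map_zero' := hπ.pullbackForm_injective <| by
    rw [(exists_pullbackForm_eq_of_mem_formWobs hj hcl hπ 0).choose_spec, ZeroMemClass.coe_zero,
      map_zero, map_zero, map_zero]
  map_add' α β := hπ.pullbackForm_injective <| by
    rw [(exists_pullbackForm_eq_of_mem_formWobs hj hcl hπ (α + β)).choose_spec, map_add,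
      (exists_pullbackForm_eq_of_mem_formWobs hj hcl hπ α).choose_spec,
      (exists_pullbackForm_eq_of_mem_formWobs hj hcl hπ β).choose_spec, AddMemClass.coe_add,
      map_add, map_add]

lemma pullbackForm_reduceForm (α : (symmetryData (E := EM) j 𝓓).formWobs k) :
    pullbackForm hπ.contMDiff (reduceForm hj hcl hπ α) =
      pullbackForm hj.contMDiff ((formEquiv EM M k).symm α.1) :=
  (exists_pullbackForm_eq_of_mem_formWobs hj hcl hπ α).choose_spec

lemma reduceForm_eq_of_pullbackForm_eq {σ : DiffForm EM M k}
    {α : (symmetryData (E := EM) j 𝓓).formWobs k} (hσ : formEquiv EM M k σ = α.1)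
    {τ : DiffForm E' Q k} (hτ : pullbackForm hπ.contMDiff τ = pullbackForm hj.contMDiff σ) :
    reduceForm hj hcl hπ α = τ :=
  hπ.pullbackForm_injective <| by
    rw [pullbackForm_reduceForm, hτ, ← hσ, LinearEquiv.symm_apply_apply]

lemma ker_reduceForm : (reduceForm (k := k) hj hcl hπ).ker =
    (((symmetryData (E := EM) j 𝓓).formNull k).comap
      ((symmetryData (E := EM) j 𝓓).formWobs k).subtype).toAddSubgroup := by
  ext α
  rw [AddMonoidHom.mem_ker, ← hπ.pullbackForm_injective.eq_iff, pullbackForm_reduceForm, map_zero,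
    ← formEquiv_mem_formNull_iff hj hcl (𝓓 := 𝓓), LinearEquiv.apply_symm_apply]
  rfl

lemma reduceForm_surjective : Function.Surjective (reduceForm (k := k) hj hcl hπ) := fun τ => by
  obtain ⟨σ, hσ⟩ := pullbackForm_surjective hj hcl (pullbackForm hπ.contMDiff τ)
  exact ⟨⟨formEquiv EM M k σ, (formEquiv_mem_formWobs_iff_exists hj hcl hπ).2 ⟨τ, hσ.symm⟩⟩,
    reduceForm_eq_of_pullbackForm_eq hj hcl hπ rfl hσ.symm⟩

lemma reduceForm_smul (f : (symmetryData (E := EM) j 𝓓).algWobs)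
    (α : (symmetryData (E := EM) j 𝓓).formWobs k) :
    reduceForm hj hcl hπ ⟨f • α.1, Submodule.smul_mem _ f α.2⟩ =
      reduceFun hj hcl hπ f • reduceForm hj hcl hπ α := by
  refine reduceForm_eq_of_pullbackForm_eq hj hcl hπ (σ := f.1 • (formEquiv EM M k).symm α.1) ?_ ?_
  · rw [formEquiv_fun_smul, LinearEquiv.apply_symm_apply]
    rfl
  · rw [pullbackForm_fun_smul, pullbackForm_fun_smul, comapFun_reduceFun, pullbackForm_reduceForm]

variable (k) in
/-- The isomorphism of the reduced forms with the differential forms on the leaf space. -/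
def formRedEquiv : (symmetryData (E := EM) j 𝓓).FormRed k ≃ₗ[ℝ] DiffForm E' Q k where
  __ := (QuotientAddGroup.quotientAddEquivOfEq (ker_reduceForm hj hcl hπ).symm).trans
    (QuotientAddGroup.quotientKerEquivOfSurjective _ (reduceForm_surjective hj hcl hπ))
  map_smul' c x := by
    obtain ⟨α, hα, rfl⟩ := Red.exists_mk x
    refine (reduceForm_smul hj hcl hπ (algebraMap ℝ _ c) ⟨α, hα⟩).trans ?_
    rw [AlgHom.commutes]
    rfl

lemma Represents.pullback_formRedEquiv {α : CE ℝ (Fun EM M) k} {σ : DiffForm EM M k}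
    (h : Represents σ α) (hα : α ∈ (symmetryData (E := EM) j 𝓓).formWobs k) (s : S) :
    pullback (E' := E) π (formRedEquiv k hj hcl hπ (SymmetryData.formMk _ α hα)).1 s =
      pullback j σ.1 s := by
  obtain rfl := represents_iff.1 h
  have hpull := pullbackForm_reduceForm hj hcl hπ ⟨_, hα⟩
  rw [LinearEquiv.symm_apply_apply] at hpull
  exact congrFun (congrArg Subtype.val hpull) s

lemma formRedEquiv_smul_apply (a : (symmetryData (E := EM) j 𝓓).AlgRed)
    (x : (symmetryData (E := EM) j 𝓓).FormRed k) (q : Q) :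
    (formRedEquiv k hj hcl hπ (a • x)).1 q =
      algRedEquiv hj hcl hπ a q • (formRedEquiv k hj hcl hπ x).1 q := by
  obtain ⟨f, rfl⟩ := Ideal.Quotient.mk_surjective a
  obtain ⟨α, hα, rfl⟩ := Red.exists_mk x
  exact congrArg (fun τ : DiffForm E' Q k => τ.1 q) (reduceForm_smul hj hcl hπ f ⟨α, hα⟩)

lemma exists_formRedEquiv_eq_ceDiff {α : CE ℝ (Fun EM M) k}
    (hα : α ∈ (symmetryData (E := EM) j 𝓓).formWobs k) : ∃ β : CE ℝ (Fun EM M) (k + 1),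
      ∃ hβ : β ∈ (symmetryData (E := EM) j 𝓓).formWobs (k + 1), (∀ X, β X = ceDiff α X) ∧
        ∀ V, DiffForm.eval (formRedEquiv (k + 1) hj hcl hπ (SymmetryData.formMk _ β hβ)) V =
          ceDiff (DiffForm.eval (formRedEquiv k hj hcl hπ (SymmetryData.formMk _ α hα))) V := by
  let τ := reduceForm hj hcl hπ ⟨α, hα⟩
  let σ := (formEquiv EM M k).symm α
  have hd : formEquiv EM M (k + 1) (DiffForm.extDeriv σ) = exteriorDeriv α := by
    rw [formEquiv_extDeriv, LinearEquiv.apply_symm_apply]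
  have hpull : pullbackForm hπ.contMDiff (DiffForm.extDeriv τ) =
      pullbackForm hj.contMDiff (DiffForm.extDeriv σ) := by
    rw [hπ.hasRelatedFields.pullbackForm_extDeriv, pullbackForm_reduceForm,
      (hasRelatedFields_of_isSmoothEmbedding hj hcl).pullbackForm_extDeriv]
  have hmem : exteriorDeriv α ∈ (symmetryData (E := EM) j 𝓓).formWobs (k + 1) :=
    hd ▸ (formEquiv_mem_formWobs_iff_exists hj hcl hπ).2 ⟨_, hpull⟩
  have hred : reduceForm hj hcl hπ ⟨_, hmem⟩ = DiffForm.extDeriv τ :=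
    reduceForm_eq_of_pullbackForm_eq hj hcl hπ hd hpull
  exact ⟨_, hmem, exteriorDeriv_apply α, fun V =>
    (congrArg (fun θ => DiffForm.eval θ V) hred).trans (DiffForm.eval_extDeriv τ V)⟩

lemma exists_formRedEquiv_eq_contract {α : CE ℝ (Fun EM M) (k + 1)}
    (hα : α ∈ (symmetryData (E := EM) j 𝓓).formWobs (k + 1))
    (X : (symmetryData (E := EM) j 𝓓).lieWobs) :
    ∃ h : contract X.1 α ∈ (symmetryData (E := EM) j 𝓓).formWobs k,
      ∀ q (v : Fin k → TangentSpace 𝓘(ℝ, E') q),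
        (formRedEquiv k hj hcl hπ (SymmetryData.formMk _ _ h)).1 q v =
          (formRedEquiv (k + 1) hj hcl hπ (SymmetryData.formMk _ α hα)).1 q
            (Matrix.vecCons (lieRedHom hj hcl hπ (LieSubmodule.Quotient.mk X) q) v) := by
  let τ := reduceForm hj hcl hπ ⟨α, hα⟩
  let σ := (formEquiv EM M (k + 1)).symm α
  obtain ⟨Z, hY, hV⟩ := reducesTo_reduceVF hj hcl hπ X
  have hι : formEquiv EM M k (DiffForm.contract (derEquiv.symm X.1) σ) = contract X.1 α := by
    rw [formEquiv_contract, LinearEquiv.apply_symm_apply, toDer_derEquiv_symm]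
  have hpull : pullbackForm hπ.contMDiff (DiffForm.contract (reduceVF hj hcl hπ X) τ) =
      pullbackForm hj.contMDiff (DiffForm.contract (derEquiv.symm X.1) σ) := by
    rw [pullbackForm_contract _ hV, pullbackForm_reduceForm, pullbackForm_contract _ hY]
  have hmem : contract X.1 α ∈ (symmetryData (E := EM) j 𝓓).formWobs k :=
    hι ▸ (formEquiv_mem_formWobs_iff_exists hj hcl hπ).2 ⟨_, hpull⟩
  have hred : reduceForm hj hcl hπ ⟨_, hmem⟩ = DiffForm.contract (reduceVF hj hcl hπ X) τ :=
    reduceForm_eq_of_pullbackForm_eq hj hcl hπ hι hpull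
  exact ⟨hmem, fun q v => congrArg (fun θ : DiffForm E' Q k => θ.1 q v) hred⟩

end FormReduction

end

end ConstraintReduction

theorem mainTheorem8
    {EM M ES S EQ Q : Type*}
    [NormedAddCommGroup EM] [NormedSpace ℝ EM] [FiniteDimensional ℝ EM]
    [TopologicalSpace M] [ChartedSpace EM M] [IsManifold 𝓘(ℝ, EM) ∞ M]
    [T2Space M] [SecondCountableTopology M]
    [NormedAddCommGroup ES] [NormedSpace ℝ ES] [FiniteDimensional ℝ ES]
    [TopologicalSpace S] [ChartedSpace ES S] [IsManifold 𝓘(ℝ, ES) ∞ S]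
    [NormedAddCommGroup EQ] [NormedSpace ℝ EQ] [FiniteDimensional ℝ EQ]
    [TopologicalSpace Q] [ChartedSpace EQ Q] [IsManifold 𝓘(ℝ, EQ) ∞ Q]
    [T2Space Q] [SecondCountableTopology Q]
    -- the closed embedded submanifold `S`, the foliation and its leaf space `π : S → Q`
    (j : S → M) (hj : Manifold.IsSmoothEmbedding 𝓘(ℝ, ES) 𝓘(ℝ, EM) ∞ j)
    (hcl : IsClosed (Set.range j))
    (𝓓 : ConstraintReduction.RegularFoliation ES S)
    (π : S → Q) (hπ : 𝓓.IsLeafSpace (E' := EQ) π)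
    (P : ConstraintReduction.SymmetryData ℝ (ConstraintReduction.Fun EM M))
    (hP : P = ConstraintReduction.symmetryData j 𝓓) :
    -- derivations of `C^∞(M)` are vector fields, forms on derivations are differential forms
    Function.Bijective (ConstraintReduction.VF.toDer (E := EM) (M := M)) ∧
    (∀ k, (∀ α : ConstraintReduction.CE ℝ (ConstraintReduction.Fun EM M) k,
        ∃! σ : ConstraintReduction.DiffForm EM M k, ConstraintReduction.Represents σ α) ∧
      ∀ σ : ConstraintReduction.DiffForm EM M k,
        ∃! α : ConstraintReduction.CE ℝ (ConstraintReduction.Fun EM M) k,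
          ConstraintReduction.Represents σ α) ∧
    -- the constraint objects before reduction, in geometric terms
    (∀ f : ConstraintReduction.Fun EM M,
      f ∈ P.algWobs ↔ ∀ s t, 𝓓.SameLeaf s t → f (j s) = f (j t)) ∧
    (∀ X ∈ P.F, X ∈ P.lieWobs) ∧
    (∀ k, P.formNull k ≤ P.formWobs k) ∧
    (∀ Y : ConstraintReduction.VF EM M, Y.toDer ∈ P.lieWobs ↔
      ∃ Z : ConstraintReduction.VF ES S, ConstraintReduction.Restricts j Y Z ∧
        ∀ W ∈ ConstraintReduction.secs 𝓓.D, ⁅Z, W⁆ ∈ ConstraintReduction.secs 𝓓.D) ∧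
    (∀ Y : ConstraintReduction.VF EM M, Y.toDer ∈ P.F ↔
      ∃ Z ∈ ConstraintReduction.secs 𝓓.D, ConstraintReduction.Restricts j Y Z) ∧
    (∀ k (α : ConstraintReduction.CE ℝ (ConstraintReduction.Fun EM M) k)
      (σ : ConstraintReduction.DiffForm EM M k), ConstraintReduction.Represents σ α →
      (α ∈ P.formWobs k ↔ 𝓓.IsBasic (ConstraintReduction.pullback j σ.1)) ∧
      (α ∈ P.formNull k ↔
        ∀ s : S, ConstraintReduction.pullback (E' := ES) j σ.1 s = 0)) ∧
    -- the reduced objects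
    ∃ φ : P.AlgRed ≃ₐ[ℝ] ConstraintReduction.Fun EQ Q,
    ∃ Φ : LieRinehartAlgebra.Hom φ.toAlgHom
      P.LieRed (ConstraintReduction.VF EQ Q),
    ∃ Ψ : ∀ k, P.FormRed k ≃ₗ[ℝ] ConstraintReduction.DiffForm EQ Q k,
      -- the canonical identification of the reduced algebra with `C^∞(Q)`
      (∀ (f : P.algWobs) (s : S), φ (Ideal.Quotient.mk P.algNull f) (π s) = f.1 (j s)) ∧
      -- the reduced Lie-Rinehart algebra is `𝔛(Q)`
      Function.Bijective (fun x => Φ x) ∧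
      (∀ (X : P.lieWobs) (Y : ConstraintReduction.VF EM M) (Z : ConstraintReduction.VF ES S),
        Y.toDer = X.1 → ConstraintReduction.Restricts j Y Z → ∀ s : S,
          Φ (LieSubmodule.Quotient.mk X) (π s) = mfderiv 𝓘(ℝ, ES) 𝓘(ℝ, EQ) π s (Z s)) ∧
      -- the reduced forms are `Ω(Q)`
      (∀ k (α : ConstraintReduction.CE ℝ (ConstraintReduction.Fun EM M) k)
        (hα : α ∈ P.formWobs k) (σ : ConstraintReduction.DiffForm EM M k),
        ConstraintReduction.Represents σ α → ∀ s : S,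
          ConstraintReduction.pullback (E' := ES) π (Ψ k (P.formMk α hα)).1 s =
            ConstraintReduction.pullback (E' := ES) j σ.1 s) ∧
      -- compatibility with multiplication by functions
      (∀ k (a : P.AlgRed) (x : P.FormRed k) (q : Q),
        (Ψ k (a • x)).1 q = φ a q • (Ψ k x).1 q) ∧
      -- compatibility with the differentials
      (∀ k (α : ConstraintReduction.CE ℝ (ConstraintReduction.Fun EM M) k)
        (hα : α ∈ P.formWobs k),
        ∃ β : ConstraintReduction.CE ℝ (ConstraintReduction.Fun EM M) (k + 1),
        ∃ hβ : β ∈ P.formWobs (k + 1),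
          (∀ X, β X = ConstraintReduction.ceDiff α X) ∧
          ∀ V : Fin (k + 1) → ConstraintReduction.VF EQ Q,
            ConstraintReduction.DiffForm.eval (Ψ (k + 1) (P.formMk β hβ)) V =
              ConstraintReduction.ceDiff
                (ConstraintReduction.DiffForm.eval (Ψ k (P.formMk α hα))) V) ∧
      -- compatibility with contractions
      (∀ k (α : ConstraintReduction.CE ℝ (ConstraintReduction.Fun EM M) (k + 1))
        (hα : α ∈ P.formWobs (k + 1)) (X : P.lieWobs),
        ∃ h : ConstraintReduction.contract X.1 α ∈ P.formWobs k,
          ∀ (q : Q) (v : Fin k → TangentSpace 𝓘(ℝ, EQ) q),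
            (Ψ k (P.formMk (ConstraintReduction.contract X.1 α) h)).1 q v =
              (Ψ (k + 1) (P.formMk α hα)).1 q
                (Matrix.vecCons (Φ (LieSubmodule.Quotient.mk X) q) v)) := by
  subst hP
  have : T2Space S := hj.isEmbedding.t2Space
  have : SecondCountableTopology S := hj.isEmbedding.secondCountableTopology
  have : LocallyCompactSpace M := ChartedSpace.locallyCompactSpace EM M
  have : LocallyCompactSpace S := ChartedSpace.locallyCompactSpace ES S
  open ConstraintReduction in
  refine ⟨VF.toDer_bijective, fun k => ⟨existsUnique_represents, existsUnique_represented⟩,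
    fun f => mem_algWobs_iff_sameLeaf hj hcl hπ, fun X hX => F_le_lieWobs hj hcl hX,
    fun k => formNull_le_formWobs hj hcl, fun Y => mem_lieWobs_iff hj hcl,
    fun Y => mem_symmetryData_F_iff hj hcl,
    fun k α σ h => ⟨h.mem_formWobs_iff hj hcl, h.mem_formNull_iff hj hcl⟩,
    algRedEquiv hj hcl hπ, lieRedHom hj hcl hπ, fun k => formRedEquiv k hj hcl hπ,
    algRedEquiv_mk_apply hj hcl hπ, lieRedHom_bijective hj hcl hπ,
    fun X Y Z hY hZ => lieRedHom_mk_apply hj hcl hπ hY hZ,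
    fun k α hα σ h => h.pullback_formRedEquiv hj hcl hπ hα,
    fun k => formRedEquiv_smul_apply hj hcl hπ,
    fun k α hα => exists_formRedEquiv_eq_ceDiff hj hcl hπ hα,
    fun k α hα X => exists_formRedEquiv_eq_contract hj hcl hπ hα X⟩
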